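/- **Setting.** Let $n\ge 2$ and let $H_n=\mathbb R^{2n+1}$ be the Heisenberg group with coordinates $(x^1,\dots,x^{2n},z)$, left-invariant horizontal frame $\hat e_j=\partial_{x^j}+x^{n+j}\partial_z$, $\hat e_{j'}=\partial_{x^{n+j}}-x^j\partial_z$ $(1\le j\le n)$, volume form $dv=dx^1\wedge\dots\wedge dx^{2n}\wedge dz$, and the degenerate inner product on covectors $\langle\omega,\eta\rangle^*=\sum_{j=1}^n\big(\omega(\hat e_j)\eta(\hat e_j)+\omega(\hat e_{j'})\eta(\hat e_{j'})\big)$, $|\omega|_*^2=\langle\omega,\omega\rangle^*$. Let $G(\eta)$ be the vector with $\omega(G(\eta))=\langle\omega,\eta\rangle^*$ for all $\omega$. For $a\in\mathbb R$ let $$l_a(x^1,\dots,x^{2n},z)=(x^1+a,x^2,\dots,x^{2n},z-a\,x^{n+1})$$ be the Heisenberg translation in the direction $\partial/\partial x^1$. **Mean curvature.** Let $p\ge 0$, let $\Sigma\subset H_n$ be a $C^\infty$ hypersurface near $q\in\Sigma$, and suppose that near $q$ it is $\{\phi=0\}$ for a $C^\infty$ function $\phi$ with $d\phi\ne0$, $|d\phi|_*\neq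 0$, which is compatible with the translations: $\phi(l_a(x))=\phi(x)-a$ for $x$ near $q$ and $a$ near $0$ (such a $\phi$ is determined by $\Sigma$ near $q$). Put $\nu_p=G(d\phi)/|d\phi|_*^{1-p}$ and let $dv_{\phi,p}$ be the $2n$-form $\nu_p\lrcorner dv$. The $p$-mean curvature $H_{\Sigma,p}$ is the continuous function on $\Sigma$ near $q$ given by the first variation formula $$\delta_{f\nu_p}\int_\Sigma dv_{\phi,p}=\int_\Sigma f\,H_{\Sigma,p}\,dv_{\phi,p}$$ for all smooth $f$ with compact support in $\Sigma$ near $q$, where $\delta_{f\nu_p}$ is the derivative at $t=0$ when $\Sigma$ moves with initial velocity $f\nu_p$ (the form $dv_{\phi,p}$ being kept fixed). **Corollary D.** Let $p\ge0$ and let $\Sigma_1,\Sigma_2\subset H_n$, $n\ge2$, be subsets containing $p_0$ that are $C^\infty$ hypersurfaces near $p_0$. Suppose that both have Euclidean unit normal $-\partial/\partial x^1$ at $p_0$ (so they are tangent at $p_0$ along a vertical hyperplane). Suppose that for all $q\in\Sigma_1$ near $p_0$ there is a number $a(q)\ge0$, with $a(q)\to0$ as $q\to p_0$, such that $l_{a(q)}(q)\in\Sigma_2$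 and $$H_{\Sigma_2,p}\big(l_{a(q)}(q)\big)\le H_{\Sigma_1,p}(q).$$ Then $\Sigma_1$ and $\Sigma_2$ coincide near $p_0$, i.e. $\Sigma_1\cap U=\Sigma_2\cap U$ for some neighborhood $U$ of $p_0$. -/

import Mathlib

open Filter MeasureTheory
open scoped Topology ContDiff

noncomputable section

namespace Heisenberg

/-- The Heisenberg group `H_n` in its global coordinates
`(x_1, …, x_n, y_1, …, y_n, z)`: `inl (inl j)` is the index of `x_j`, `inl (inr j)` that of
`y_j = x^{n+j}` and `inr ()` that of `z`. -/
abbrev Heis (n : ℕ) : Type := (Fin n ⊕ Fin n) ⊕ Unit → ℝ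

/-- The coordinate vector `∂/∂x_j`. -/
def ddx {n : ℕ} (j : Fin n) : Heis n := Pi.single (Sum.inl (Sum.inl j)) 1

/-- The coordinate vector `∂/∂y_j`. -/
def ddy {n : ℕ} (j : Fin n) : Heis n := Pi.single (Sum.inl (Sum.inr j)) 1

/-- The coordinate vector `∂/∂z`. -/
def ddz {n : ℕ} : Heis n := Pi.single (Sum.inr ()) 1

/-- The Heisenberg translation
`l_a (x_1, …, x_n, y_1, …, y_n, z) = (x_1 + a, x_2, …, x_n, y_1, …, y_n, z - a y_1)`, that is, left
multiplication by `(a, 0, …, 0)`. -/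
def lTrans {n : ℕ} [NeZero n] (a : ℝ) (q : Heis n) : Heis n :=
  q + a • (ddx 0 - q (Sum.inl (Sum.inr 0)) • ddz)

/-- The left invariant horizontal frame `ê_j = ∂/∂x_j + y_j ∂/∂z`, `ê_{j'} = ∂/∂y_j - x_j ∂/∂z`. -/
def frame {n : ℕ} : Fin n ⊕ Fin n → Heis n → Heis n
  | Sum.inl j, q => ddx j + q (Sum.inl (Sum.inr j)) • ddz
  | Sum.inr j, q => ddy j - q (Sum.inl (Sum.inl j)) • ddz

/-- The degenerate inner product `⟨·,·⟩^*` on the cotangent space at `q`, for which `dx_j`, `dy_j`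
are orthonormal and `Θ = dz + ∑ (x_j dy_j - y_j dx_j)` is in the kernel. (The coframe
`dx_j, dy_j, Θ` is dual to `ê_j, ê_{j'}, ∂/∂z`.) -/
def coInner {n : ℕ} (q : Heis n) (α η : Heis n →L[ℝ] ℝ) : ℝ :=
  ∑ k, α (frame k q) * η (frame k q)

/-- The length `|α|_*` of a covector at `q`. -/
def coNorm {n : ℕ} (q : Heis n) (α : Heis n →L[ℝ] ℝ) : ℝ := √(coInner q α α)

/-- The map `G : T^*_q → T_q` with `α (G η) = ⟨α, η⟩^*`. -/
def sharp {n : ℕ} (q : Heis n) (η : Heis n →L[ℝ] ℝ) : Heis n :=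
  ∑ k, η (frame k q) • frame k q

/-- The standard volume form `dx_1 ∧ … ∧ dx_n ∧ dy_1 ∧ … ∧ dy_n ∧ dz`
(`= dx_1 ∧ … ∧ dy_n ∧ Θ`). -/
def volForm (n : ℕ) : Heis n [⋀^(Fin n ⊕ Fin n) ⊕ Unit]→ₗ[ℝ] ℝ := Matrix.detRowAlternating

/-- The `p`-normal `ν_p = G(dφ) / |dφ|_*^{1-p}` of the level sets of `φ`. -/
def pNormal {n : ℕ} (p : ℝ) (φ : Heis n → ℝ) (q : Heis n) : Heis n :=
  (coNorm q (fderiv ℝ φ q) ^ (1 - p))⁻¹ • sharp q (fderiv ℝ φ q)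

/-- The `p`-area form `dv_{φ,p} = (dφ / |dφ|_*^{1-p}) ⌟ dv = ν_p ⌟ dv`, a `2n`-form. The vector
`ν_p` is put in the last slot; moving it there past `2n` vectors does not change the sign. -/
def areaForm {n : ℕ} (p : ℝ) (φ : Heis n → ℝ) (q : Heis n) (v : Fin n ⊕ Fin n → Heis n) : ℝ :=
  volForm n (Sum.elim v fun _ => pNormal p φ q)

/-- The coefficient at `y` of the pullback by `γ : ℝ^{2n} → H_n` of a `2n`-form `α`. -/
def pullback {n : ℕ} (α : Heis n → (Fin n ⊕ Fin n → Heis n) → ℝ)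
    (γ : (Fin n ⊕ Fin n → ℝ) → Heis n) (y : Fin n ⊕ Fin n → ℝ) : ℝ :=
  α (γ y) fun k => fderiv ℝ γ y (Pi.single k 1)

/-- `φ` is a smooth defining function of the hypersurface `S` in the open set `U`. -/
structure IsDefiningFunction {n : ℕ} (φ : Heis n → ℝ) (S U : Set (Heis n)) : Prop where
  isOpen : IsOpen U
  contDiffOn : ContDiffOn ℝ ∞ φ U
  fderiv_ne_zero : ∀ x ∈ U, fderiv ℝ φ x ≠ 0
  mem_iff : ∀ x ∈ U, x ∈ S ↔ φ x = 0

/-- `φ` is compatible in `U` with the translations `l_a`: `φ (l_a x) = φ x - a` for small `a`. -/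
def IsCompatible {n : ℕ} [NeZero n] (φ : Heis n → ℝ) (U : Set (Heis n)) : Prop :=
  ∃ δ > 0, ∀ x ∈ U, ∀ a : ℝ, |a| < δ → lTrans a x ∈ U → φ (lTrans a x) = φ x - a

/-- Near `q ∈ S` the set `S` is a smooth hypersurface whose Euclidean unit normal at `q` is `N`
(the Euclidean gradient at `q` of a defining function is a positive multiple of `N`). -/
def HasUnitNormalAt {n : ℕ} (S : Set (Heis n)) (q N : Heis n) : Prop :=
  q ∈ S ∧ N ⬝ᵥ N = 1 ∧ ∃ U φ, IsDefiningFunction φ S U ∧ q ∈ U ∧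
    ∃ c > 0, ∀ v, fderiv ℝ φ q v = c * (N ⬝ᵥ v)

/-- The continuous function `H` on `S ∩ V` satisfies the first variation formula
`δ_{f ν_p} ∫_S dv_{φ,p} = ∫_S f H dv_{φ,p}` for all test functions `f` supported in a coordinate
patch `γ : B → S ∩ V`; here `f` is written in the coordinates of the patch, and the variation moves
`γ y` to `γ y + t f(y) ν_p(γ y)`. The part of `S` outside the support of `f` does not move and is
left out of the integrals, so that all of them are over compact sets. -/
def SatisfiesFirstVariation {n : ℕ} (p : ℝ) (φ : Heis n → ℝ) (S V : Set (Heis n))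
    (H : Heis n → ℝ) : Prop :=
  ContinuousOn H (S ∩ V) ∧
    ∀ (B : Set (Fin n ⊕ Fin n → ℝ)) (γ : (Fin n ⊕ Fin n → ℝ) → Heis n),
      IsOpen B → ContDiffOn ℝ ∞ γ B → Set.InjOn γ B →
      (∀ y ∈ B, Function.Injective (fderiv ℝ γ y)) → Set.MapsTo γ B (S ∩ V) →
      ∀ f : (Fin n ⊕ Fin n → ℝ) → ℝ, ContDiff ℝ ∞ f → HasCompactSupport f → tsupport f ⊆ B →
        HasDerivAt
          (fun t : ℝ => ∫ y in tsupport f,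
            pullback (areaForm p φ) (fun w => γ w + (t * f w) • pNormal p φ (γ w)) y)
          (∫ y in tsupport f, f y * H (γ y) * pullback (areaForm p φ) γ y) 0

/-- `h` is the value at the nonsingular point `q ∈ S` of the `p`-mean curvature of `S`, computed with
a defining function near `q` that is compatible with the translations `l_a`. (Such a function is
determined by `S` near `q`.) -/
def IsMeanCurvatureAt {n : ℕ} [NeZero n] (S : Set (Heis n)) (p : ℝ) (q : Heis n) (h : ℝ) : Prop :=
  q ∈ S ∧ ∃ V φ, IsDefiningFunction φ S V ∧ q ∈ V ∧ IsCompatible φ V ∧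
    (∀ x ∈ V, coNorm x (fderiv ℝ φ x) ≠ 0) ∧
    ∃ H : Heis n → ℝ, SatisfiesFirstVariation p φ S V H ∧ H q = h

open Classical in
/-- The `p`-mean curvature `H_{S,p}(q)` (with the value `0` where it is not defined). -/
def meanCurvature {n : ℕ} [NeZero n] (S : Set (Heis n)) (p : ℝ) (q : Heis n) : ℝ :=
  if h : ∃ c, IsMeanCurvatureAt S p q c then h.choose else 0

end Heisenberg

end

/-! The translations have one-dimensional orbits, and near `p₀` both hypersurfaces are graphs x_1 =
u₁, x_1 = u₂ over the 2n-dimensional orbit space, with du₁ = du₂ = 0 at the orbit of `p₀`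
(`HasUnitNormalAt.exists_graph`). A compatible defining function must be u − x_1, the first
variation of the area is the divergence of ν_p, and the horizontal frame descends to fields Y_k on
the orbit space. Hence the mean curvature is a quasilinear operator Q(u) built from the Y_k u and
Y_k Y_l u (`meanCurvature_eq_curvOp`). The hypothesis turns into u₁ ≤ u₂ and Q(u₂) ≤ Q(u₁) with
contact at one point, and the claim into a strong maximum principle (`eventually_eq_of_curvOp_le`).

The difficulty is degeneracy. Write v for the horizontal gradient of u₁ − x_1, with component v_0
along the first frame field. For p = 0 the symbol of the linearization Λ at u₁ vanishes on covectors
whose values on the Y_k are proportional to v. For every p ≥ 0 it still controls the 2n − 1 fields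
X_k = Y_k − (v_k/v_0) Y_0, and for n ≥ 2 two of them have a commutator transversal to all of them.

The argument is of Bony's type, on the contact set Z = {u₁ = u₂}. At a point of Z, Λ is nonpositive
on every function with a local maximum along Z (`linCurvOp_nonpos_of_contact`), so the differential
of such a function annihilates all X_k (`IsContactOperator.characteristic`). If Z were not a
neighbourhood, a nearest point z of Z to a point outside would carry an exterior ball whose normal
annihilates the X_k (`mem_nhds_of_isContactOperator`). This is refuted by a barrier Φ whose
quadratic part absorbs the symmetric part of the derivative of the X_k
(`false_of_exterior_paraboloid`): at its maximum along Z near z, the equations X_i Φ = X_j Φ = 0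
retain the antisymmetric part, that is the commutator, which forces the maximum to be z; but Φ is
built so that ΛΦ > 0 there. -/

noncomputable section

namespace Heisenberg

/-! ### Propagation of contact along a step-two distribution -/

section Propagation

variable {ι : Type*} [DecidableEq ι]

/-- The vector field `∂_k + g_k ∂_s`. -/
def contactField (s : ι) (g : (ι → ℝ) → ι → ℝ) (k : ι) (z : ι → ℝ) : ι → ℝ :=
  Pi.single k 1 + g z k • Pi.single s 1

theorem contactField_apply_self {s k : ι} (hk : k ≠ s) (g : (ι → ℝ) → ι → ℝ) (x : ι → ℝ) :
    contactField s g k x s = g x k := by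
  simp [contactField, hk.symm]

theorem contactField_apply_of_ne {s k l : ι} (hl : l ≠ s) (g : (ι → ℝ) → ι → ℝ) (x : ι → ℝ) :
    contactField s g k x l = if l = k then 1 else 0 := by
  simp [contactField, Pi.single_apply, hl]

variable [Fintype ι]

/-- `Λ` is a second order operator at `z`, nonpositive on functions whose restriction to `Z` has a
local maximum at `z`, whose principal symbol is nonnegative and vanishes only on covectors
annihilating the vectors `∂_k + g_k ∂_s`, `k ≠ s`. -/
structure IsContactOperator (s : ι) (g : (ι → ℝ) → ι → ℝ) (Z : Set (ι → ℝ)) (z : ι → ℝ)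
    (Λ : ((ι → ℝ) → ℝ) → ℝ) : Prop where
  add_mul : ∀ Φ Ψ : (ι → ℝ) → ℝ, ContDiff ℝ ∞ Φ → ContDiff ℝ ∞ Ψ → ∀ c : ℝ,
    Λ (fun x => Φ x + c * Ψ x) = Λ Φ + c * Λ Ψ
  contact : ∀ Φ : (ι → ℝ) → ℝ, ContDiff ℝ ∞ Φ → (∀ᶠ x in 𝓝 z, x ∈ Z → Φ x ≤ Φ z) → Λ Φ ≤ 0
  sq_nonneg : ∀ h : (ι → ℝ) → ℝ, ContDiff ℝ ∞ h → h z = 0 → 0 ≤ Λ fun x => h x ^ 2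
  fderiv_eq_zero : ∀ h : (ι → ℝ) → ℝ, ContDiff ℝ ∞ h → h z = 0 → (Λ fun x => h x ^ 2) = 0 →
    ∀ k ≠ s, fderiv ℝ h z (contactField s g k z) = 0
  sq_eq_zero : ∀ h : (ι → ℝ) → ℝ, ContDiff ℝ ∞ h → h z = 0 → fderiv ℝ h z = 0 →
    (Λ fun x => h x ^ 2) = 0

/-- Adding α(Φ − Φ(z))² keeps the local maximum along Z, since t + αt² = t(1 + αt) ≤ 0 for small t ≤
0. If the symbol were positive at dΦ, a large α would make Λ positive on the sum, against `contact`.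
-/
theorem IsContactOperator.characteristic {s : ι} {g : (ι → ℝ) → ι → ℝ} {Z : Set (ι → ℝ)}
    {z : ι → ℝ} {Λ : ((ι → ℝ) → ℝ) → ℝ} (hΛ : IsContactOperator s g Z z Λ) {Φ : (ι → ℝ) → ℝ}
    (hΦ : ContDiff ℝ ∞ Φ) (hmax : ∀ᶠ x in 𝓝 z, x ∈ Z → Φ x ≤ Φ z) {k : ι} (hk : k ≠ s) :
    fderiv ℝ Φ z (contactField s g k z) = 0 := by
  have hh : ContDiff ℝ ∞ fun x => Φ x - Φ z := hΦ.sub contDiff_const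
  have hfd : fderiv ℝ (fun x => Φ x - Φ z) z = fderiv ℝ Φ z := fderiv_sub_const _
  set q := Λ fun x => (Φ x - Φ z) ^ 2 with hq
  have hq0 : 0 ≤ q := hΛ.sq_nonneg _ hh (sub_self _)
  rcases hq0.eq_or_lt with h0 | hpos
  · rw [← hfd]
    exact hΛ.fderiv_eq_zero _ hh (sub_self _) h0.symm k hk
  exfalso
  obtain ⟨α, hα0, hα⟩ : ∃ α : ℝ, 0 < α ∧ 0 < Λ Φ + α * q := by
    refine ⟨(|Λ Φ| + 1) / q, by positivity, ?_⟩
    rw [div_mul_cancel₀ _ hpos.ne']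
    linarith [neg_abs_le (Λ Φ)]
  have h1 := hΛ.contact (fun x => Φ x + α * (Φ x - Φ z) ^ 2)
    (hΦ.add (contDiff_const.mul (hh.pow 2))) (by
      have hc : ∀ᶠ x in 𝓝 z, α * (Φ z - Φ x) < 1 := by
        have : ContinuousAt (fun x => α * (Φ z - Φ x)) z :=
          (continuousAt_const.mul (continuousAt_const.sub hΦ.continuous.continuousAt))
        exact this.eventually_lt continuousAt_const (by simp)
      filter_upwards [hmax, hc] with x hx hx1 hxZ
      have := hx hxZ
      nlinarith)
  rw [hΛ.add_mul Φ _ hΦ (hh.pow 2)] at h1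
  linarith

/-- The barrier function. -/
def barrier (s i j : ι) (z γ : ι → ℝ) (lam b₁ b₂ b₃ K N M : ℝ) (x : ι → ℝ) : ℝ :=
  2 * lam * ((x s - z s) - ∑ k ∈ Finset.univ.erase s, γ k * (x k - z k)
    - (1 / 2) * (b₁ * (x i - z i) ^ 2 + b₂ * ((x i - z i) * (x j - z j)) + b₃ * (x j - z j) ^ 2))
  - N * ∑ k ∈ ((Finset.univ.erase s).erase i).erase j, (x k - z k) ^ 2
  + K * (x i - z i) ^ 2 + K * (x j - z j) ^ 2 + (-M) * ((x i - z i) ^ 2 + (x j - z j) ^ 2) ^ 2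

theorem contDiff_barrier (s i j : ι) (z γ : ι → ℝ) (lam b₁ b₂ b₃ K N M : ℝ) :
    ContDiff ℝ ∞ (barrier s i j z γ lam b₁ b₂ b₃ K N M) := by
  unfold barrier
  fun_prop

theorem fderiv_barrier (s i j : ι) (z γ : ι → ℝ) (lam b₁ b₂ b₃ K N M : ℝ) (x v : ι → ℝ) :
    fderiv ℝ (barrier s i j z γ lam b₁ b₂ b₃ K N M) x v =
      2 * lam * (v s - ∑ k ∈ Finset.univ.erase s, γ k * v k
        - (b₁ * ((x i - z i) * v i) + (1 / 2) * b₂ * ((x i - z i) * v j + (x j - z j) * v i)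
          + b₃ * ((x j - z j) * v j)))
      - 2 * N * ∑ k ∈ ((Finset.univ.erase s).erase i).erase j, (x k - z k) * v k
      + (2 * K - 4 * M * ((x i - z i) ^ 2 + (x j - z j) ^ 2)) *
        ((x i - z i) * v i + (x j - z j) * v j) := by
  have hd : DifferentiableAt ℝ (barrier s i j z γ lam b₁ b₂ b₃ K N M) x :=
    (contDiff_barrier ..).differentiable (by simp) x
  have h1 : HasDerivAt (fun t : ℝ => barrier s i j z γ lam b₁ b₂ b₃ K N M (x + t • v))
      (fderiv ℝ (barrier s i j z γ lam b₁ b₂ b₃ K N M) x v) 0 := hd.hasFDerivAt.hasLineDerivAt v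
  have hc : ∀ k, HasDerivAt (fun t : ℝ => (x + t • v) k - z k) (v k) 0 := fun k => by
    have := (((hasDerivAt_id (0 : ℝ)).mul_const (v k)).const_add (x k)).sub_const (z k)
    simpa using this
  have hq : ∀ k, HasDerivAt (fun t : ℝ => ((x + t • v) k - z k) ^ 2) (2 * (x k - z k) * v k) 0 :=
    fun k => by simpa using (hc k).fun_pow 2
  have h2 := ((((((hc s).sub (HasDerivAt.fun_sum fun k (_ : k ∈ Finset.univ.erase s) =>
    (hc k).const_mul (γ k))).sub (((((hq i).const_mul b₁).add
      (((hc i).mul (hc j)).const_mul b₂)).add ((hq j).const_mul b₃)).const_mul (1 / 2))).const_mul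
      (2 * lam)).sub ((HasDerivAt.fun_sum fun k
        (_ : k ∈ ((Finset.univ.erase s).erase i).erase j) => hq k).const_mul N)).add
      ((hq i).const_mul K)).add ((hq j).const_mul K) |>.add ((((hq i).add (hq j)).pow 2).const_mul (-M))
  have h3 := h1.unique (h2.congr_of_eventuallyEq (Eventually.of_forall fun t => by
    simp [barrier]))
  rw [h3]
  simp only [Pi.add_apply, Pi.smul_apply, zero_smul, add_zero, mul_assoc, ← Finset.mul_sum]
  simp
  ring

/-- The quadratic and quartic terms of the barrier confine the contact points. -/
theorem barrier_confinement {lam L G b K N M P Q T S : ℝ} (hL : L = |lam|)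
    (hG : 0 ≤ G) (hb : 0 ≤ b) (hK : 0 ≤ K) (hM : 0 ≤ M) (hN : 3 + 2 * G ≤ N) (hP : 0 ≤ P)
    (hQ : 0 ≤ Q) (h1 : 2 * lam * T ≤ P + Q + S ^ 2) (h3 : S ^ 2 ≤ 2 * T ^ 2 + 2 * G * (P + Q))
    (h2 : 0 ≤ 2 * lam * T + b * P + K * P - N * Q - M * P ^ 2) (hT : 2 * |T| ≤ L)
    (hT' : 2 * |T| * (1 + 2 * G + b + K) ≤ L) :
    M * P ^ 2 + Q ≤ (b + K + 2 + 2 * G) * P ∧ L * |T| ≤ (1 + 2 * G + b + K) * (P + Q) ∧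
      2 * T ^ 2 ≤ P + Q := by
  have hMP : 0 ≤ M * P ^ 2 := by positivity
  have hNQ : 0 ≤ N * Q := mul_nonneg (by linarith) hQ
  have hbP : 0 ≤ b * P := mul_nonneg hb hP
  have hKP : 0 ≤ K * P := mul_nonneg hK hP
  have hGP : 0 ≤ G * P := mul_nonneg hG hP
  have hbQ : 0 ≤ b * Q := mul_nonneg hb hQ
  have hKQ : 0 ≤ K * Q := mul_nonneg hK hQ
  have hGQ : 0 ≤ G * Q := mul_nonneg hG hQ
  have hTT : T ^ 2 = |T| * |T| := by rw [← sq, sq_abs]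
  have hTn := abs_nonneg T
  have hTL : 2 * T ^ 2 ≤ L * |T| := by nlinarith
  -- The paraboloid `h1` bounds 2λT from above, the sign of the barrier `h2` bounds it from below.
  -- The term 2T² is then absorbed by `hTL`.
  have habs : 2 * (L * |T|) ≤ (1 + 2 * G + b + K) * (P + Q) + 2 * T ^ 2 := by
    rw [hL, ← abs_mul]
    rcases abs_cases (lam * T) with ⟨h, _⟩ | ⟨h, _⟩ <;> rw [h] <;> nlinarith
  have hB : L * |T| ≤ (1 + 2 * G + b + K) * (P + Q) := by linarith
  have hc1 : 0 < 1 + 2 * G + b + K := by linarith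
  have hC : 2 * T ^ 2 ≤ P + Q := by
    have h5 : (1 + 2 * G + b + K) * (2 * T ^ 2) ≤ (1 + 2 * G + b + K) * (P + Q) := by
      rw [hTT]; nlinarith
    exact le_of_mul_le_mul_left h5 hc1
  refine ⟨?_, hB, hC⟩
  -- Inserting `h1` and `h3` into `h2` leaves (2 + 2G)(P + Q) + (b + K)P on the right; N ≥ 3 + 2G
  -- absorbs its Q-part with one Q to spare.
  have : (3 + 2 * G) * Q ≤ N * Q := mul_le_mul_of_nonneg_right hN hQ
  nlinarith


/-- Setting this and its two companions to zero gives the equations at a maximum of the barrier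
along Z. The K- and M-terms are radial in the (i, j)-plane, so they drop out of a cross combination;
in the remaining directions N dominates. -/
theorem fderiv_barrier_contactField_fst {s i j : ι} (his : i ≠ s) (hjs : j ≠ s) (hij : i ≠ j)
    (g : (ι → ℝ) → ι → ℝ) (z γ : ι → ℝ) (lam b₁ b₂ b₃ K N M : ℝ) (x : ι → ℝ) :
    fderiv ℝ (barrier s i j z γ lam b₁ b₂ b₃ K N M) x (contactField s g i x) =
      2 * lam * (g x i - γ i - (b₁ * (x i - z i) + (1 / 2) * b₂ * (x j - z j))) +
      (2 * K - 4 * M * ((x i - z i) ^ 2 + (x j - z j) ^ 2)) * (x i - z i) := by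
  rw [fderiv_barrier, contactField_apply_self his, contactField_apply_of_ne his,
    contactField_apply_of_ne hjs, if_pos rfl, if_neg hij.symm,
    Finset.sum_eq_single_of_mem i (by simp [his]), Finset.sum_eq_zero,
    contactField_apply_of_ne his, if_pos rfl]
  · ring
  · intro k hk
    simp only [Finset.mem_erase] at hk
    rw [contactField_apply_of_ne hk.2.2.1, if_neg hk.2.1, mul_zero]
  · intro k hk hki
    rw [contactField_apply_of_ne (Finset.ne_of_mem_erase hk), if_neg hki, mul_zero]

theorem fderiv_barrier_contactField_snd {s i j : ι} (his : i ≠ s) (hjs : j ≠ s) (hij : i ≠ j)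
    (g : (ι → ℝ) → ι → ℝ) (z γ : ι → ℝ) (lam b₁ b₂ b₃ K N M : ℝ) (x : ι → ℝ) :
    fderiv ℝ (barrier s i j z γ lam b₁ b₂ b₃ K N M) x (contactField s g j x) =
      2 * lam * (g x j - γ j - ((1 / 2) * b₂ * (x i - z i) + b₃ * (x j - z j))) +
      (2 * K - 4 * M * ((x i - z i) ^ 2 + (x j - z j) ^ 2)) * (x j - z j) := by
  rw [fderiv_barrier, contactField_apply_self hjs, contactField_apply_of_ne his,
    contactField_apply_of_ne hjs, if_pos rfl, if_neg hij,
    Finset.sum_eq_single_of_mem j (by simp [hjs]), Finset.sum_eq_zero,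
    contactField_apply_of_ne hjs, if_pos rfl]
  · ring
  · intro k hk
    simp only [Finset.mem_erase] at hk
    rw [contactField_apply_of_ne hk.2.2.1, if_neg hk.1, mul_zero]
  · intro k hk hki
    rw [contactField_apply_of_ne (Finset.ne_of_mem_erase hk), if_neg hki, mul_zero]

theorem fderiv_barrier_contactField_other {s i j k : ι} (his : i ≠ s) (hjs : j ≠ s)
    (hk : k ∈ ((Finset.univ.erase s).erase i).erase j)
    (g : (ι → ℝ) → ι → ℝ) (z γ : ι → ℝ) (lam b₁ b₂ b₃ K N M : ℝ) (x : ι → ℝ) :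
    fderiv ℝ (barrier s i j z γ lam b₁ b₂ b₃ K N M) x (contactField s g k x) =
      2 * (lam * (g x k - γ k) - N * (x k - z k)) := by
  have hk' := hk
  simp only [Finset.mem_erase, Finset.mem_univ, and_true] at hk'
  obtain ⟨hkj, hki, hks⟩ := hk'
  rw [fderiv_barrier, contactField_apply_self hks, contactField_apply_of_ne his,
    contactField_apply_of_ne hjs, if_neg hki.symm, if_neg hkj.symm,
    Finset.sum_eq_single_of_mem k (by simp [hks]), Finset.sum_eq_single_of_mem k hk,
    contactField_apply_of_ne hks, if_pos rfl]
  · ring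
  · intro l hl hlk
    simp only [Finset.mem_erase] at hl
    rw [contactField_apply_of_ne hl.2.2.1, if_neg hlk, mul_zero]
  · intro l hl hlk
    rw [contactField_apply_of_ne (Finset.ne_of_mem_erase hl), if_neg hlk, mul_zero]

/-- Two perturbed equations with a nonzero antisymmetric part have only the trivial solution. -/
theorem sq_add_sq_eq_zero_of_antisymm {lam X Y a b₁ b₂ b₃ c u v R κ : ℝ} (hlam : lam ≠ 0)
    (hR0 : 0 ≤ R) (hR : X ^ 2 + Y ^ 2 = R ^ 2)
    (h₁ : 2 * lam * (u - (b₁ * X + (1 / 2) * (b₂ + a) * Y)) + c * X = 0)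
    (h₂ : 2 * lam * (v - ((1 / 2) * (b₂ + a) * X + b₃ * Y)) + c * Y = 0)
    (hu : |u - b₁ * X - b₂ * Y| ≤ κ * R) (hv : |v - a * X - b₃ * Y| ≤ κ * R)
    (hκ : 4 * κ < |b₂ - a|) : R = 0 := by
  by_contra hne
  have hRpos : 0 < R := lt_of_le_of_ne hR0 (Ne.symm hne)
  have hX : |X| ≤ R := abs_le_of_sq_le_sq (by nlinarith [sq_nonneg Y]) hR0
  have hY : |Y| ≤ R := abs_le_of_sq_le_sq (by nlinarith [sq_nonneg X]) hR0
  -- The combination Y·`h₁` − X·`h₂` eliminates the radial coefficient c and the symmetric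
  -- coefficients; the antisymmetric part b₂ − a remains, up to errors of size κR².
  have hcross : 2 * lam * ((1 / 2) * (b₂ - a) * R ^ 2 + (Y * (u - b₁ * X - b₂ * Y)
      - X * (v - a * X - b₃ * Y))) = 0 := by
    rw [← hR]; linear_combination Y * h₁ - X * h₂
  have h3 := (mul_eq_zero.mp hcross).resolve_left (by simpa using hlam)
  have h4 : (1 / 2) * |b₂ - a| * R ^ 2 ≤ 2 * κ * R ^ 2 := by
    calc (1 / 2) * |b₂ - a| * R ^ 2 = |(1 / 2) * (b₂ - a) * R ^ 2| := by
          rw [abs_mul, abs_mul, abs_of_pos (by norm_num : (0 : ℝ) < 1 / 2),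
            abs_of_nonneg (sq_nonneg R)]
      _ = |X * (v - a * X - b₃ * Y) - Y * (u - b₁ * X - b₂ * Y)| := by congr 1; linarith
      _ ≤ |X| * |v - a * X - b₃ * Y| + |Y| * |u - b₁ * X - b₂ * Y| := by
          rw [← abs_mul, ← abs_mul]; exact abs_sub _ _
      _ ≤ R * (κ * R) + R * (κ * R) := by gcongr
      _ = 2 * κ * R ^ 2 := by ring
  have h5 : 0 < R ^ 2 := by positivity
  nlinarith

end Propagation

/-! ### Norm estimates in coordinates split along s, i, j and the rest -/

section PowerSums

variable {ι : Type*} [DecidableEq ι] [Fintype ι]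

theorem sum_univ_eq_erase {s i j : ι} (his : i ≠ s) (hjs : j ≠ s) (hij : i ≠ j) (f : ι → ℝ) :
    ∑ k, f k = f s + f i + f j + ∑ k ∈ ((Finset.univ.erase s).erase i).erase j, f k := by
  rw [← Finset.add_sum_erase Finset.univ f (Finset.mem_univ s),
    ← Finset.add_sum_erase (Finset.univ.erase s) f (a := i) (by simp [his]),
    ← Finset.add_sum_erase ((Finset.univ.erase s).erase i) f (a := j) (by simp [hjs, hij.symm])]
  ring

theorem norm_sq_le_sum_sq {ι : Type*} [Fintype ι] (f : ι → ℝ) : ‖f‖ ^ 2 ≤ ∑ k, f k ^ 2 := by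
  have h : ‖f‖ ≤ √(∑ k, f k ^ 2) := by
    refine (pi_norm_le_iff_of_nonneg (Real.sqrt_nonneg _)).2 fun k => ?_
    rw [Real.norm_eq_abs]
    exact Real.abs_le_sqrt
      (Finset.single_le_sum (f := fun k => f k ^ 2) (fun _ _ => sq_nonneg _) (Finset.mem_univ k))
  calc ‖f‖ ^ 2 ≤ √(∑ k, f k ^ 2) ^ 2 := by gcongr
    _ = _ := Real.sq_sqrt (Finset.sum_nonneg fun _ _ => sq_nonneg _)

/-- The component of `ζ` in the direction `∂_s` complementary to the vectors `∂_k + γ_k ∂_s`. -/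
def verticalPart (s : ι) (γ ζ : ι → ℝ) : ℝ := ζ s - ∑ k ∈ Finset.univ.erase s, γ k * ζ k

theorem abs_verticalPart_le (s : ι) (γ ζ : ι → ℝ) :
    |verticalPart s γ ζ| ≤ (1 + ∑ k, |γ k|) * ‖ζ‖ := by
  have h1 : |∑ k ∈ Finset.univ.erase s, γ k * ζ k| ≤ (∑ k, |γ k|) * ‖ζ‖ := by
    refine (Finset.abs_sum_le_sum_abs _ _).trans ?_
    rw [Finset.sum_mul]
    refine (Finset.sum_le_sum fun k _ => ?_).trans
      (Finset.sum_le_sum_of_subset_of_nonneg (Finset.subset_univ _)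
        fun k _ _ => mul_nonneg (abs_nonneg (γ k)) (norm_nonneg ζ))
    rw [abs_mul]
    exact mul_le_mul_of_nonneg_left (norm_le_pi_norm ζ k) (abs_nonneg _)
  have h2 : |ζ s| ≤ ‖ζ‖ := norm_le_pi_norm ζ s
  calc |verticalPart s γ ζ| ≤ |ζ s| + |∑ k ∈ Finset.univ.erase s, γ k * ζ k| := abs_sub _ _
    _ ≤ _ := by linarith

/-- Cauchy–Schwarz for the horizontal sum, then (a + b)² ≤ 2a² + 2b². -/
theorem sq_apply_le_verticalPart {s i j : ι} (his : i ≠ s) (hjs : j ≠ s) (hij : i ≠ j)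
    (γ ζ : ι → ℝ) :
    ζ s ^ 2 ≤ 2 * verticalPart s γ ζ ^ 2 + 2 * (∑ k ∈ Finset.univ.erase s, γ k ^ 2) *
      (ζ i ^ 2 + ζ j ^ 2 + ∑ k ∈ ((Finset.univ.erase s).erase i).erase j, ζ k ^ 2) := by
  have hcs := Finset.sum_mul_sq_le_sq_mul_sq (Finset.univ.erase s) γ ζ
  have he : ∑ k ∈ Finset.univ.erase s, ζ k ^ 2 =
      ζ i ^ 2 + ζ j ^ 2 + ∑ k ∈ ((Finset.univ.erase s).erase i).erase j, ζ k ^ 2 := by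
    rw [← Finset.add_sum_erase (Finset.univ.erase s) (fun k => ζ k ^ 2) (a := i) (by simp [his]),
      ← Finset.add_sum_erase ((Finset.univ.erase s).erase i) (fun k => ζ k ^ 2) (a := j)
        (by simp [hjs, hij.symm])]
    ring
  rw [he] at hcs
  have : ζ s = verticalPart s γ ζ + ∑ k ∈ Finset.univ.erase s, γ k * ζ k := by
    simp [verticalPart]
  rw [this]
  nlinarith [sq_nonneg (verticalPart s γ ζ - ∑ k ∈ Finset.univ.erase s, γ k * ζ k)]

/-- The part of `ζ` complementary to two of the vectors `∂_k + γ_k ∂_s`. -/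
theorem norm_sub_contactField_le {s i j : ι} (his : i ≠ s) (hjs : j ≠ s) (hij : i ≠ j)
    (g : (ι → ℝ) → ι → ℝ) (z ζ : ι → ℝ) :
    ‖ζ - (ζ i • contactField s g i z + ζ j • contactField s g j z)‖ ≤
      |verticalPart s (g z) ζ| + (1 + ∑ k, |g z k|) *
        √(∑ k ∈ ((Finset.univ.erase s).erase i).erase j, ζ k ^ 2) := by
  set Q := ∑ k ∈ ((Finset.univ.erase s).erase i).erase j, ζ k ^ 2 with hQ
  have hA : 0 ≤ ∑ k, |g z k| := Finset.sum_nonneg fun _ _ => abs_nonneg _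
  have hk : ∀ k ∈ ((Finset.univ.erase s).erase i).erase j, |ζ k| ≤ √Q := fun k hk =>
    Real.abs_le_sqrt (Finset.single_le_sum (f := fun k => ζ k ^ 2) (fun _ _ => sq_nonneg _) hk)
  have hT := abs_nonneg (verticalPart s (g z) ζ)
  have hQ0 := Real.sqrt_nonneg Q
  refine (pi_norm_le_iff_of_nonneg (by positivity)).2 fun k => ?_
  rw [Real.norm_eq_abs]
  by_cases hks : k = s
  · subst hks
    have h1 : (ζ - (ζ i • contactField k g i z + ζ j • contactField k g j z)) k =
        verticalPart k (g z) ζ +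
          ∑ l ∈ ((Finset.univ.erase k).erase i).erase j, g z l * ζ l := by
      simp only [Pi.sub_apply, Pi.add_apply, Pi.smul_apply, contactField_apply_self his,
        contactField_apply_self hjs, verticalPart, smul_eq_mul]
      rw [← Finset.add_sum_erase (Finset.univ.erase k) (fun l => g z l * ζ l) (a := i)
          (by simp [his]),
        ← Finset.add_sum_erase ((Finset.univ.erase k).erase i) (fun l => g z l * ζ l) (a := j)
        (by simp [hjs, hij.symm])]
      ring
    rw [h1]
    have h2 : |∑ l ∈ ((Finset.univ.erase k).erase i).erase j, g z l * ζ l| ≤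
        (∑ l, |g z l|) * √Q := by
      refine (Finset.abs_sum_le_sum_abs _ _).trans ?_
      rw [Finset.sum_mul]
      refine (Finset.sum_le_sum fun l hl => ?_).trans
        (Finset.sum_le_sum_of_subset_of_nonneg (Finset.subset_univ _)
          fun l _ _ => mul_nonneg (abs_nonneg (g z l)) hQ0)
      rw [abs_mul]
      exact mul_le_mul_of_nonneg_left (hk l hl) (abs_nonneg _)
    calc _ ≤ |verticalPart k (g z) ζ| + _ := abs_add_le _ _
      _ ≤ _ := by nlinarith
  · simp only [Pi.sub_apply, Pi.add_apply, Pi.smul_apply, contactField_apply_of_ne hks, smul_eq_mul]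
    by_cases hki : k = i
    · subst hki; simp [hij]; positivity
    by_cases hkj : k = j
    · subst hkj; simp [hki]; positivity
    have := hk k (by simp [hks, hki, hkj])
    simp only [if_neg hki, if_neg hkj, mul_zero, add_zero, sub_zero]
    nlinarith

theorem barrier_eq (s i j : ι) (z γ : ι → ℝ) (lam b₁ b₂ b₃ K N M : ℝ) (x : ι → ℝ) :
    barrier s i j z γ lam b₁ b₂ b₃ K N M x =
      2 * lam * verticalPart s γ (x - z)
        - lam * (b₁ * (x - z) i ^ 2 + b₂ * ((x - z) i * (x - z) j) + b₃ * (x - z) j ^ 2)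
        + K * ((x - z) i ^ 2 + (x - z) j ^ 2)
        - N * ∑ k ∈ ((Finset.univ.erase s).erase i).erase j, (x - z) k ^ 2
        - M * ((x - z) i ^ 2 + (x - z) j ^ 2) ^ 2 := by
  simp only [barrier, verticalPart, Pi.sub_apply]
  ring

theorem abs_quadratic_le (b₁ b₂ b₃ X Y : ℝ) :
    |b₁ * X ^ 2 + b₂ * (X * Y) + b₃ * Y ^ 2| ≤ (|b₁| + |b₂| + |b₃|) * (X ^ 2 + Y ^ 2) := by
  have h1 : |b₁ * X ^ 2 + b₂ * (X * Y) + b₃ * Y ^ 2| ≤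
      |b₁| * X ^ 2 + |b₂| * |X * Y| + |b₃| * Y ^ 2 := by
    refine (abs_add_le _ _).trans (add_le_add ((abs_add_le _ _).trans (add_le_add ?_ ?_)) ?_)
    · rw [abs_mul, abs_of_nonneg (sq_nonneg X)]
    · rw [abs_mul]
    · rw [abs_mul, abs_of_nonneg (sq_nonneg Y)]
  have h2 : |X * Y| ≤ X ^ 2 + Y ^ 2 := by
    rw [abs_le]; constructor <;> nlinarith [sq_nonneg (X + Y), sq_nonneg (X - Y)]
  nlinarith [abs_nonneg b₁, abs_nonneg b₂, abs_nonneg b₃, sq_nonneg X, sq_nonneg Y,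
    mul_nonneg (abs_nonneg b₁) (sq_nonneg Y), mul_nonneg (abs_nonneg b₃) (sq_nonneg X),
    mul_le_mul_of_nonneg_left h2 (abs_nonneg b₂)]

end PowerSums

/-! ### The barrier argument at a point with an exterior paraboloid -/

section Paraboloid

variable {ι : Type*} [DecidableEq ι] [Fintype ι]

/-- Finitely many homogeneous linear constraints hold for small positive numbers. -/
theorem exists_pos_of_linear_bounds {r a' b' c' : ℝ} (hr : 0 < r) (ha' : 0 < a') (hb' : 0 < b')
    (hc' : 0 < c') (a b c : ℝ) :
    ∃ ρ : ℝ, 0 < ρ ∧ ρ ≤ r ∧ a * ρ ≤ a' ∧ b * ρ ≤ b' ∧ c * ρ ≤ c' := by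
  have h : ∀ {a a' : ℝ}, 0 < a' → ∀ᶠ ρ in 𝓝[>] (0 : ℝ), a * ρ ≤ a' := fun {a a'} h => by
    have : Tendsto (fun ρ : ℝ => a * ρ) (𝓝[>] 0) (𝓝 (a * 0)) :=
      ((continuous_const.mul continuous_id).tendsto 0).mono_left nhdsWithin_le_nhds
    rw [mul_zero] at this
    exact (this.eventually_lt_const h).mono fun _ => le_of_lt
  obtain ⟨ρ, ⟨⟨⟨h1, h2⟩, h3⟩, h4⟩, h5⟩ := (((((h (a := 1) hr).and (h (a := a) ha')).and
    (h (a := b) hb')).and (h (a := c) hc')).and self_mem_nhdsWithin).exists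
  exact ⟨ρ, h5, by linarith, h2, h3, h4⟩

set_option maxHeartbeats 2000000 in
/-- If the contact set has an exterior paraboloid at `z` whose normal annihilates the vectors
`∂_k + g_k ∂_s`, then two of these vector fields cannot have a commutator transversal to them. -/
theorem false_of_exterior_paraboloid {s i j : ι} (his : i ≠ s) (hjs : j ≠ s) (hij : i ≠ j)
    {g : (ι → ℝ) → ι → ℝ} {Z O : Set (ι → ℝ)} {z : ι → ℝ} (hO : O ∈ 𝓝 z)
    (hcl : ∀ C, IsCompact C → C ⊆ O → IsCompact (C ∩ Z)) (hz : z ∈ Z)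
    (hg : DifferentiableAt ℝ g z)
    (hbr : fderiv ℝ g z (contactField s g j z) i ≠ fderiv ℝ g z (contactField s g i z) j)
    {Λ : (ι → ℝ) → ((ι → ℝ) → ℝ) → ℝ} (hΛ : ∀ x ∈ O, x ∈ Z → IsContactOperator s g Z x (Λ x))
    {lam : ℝ} (hlam : lam ≠ 0)
    (hext : ∀ᶠ x in 𝓝 z, x ∈ Z →
      2 * lam * verticalPart s (g z) (x - z) ≤ ∑ k, (x - z) k ^ 2) : False := by
  have hzO : z ∈ O := mem_of_mem_nhds hO
  set D := fderiv ℝ g z with hD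
  set Bii := D (contactField s g i z) i with hBii
  set Bij := D (contactField s g j z) i with hBij
  set Bji := D (contactField s g i z) j with hBji
  set Bjj := D (contactField s g j z) j with hBjj
  set L := |lam| with hL
  have hLpos : 0 < L := abs_pos.2 hlam
  set G := ∑ k ∈ Finset.univ.erase s, g z k ^ 2 with hG
  have hG0 : 0 ≤ G := Finset.sum_nonneg fun _ _ => sq_nonneg _
  set A := 1 + ∑ k, |g z k| with hA
  have hA1 : 1 ≤ A := by
    have : 0 ≤ ∑ k, |g z k| := Finset.sum_nonneg fun _ _ => abs_nonneg _
    linarith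
  set b := L * (|Bii| + |Bij + Bji| + |Bjj|) with hb
  have hb0 : 0 ≤ b := by positivity
  -- An eighth gives the strict 4κ < |Bij − Bji| required by `sq_add_sq_eq_zero_of_antisymm`. The
  -- error κR is shared in thirds by the nonlinearity of g (through η), the directions other than s,
  -- i, j (through δ) and the vertical part (through ρ).
  set κ := |Bij - Bji| / 8 with hκ
  have hβ : 0 < |Bij - Bji| := abs_pos.2 (sub_ne_zero.2 hbr)
  have hκ0 : 0 < κ := by positivity
  set c₅ := 2 + 2 * G with hc₅
  have hc₅0 : 0 < c₅ := by positivity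
  set η := min 1 (κ / (3 * c₅)) with hη
  have hη0 : 0 < η := lt_min one_pos (by positivity)
  set δ := min 1 (κ / (3 * (‖D‖ * A + 1))) with hδ
  have hδ0 : 0 < δ := lt_min one_pos (by positivity)
  set F := (Fintype.card ι : ℝ) * (L * (‖D‖ + 1)) ^ 2 * c₅ + 1 with hF
  have hF1 : 1 ≤ F := by
    have : 0 ≤ (Fintype.card ι : ℝ) * (L * (‖D‖ + 1)) ^ 2 * c₅ := by positivity
    linarith
  -- The first summand serves `barrier_confinement`; the second makes N² so large that Q ≤ δ²P at
  -- the maximum. N has to be fixed before K, which depends on it through Ψ.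
  set N := 3 + 2 * G + F * (1 + 1 / δ ^ 2) with hN
  have hFδ : 0 ≤ F * (1 + 1 / δ ^ 2) := by positivity
  have hN3 : 3 + 2 * G ≤ N := by linarith
  have hNsq : F * (1 + 1 / δ ^ 2) ≤ N ^ 2 := by
    have h1 : N ≤ N ^ 2 := le_self_pow₀ (by linarith) two_ne_zero
    linarith
  -- the choice of `K`
  have hzΛ := hΛ z hzO hz
  set Ψ := barrier s i j z (g z) lam Bii (Bij + Bji) Bjj 0 N 0 with hΨ
  have hΨs : ContDiff ℝ ∞ Ψ := contDiff_barrier ..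
  have hcoord : ∀ k : ι, ContDiff ℝ ∞ fun x : ι → ℝ => x k - z k := fun k => by fun_prop
  have hfdi : ∀ k : ι, ∀ v, fderiv ℝ (fun x : ι → ℝ => x k - z k) z v = v k := fun k v => by
    rw [fderiv_sub_const]
    have : HasFDerivAt (fun x : ι → ℝ => x k) (ContinuousLinearMap.proj (R := ℝ) k) z :=
      (ContinuousLinearMap.proj (R := ℝ) (φ := fun _ : ι => ℝ) k).hasFDerivAt
    rw [this.fderiv]; rfl
  have hqi : 0 < Λ z fun x => (x i - z i) ^ 2 := by
    refine lt_of_le_of_ne (hzΛ.sq_nonneg _ (hcoord i) (sub_self _)) fun h => ?_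
    have := hzΛ.fderiv_eq_zero _ (hcoord i) (sub_self _) h.symm i his
    rw [hfdi, contactField_apply_of_ne his, if_pos rfl] at this
    exact one_ne_zero this
  have hqj : 0 ≤ Λ z fun x => (x j - z j) ^ 2 := hzΛ.sq_nonneg _ (hcoord j) (sub_self _)
  set qi := Λ z fun x => (x i - z i) ^ 2
  set qj := Λ z fun x => (x j - z j) ^ 2
  obtain ⟨K, hK0, hK⟩ : ∃ K : ℝ, 0 ≤ K ∧ 0 < Λ z Ψ + K * qi := by
    refine ⟨(|Λ z Ψ| + 1) / qi, by positivity, ?_⟩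
    rw [div_mul_cancel₀ _ hqi.ne']
    linarith [neg_abs_le (Λ z Ψ)]
  set c₁ := 1 + 2 * G + b + K with hc₁
  set c₂ := b + K + 2 + 2 * G with hc₂
  have hc₁0 : 0 < c₁ := by positivity
  have hc₂0 : 0 < c₂ := by positivity
  set c₃ := c₁ * (1 + c₂) / L with hc₃
  have hc₃0 : 0 < c₃ := by positivity
  -- the choice of the ball
  have hlittle := hg.hasFDerivAt.isLittleO.def hη0
  obtain ⟨ρ₀, hρ₀, hball⟩ := Metric.nhds_basis_closedBall.mem_iff.1
    (inter_mem hO (inter_mem hext hlittle))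
  obtain ⟨ρ, hρ0, hρρ₀, hρ1, hρ2, hρ3⟩ : ∃ ρ : ℝ, 0 < ρ ∧ ρ ≤ ρ₀ ∧ 2 * (A * ρ) ≤ L ∧
      2 * (A * ρ) * c₁ ≤ L ∧ ‖D‖ * (c₃ * (2 + 2 * G) * ρ) ≤ κ / 3 := by
    obtain ⟨ρ, h0, h1, h2, h3, h4⟩ := exists_pos_of_linear_bounds hρ₀ hLpos hLpos
      (by positivity : 0 < κ / 3) (2 * A) (2 * A * c₁) (‖D‖ * (c₃ * (2 + 2 * G)))
    exact ⟨ρ, h0, h1, by linarith, by linarith, by linarith⟩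
  have hballρ : ∀ x ∈ Metric.closedBall z ρ, x ∈ O ∧ (x ∈ Z →
      2 * lam * verticalPart s (g z) (x - z) ≤ ∑ k, (x - z) k ^ 2) ∧
      ‖g x - g z - D (x - z)‖ ≤ η * ‖x - z‖ := fun x hx =>
    hball (Metric.closedBall_subset_closedBall hρρ₀ hx)
  -- Confinement gives MP ≤ c₂ when P > 0, and ‖x − z‖² ≤ (2 + 2G)(1 + c₂)P; this M makes ‖x − z‖ <
  -- ρ, so the maximum over the closed ball is interior.
  set M := ((2 + 2 * G) * (1 + c₂) * c₂ + 1) / ρ ^ 2 with hM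
  have hM0 : 0 < M := by positivity
  -- confinement of the points of `Z` where the barrier is nonnegative
  set Φ := barrier s i j z (g z) lam Bii (Bij + Bji) Bjj K N M with hΦ
  have hΦs : ContDiff ℝ ∞ Φ := contDiff_barrier ..
  have hΦz : Φ z = 0 := by simp [hΦ, barrier]
  have hconf : ∀ x ∈ Metric.closedBall z ρ, x ∈ Z → 0 ≤ Φ x →
      ∀ P Q T : ℝ, P = (x - z) i ^ 2 + (x - z) j ^ 2 →
      Q = ∑ k ∈ ((Finset.univ.erase s).erase i).erase j, (x - z) k ^ 2 →
      T = verticalPart s (g z) (x - z) →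
      0 ≤ P ∧ 0 ≤ Q ∧ M * P ^ 2 + Q ≤ c₂ * P ∧ |T| ≤ c₃ * P ∧ ‖x - z‖ ^ 2 ≤ (2 + 2 * G) * (P + Q) := by
    intro x hx hxZ hΦx P Q T hP hQ hT
    obtain ⟨-, hx1, -⟩ := hballρ x hx
    have hP0 : 0 ≤ P := by rw [hP]; positivity
    have hQ0 : 0 ≤ Q := by rw [hQ]; exact Finset.sum_nonneg fun _ _ => sq_nonneg _
    have hxr : ‖x - z‖ ≤ ρ := by simpa [dist_eq_norm] using hx
    have hTA : |T| ≤ A * ρ := by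
      rw [hT]
      exact (abs_verticalPart_le s (g z) (x - z)).trans
        (mul_le_mul_of_nonneg_left hxr (by linarith))
    have hsum : ∑ k, (x - z) k ^ 2 = P + Q + (x - z) s ^ 2 := by
      rw [sum_univ_eq_erase his hjs hij, hP, hQ]; ring
    have h1 : 2 * lam * T ≤ P + Q + (x - z) s ^ 2 := by rw [hT, ← hsum]; exact hx1 hxZ
    have h3 : (x - z) s ^ 2 ≤ 2 * T ^ 2 + 2 * G * (P + Q) := by
      rw [hT, hP, hQ]; exact sq_apply_le_verticalPart his hjs hij _ _
    have h2 : 0 ≤ 2 * lam * T + b * P + K * P - N * Q - M * P ^ 2 := by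
      have h4 := abs_quadratic_le Bii (Bij + Bji) Bjj ((x - z) i) ((x - z) j)
      rw [hΦ, barrier_eq, ← hP, ← hQ, ← hT] at hΦx
      rw [← hP] at h4
      have h5 : -(lam * (Bii * (x - z) i ^ 2 + (Bij + Bji) * ((x - z) i * (x - z) j) +
          Bjj * (x - z) j ^ 2)) ≤ b * P := by
        refine (neg_le_abs _).trans ?_
        rw [abs_mul, hb, mul_assoc]
        exact mul_le_mul_of_nonneg_left h4 (abs_nonneg _)
      linarith
    obtain ⟨e1, e2, e3⟩ := barrier_confinement hL hG0 hb0 hK0 hM0.le hN3 hP0 hQ0 h1 h3 h2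
      (by linarith) ((mul_le_mul_of_nonneg_right (by linarith) hc₁0.le).trans hρ2)
    refine ⟨hP0, hQ0, e1, ?_, ?_⟩
    · have hMP : 0 ≤ M * P ^ 2 := by positivity
      rw [hc₃, div_mul_eq_mul_div, le_div_iff₀ hLpos]
      calc |T| * L = L * |T| := mul_comm _ _
        _ ≤ c₁ * (P + Q) := e2
        _ ≤ c₁ * ((1 + c₂) * P) := by
            apply mul_le_mul_of_nonneg_left _ hc₁0.le; linarith
        _ = _ := by ring
    · refine (norm_sq_le_sum_sq (x - z)).trans ?_
      rw [hsum]; linarith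
  have hint : ∀ x ∈ Metric.closedBall z ρ, x ∈ Z → 0 ≤ Φ x → ‖x - z‖ < ρ := by
    intro x hx hxZ hΦx
    obtain ⟨hP, hQ, e1, -, e3⟩ := hconf x hx hxZ hΦx _ _ _ rfl rfl rfl
    set P := (x - z) i ^ 2 + (x - z) j ^ 2
    set Q := ∑ k ∈ ((Finset.univ.erase s).erase i).erase j, (x - z) k ^ 2
    refine lt_of_pow_lt_pow_left₀ 2 hρ0.le (lt_of_le_of_lt e3 ?_)
    have hQP : Q ≤ c₂ * P := by linarith [mul_nonneg hM0.le (sq_nonneg P)]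
    rcases hP.eq_or_lt with h0 | hPpos
    · have : Q = 0 := le_antisymm (by rw [← h0] at hQP; simpa using hQP) hQ
      rw [← h0, this]; simp; positivity
    · have h5 : M * P ≤ c₂ := by
        have h : (M * P) * P = M * P ^ 2 := by ring
        have : (M * P) * P ≤ c₂ * P := by linarith
        exact le_of_mul_le_mul_right this hPpos
      have h6 : ((2 + 2 * G) * (1 + c₂) * c₂ + 1) * P ≤ c₂ * ρ ^ 2 := by
        rw [hM, div_mul_eq_mul_div, div_le_iff₀ (by positivity)] at h5; exact h5
      have h7 : (2 + 2 * G) * (P + Q) ≤ (2 + 2 * G) * ((1 + c₂) * P) :=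
        mul_le_mul_of_nonneg_left (by linarith) (by positivity)
      refine lt_of_le_of_lt h7 ?_
      have h8 : c₂ * ((2 + 2 * G) * ((1 + c₂) * P)) < c₂ * ρ ^ 2 := by
        have h : ((2 + 2 * G) * (1 + c₂) * c₂ + 1) * P =
          c₂ * ((2 + 2 * G) * ((1 + c₂) * P)) + P := by ring
        linarith
      exact lt_of_mul_lt_mul_left h8 hc₂0.le
  -- a maximum point of the barrier
  obtain ⟨x, ⟨hxb, hxZ⟩, hxmax⟩ := (hcl (Metric.closedBall z ρ) (isCompact_closedBall z ρ)
    fun x hx => (hballρ x hx).1).exists_isMaxOn ⟨z, Metric.mem_closedBall_self hρ0.le, hz⟩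
    hΦs.continuous.continuousOn
  have hΦx : 0 ≤ Φ x := by
    rw [← hΦz]; exact hxmax ⟨Metric.mem_closedBall_self hρ0.le, hz⟩
  have hxin := hint x hxb hxZ hΦx
  have hnear : Metric.closedBall z ρ ∈ 𝓝 x :=
    mem_of_superset (Metric.isOpen_ball.mem_nhds (by simpa [dist_eq_norm] using hxin))
      Metric.ball_subset_closedBall
  have hcont : ∀ᶠ y in 𝓝 x, y ∈ Z → Φ y ≤ Φ x := by
    filter_upwards [hnear] with y hy hyZ using hxmax ⟨hy, hyZ⟩
  obtain ⟨hxO, -, hxlit⟩ := hballρ x hxb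
  have hxΛ := hΛ x hxO hxZ
  obtain ⟨hP0, hQ0, e1, e2, e3⟩ := hconf x hxb hxZ hΦx _ _ _ rfl rfl rfl
  set P := (x - z) i ^ 2 + (x - z) j ^ 2 with hP
  set Q := ∑ k ∈ ((Finset.univ.erase s).erase i).erase j, (x - z) k ^ 2 with hQ
  have hQc : Q ≤ c₂ * P := by linarith [mul_nonneg hM0.le (sq_nonneg P)]
  have hηle : η ≤ 1 := min_le_left _ _
  have hlip : ∀ k, |g x k - g z k| ≤ (‖D‖ + 1) * ‖x - z‖ := by
    intro k
    have h1 : ‖g x - g z‖ ≤ (‖D‖ + 1) * ‖x - z‖ := by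
      calc ‖g x - g z‖ = ‖(g x - g z - D (x - z)) + D (x - z)‖ := by simp
        _ ≤ ‖g x - g z - D (x - z)‖ + ‖D (x - z)‖ := norm_add_le _ _
        _ ≤ η * ‖x - z‖ + ‖D‖ * ‖x - z‖ := add_le_add hxlit (D.le_opNorm _)
        _ ≤ _ := by linarith [mul_le_of_le_one_left (norm_nonneg (x - z)) hηle]
    exact (norm_le_pi_norm (g x - g z) k).trans h1
  -- For k other than s, i, j the critical equation reads N(x − z)_k = λ(g_k(x) − g_k(z)), whose
  -- right side is O(‖x − z‖).
  have hother : Q ≤ δ ^ 2 * P := by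
    have hk : ∀ k ∈ ((Finset.univ.erase s).erase i).erase j,
        N ^ 2 * (x - z) k ^ 2 ≤ (L * (‖D‖ + 1)) ^ 2 * ‖x - z‖ ^ 2 := by
      intro k hk
      have hks : k ≠ s := by simp only [Finset.mem_erase] at hk; exact hk.2.2.1
      have h := hxΛ.characteristic hΦs hcont hks
      rw [hΦ, fderiv_barrier_contactField_other his hjs hk] at h
      have h' : N * (x - z) k = lam * (g x k - g z k) := by simp only [Pi.sub_apply]; linarith
      rw [← mul_pow, ← mul_pow, h', ← sq_abs, abs_mul]
      refine pow_le_pow_left₀ (by positivity) ?_ 2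
      rw [mul_assoc]
      exact mul_le_mul_of_nonneg_left (hlip k) (abs_nonneg _)
    have h1 : N ^ 2 * Q ≤ (F - 1) * (P + Q) := by
      rw [hQ, Finset.mul_sum]
      refine (Finset.sum_le_card_nsmul _ _ _ hk).trans ?_
      rw [nsmul_eq_mul, ← hQ]
      have hcard : ((((Finset.univ.erase s).erase i).erase j).card : ℝ) ≤ Fintype.card ι := by
        exact_mod_cast Finset.card_le_univ _
      calc _ ≤ (Fintype.card ι : ℝ) * ((L * (‖D‖ + 1)) ^ 2 * (c₅ * (P + Q))) := by
            gcongr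
        _ = _ := by rw [hF]; ring
    have h2 : F * (1 + 1 / δ ^ 2) * Q ≤ N ^ 2 * Q := mul_le_mul_of_nonneg_right hNsq hQ0
    have h3 : F * (Q / δ ^ 2) ≤ F * P := by
      have : F * (1 + 1 / δ ^ 2) * Q = F * Q + F * (Q / δ ^ 2) := by ring
      have h : (F - 1) * (P + Q) = F * P + F * Q - P - Q := by ring
      linarith
    have h4 := le_of_mul_le_mul_left h3 (by linarith)
    rw [div_le_iff₀ (by positivity)] at h4
    linarith
  have hδ1 : δ ^ 2 ≤ 1 := pow_le_one₀ hδ0.le (min_le_left _ _)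
  set R := √P with hR
  have hRP : R ^ 2 = P := Real.sq_sqrt hP0
  have hR0 : 0 ≤ R := Real.sqrt_nonneg _
  have hQR : √Q ≤ δ * R := by
    rw [Real.sqrt_le_left (by positivity), mul_pow, hRP]; exact hother
  have hxR : ‖x - z‖ ≤ c₅ * R := by
    refine abs_le_of_sq_le_sq' ?_ (by positivity) |>.2
    rw [mul_pow, hRP]
    have hQP : Q ≤ P := hother.trans (mul_le_of_le_one_left hP0 hδ1)
    calc ‖x - z‖ ^ 2 ≤ c₅ * (P + Q) := e3
      _ ≤ c₅ * (c₅ * P) := by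
        apply mul_le_mul_of_nonneg_left _ hc₅0.le
        have := mul_nonneg hG0 hP0
        have h : c₅ * P = 2 * P + 2 * (G * P) := by rw [hc₅]; ring
        linarith
      _ = c₅ ^ 2 * P := by ring
  have hRρ : R ≤ (2 + 2 * G) * ρ := by
    have h1 : |(x - z) i| ≤ ‖x - z‖ := norm_le_pi_norm (x - z) i
    have h2 : |(x - z) j| ≤ ‖x - z‖ := norm_le_pi_norm (x - z) j
    have h3 : P ≤ 2 * ‖x - z‖ ^ 2 := by
      rw [hP, ← sq_abs ((x - z) i), ← sq_abs ((x - z) j)]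
      linarith [pow_le_pow_left₀ (abs_nonneg _) h1 2, pow_le_pow_left₀ (abs_nonneg _) h2 2]
    have h4 : R ≤ 2 * ρ := by
      refine abs_le_of_sq_le_sq' ?_ (by positivity) |>.2
      rw [hRP, mul_pow]
      have := pow_le_pow_left₀ (norm_nonneg _) hxin.le 2
      linarith [sq_nonneg ρ]
    linarith [mul_nonneg hG0 hρ0.le]
  -- The vertical part is quadratic, at most c₃R²; one factor R is made small by the radius ρ.
  have hTR : ‖D‖ * |verticalPart s (g z) (x - z)| ≤ κ / 3 * R := by
    calc ‖D‖ * |verticalPart s (g z) (x - z)| ≤ ‖D‖ * (c₃ * (R * R)) := by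
          rw [← sq, hRP]; gcongr
      _ ≤ ‖D‖ * (c₃ * (((2 + 2 * G) * ρ) * R)) := by gcongr
      _ = ‖D‖ * (c₃ * (2 + 2 * G) * ρ) * R := by ring
      _ ≤ κ / 3 * R := by gcongr
  have herr : ‖g x - g z - D ((x - z) i • contactField s g i z
      + (x - z) j • contactField s g j z)‖ ≤ κ * R := by
    have h1 := norm_sub_contactField_le his hjs hij g z (x - z)
    rw [← hQ] at h1
    set V := (x - z) i • contactField s g i z + (x - z) j • contactField s g j z
    have h2 : ‖D‖ * (A * √Q) ≤ κ / 3 * R := by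
      calc ‖D‖ * (A * √Q) ≤ ‖D‖ * (A * (δ * R)) := by gcongr
        _ = (‖D‖ * A * δ) * R := by ring
        _ ≤ κ / 3 * R := by
          gcongr
          have : δ ≤ κ / (3 * (‖D‖ * A + 1)) := min_le_right _ _
          rw [le_div_iff₀ (by positivity)] at this
          linarith
    have h3 : η * ‖x - z‖ ≤ κ / 3 * R := by
      calc η * ‖x - z‖ ≤ κ / (3 * c₅) * (c₅ * R) := by
            gcongr
            exact min_le_right _ _
        _ = κ / 3 * R := by field_simp
    calc ‖g x - g z - D V‖ = ‖(g x - g z - D (x - z)) + D (x - z - V)‖ := by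
          rw [map_sub D (x - z) V]; congr 1; abel
      _ ≤ ‖g x - g z - D (x - z)‖ + ‖D (x - z - V)‖ := norm_add_le _ _
      _ ≤ η * ‖x - z‖ + ‖D‖ * (|verticalPart s (g z) (x - z)| + A * √Q) :=
          add_le_add hxlit ((D.le_opNorm _).trans (mul_le_mul_of_nonneg_left h1 (norm_nonneg _)))
      _ ≤ κ * R := by rw [mul_add]; linarith
  have hei := (norm_le_pi_norm _ i).trans herr
  have hej := (norm_le_pi_norm _ j).trans herr
  simp only [Pi.sub_apply, map_add, map_smul, Pi.add_apply, Pi.smul_apply, smul_eq_mul,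
    Real.norm_eq_abs] at hei hej
  have hci := hxΛ.characteristic hΦs hcont his
  have hcj := hxΛ.characteristic hΦs hcont hjs
  rw [hΦ, fderiv_barrier_contactField_fst his hjs hij] at hci
  rw [hΦ, fderiv_barrier_contactField_snd his hjs hij] at hcj
  have hRzero : R = 0 := by
    refine sq_add_sq_eq_zero_of_antisymm (X := x i - z i) (Y := x j - z j) (a := Bji) (b₁ := Bii)
      (b₂ := Bij) (b₃ := Bjj) (u := g x i - g z i) (v := g x j - g z j) (κ := κ) hlam hR0
      (by rw [hRP, hP]; rfl) hci hcj ?_ ?_ (by rw [hκ]; linarith)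
    · refine le_of_eq_of_le ?_ hei
      congr 1; rw [← hBii, ← hBij]; ring
    · refine le_of_eq_of_le ?_ hej
      congr 1; rw [← hBji, ← hBjj]; ring
  -- All of x − z is controlled by R, so the maximum of the barrier is at z, where the choice of K
  -- contradicts `contact`.
  have hxz : x = z := by
    rw [hRzero, mul_zero] at hxR
    exact sub_eq_zero.1 (norm_le_zero_iff.1 hxR)
  subst hxz
  have hfin := hzΛ.contact Φ hΦs hcont
  have hΦeq : Φ = fun y => ((Ψ y + K * (y i - x i) ^ 2) + K * (y j - x j) ^ 2) +
      (-M) * ((y i - x i) ^ 2 + (y j - x j) ^ 2) ^ 2 := by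
    funext y
    simp only [hΦ, hΨ, barrier]
    ring
  have hsqi := (hcoord i).pow 2
  have hsqj := (hcoord j).pow 2
  have h4 : (Λ x fun y => ((y i - x i) ^ 2 + (y j - x j) ^ 2) ^ 2) = 0 := by
    refine hzΛ.sq_eq_zero _ (hsqi.add hsqj) (by simp) ?_
    have : IsLocalMin (fun y : ι → ℝ => (y i - x i) ^ 2 + (y j - x j) ^ 2) x :=
      Eventually.of_forall fun y => by simp; positivity
    exact this.fderiv_eq_zero
  have hs1 : ContDiff ℝ ∞ fun y => Ψ y + K * (y i - x i) ^ 2 :=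
    hΨs.add (contDiff_const.mul hsqi)
  have hs2 : ContDiff ℝ ∞ fun y => Ψ y + K * (y i - x i) ^ 2 + K * (y j - x j) ^ 2 :=
    hs1.add (contDiff_const.mul hsqj)
  rw [hΦeq, hzΛ.add_mul _ _ hs2 ((hsqi.add hsqj).pow 2), hzΛ.add_mul _ _ hs1 hsqj,
    hzΛ.add_mul _ _ hΨs hsqi, h4] at hfin
  linarith [mul_nonneg hK0 hqj]

end Paraboloid

/-! ### From an exterior ball to openness of the contact set -/

section ContactSet

variable {ι : Type*} [DecidableEq ι] [Fintype ι]

theorem fderiv_sum_sq_sub {ι : Type*} [Fintype ι] (c x v : ι → ℝ) :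
    fderiv ℝ (fun y : ι → ℝ => -∑ k, (y k - c k) ^ 2) x v = -∑ k, 2 * (x k - c k) * v k := by
  have hd : DifferentiableAt ℝ (fun y : ι → ℝ => -∑ k, (y k - c k) ^ 2) x := by fun_prop
  have h1 : HasDerivAt (fun t : ℝ => -∑ k, ((x + t • v) k - c k) ^ 2)
      (fderiv ℝ (fun y : ι → ℝ => -∑ k, (y k - c k) ^ 2) x v) 0 :=
    hd.hasFDerivAt.hasLineDerivAt v
  have hc : ∀ k, HasDerivAt (fun t : ℝ => ((x + t • v) k - c k) ^ 2) (2 * (x k - c k) * v k) 0 :=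
    fun k => by
      have h := (((hasDerivAt_id (0 : ℝ)).mul_const (v k)).const_add (x k)).sub_const (c k)
      simpa using h.fun_pow 2
  exact h1.unique (HasDerivAt.fun_sum fun k _ => hc k).neg

/-- A relatively closed set which carries contact operators at all its points is a neighbourhood of
these, if two of the vector fields `∂_k + g_k ∂_s` have a commutator transversal to them. -/
theorem mem_nhds_of_isContactOperator {s i j : ι} (his : i ≠ s) (hjs : j ≠ s) (hij : i ≠ j)
    {g : (ι → ℝ) → ι → ℝ} {Z O : Set (ι → ℝ)} {w : ι → ℝ} (hO : O ∈ 𝓝 w)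
    (hcl : ∀ C, IsCompact C → C ⊆ O → IsCompact (C ∩ Z)) (hw : w ∈ Z)
    (hg : ∀ z ∈ O, DifferentiableAt ℝ g z)
    (hbr : ∀ z ∈ O, fderiv ℝ g z (contactField s g j z) i ≠ fderiv ℝ g z (contactField s g i z) j)
    {Λ : (ι → ℝ) → ((ι → ℝ) → ℝ) → ℝ}
    (hΛ : ∀ x ∈ O, x ∈ Z → IsContactOperator s g Z x (Λ x)) : Z ∈ 𝓝 w := by
  by_contra hnot
  obtain ⟨r, hr0, hr⟩ := Metric.nhds_basis_closedBall.mem_iff.1 hO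
  -- a point outside `Z`, close to `w`
  have hE0 : ∀ᶠ c in 𝓝 w, dist c w < r / 2 ∧ ∑ k, (w k - c k) ^ 2 < (r / 2) ^ 2 := by
    refine (Metric.eventually_nhds_iff.2 ⟨r / 2, by positivity, fun {y} h => h⟩).and ?_
    have : Continuous fun c : ι → ℝ => ∑ k, (w k - c k) ^ 2 := by fun_prop
    exact this.continuousAt.eventually_lt continuousAt_const (by simp; positivity)
  obtain ⟨c, hcZ, hcr, hcE⟩ : ∃ c, c ∉ Z ∧ dist c w < r / 2 ∧ ∑ k, (w k - c k) ^ 2 < (r / 2) ^ 2 := by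
    by_contra hne
    push Not at hne
    refine hnot (hE0.mono fun c hc => ?_)
    by_contra hcZ
    exact absurd hc.2 (not_lt.2 (hne c hcZ hc.1))
  -- A maximum of Φ is a Euclidean nearest point to c. The norm of `ι → ℝ` is the sup norm, hence
  -- the explicit sum of squares.
  set Φ : (ι → ℝ) → ℝ := fun x => -∑ k, (x k - c k) ^ 2 with hΦ
  have hΦs : ContDiff ℝ ∞ Φ := by fun_prop
  obtain ⟨z, ⟨hzb, hzZ⟩, hzmax⟩ := (hcl (Metric.closedBall w r) (isCompact_closedBall w r)
    hr).exists_isMaxOn ⟨w, Metric.mem_closedBall_self hr0.le, hw⟩ hΦs.continuous.continuousOn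
  have hzw : Φ w ≤ Φ z := hzmax ⟨Metric.mem_closedBall_self hr0.le, hw⟩
  have hzc : ‖z - c‖ < r / 2 := by
    refine lt_of_pow_lt_pow_left₀ 2 (by positivity) ((norm_sq_le_sum_sq _).trans_lt ?_)
    simp only [hΦ, Pi.sub_apply] at hzw ⊢
    linarith
  have hzin : dist z w < r := by
    have := dist_triangle z c w
    rw [dist_eq_norm z c] at this
    linarith
  have hnear : Metric.closedBall w r ∈ 𝓝 z :=
    mem_of_superset (Metric.isOpen_ball.mem_nhds hzin) Metric.ball_subset_closedBall
  have hcont : ∀ᶠ y in 𝓝 z, y ∈ Z → Φ y ≤ Φ z := by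
    filter_upwards [hnear] with y hy hyZ using hzmax ⟨hy, hyZ⟩
  have hzO : z ∈ O := hr hzb
  -- The normal c − z annihilates the contact fields, so its s-component determines it. That
  -- component is nonzero, since otherwise c = z would lie in Z.
  have hchar : ∀ k ≠ s, c k - z k = -(c s - z s) * g z k := by
    intro k hk
    have h := (hΛ z hzO hzZ).characteristic hΦs hcont hk
    rw [hΦ, fderiv_sum_sq_sub, ← Finset.add_sum_erase Finset.univ _ (Finset.mem_univ s),
      contactField_apply_self hk, Finset.sum_eq_single_of_mem k (by simp [hk]),
      contactField_apply_of_ne hk, if_pos rfl] at h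
    · linarith
    · intro l hl hlk
      rw [contactField_apply_of_ne (Finset.ne_of_mem_erase hl), if_neg hlk, mul_zero]
  have hlam : c s - z s ≠ 0 := by
    intro h0
    refine hcZ ?_
    have : c = z := by
      funext k
      by_cases hk : k = s
      · rw [hk]; linarith
      · have := hchar k hk
        rw [h0] at this; linarith
    rwa [this]
  refine false_of_exterior_paraboloid his hjs hij
    (mem_of_superset hnear hr) hcl hzZ (hg z hzO) (hbr z hzO) hΛ hlam ?_
  filter_upwards [hcont] with x hx hxZ
  have h := hx hxZ
  have hexp : ∑ k, (x k - c k) ^ 2 = ∑ k, (x - z) k ^ 2 + ∑ k, (z k - c k) ^ 2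
      - 2 * ∑ k, (c k - z k) * (x - z) k := by
    rw [Finset.mul_sum, ← Finset.sum_add_distrib, ← Finset.sum_sub_distrib]
    refine Finset.sum_congr rfl fun k _ => ?_
    simp only [Pi.sub_apply]; ring
  have hv : ∑ k, (c k - z k) * (x - z) k = (c s - z s) * verticalPart s (g z) (x - z) := by
    rw [← Finset.add_sum_erase Finset.univ _ (Finset.mem_univ s), verticalPart, mul_sub,
      Finset.mul_sum, sub_eq_add_neg ((c s - z s) * (x - z) s), ← Finset.sum_neg_distrib]
    congr 1
    refine Finset.sum_congr rfl fun k hk => ?_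
    rw [hchar k (Finset.ne_of_mem_erase hk)]; ring
  simp only [hΦ] at h
  rw [hexp, hv] at h
  linarith

end ContactSet

/-! ### A nonlinear degenerate elliptic operator -/

section Operator

variable {κ : Type*} [Fintype κ]

/-- The operator `|v|^{p-1} (tr C + (p - 1) C (v, v) / |v|²)`. -/
def curvOp (p : ℝ) (v : κ → ℝ) (C : κ → κ → ℝ) : ℝ :=
  (∑ k, v k ^ 2) ^ ((p - 1) / 2) * ∑ k, C k k +
    (p - 1) * (∑ k, v k ^ 2) ^ ((p - 3) / 2) * ∑ k, ∑ l, v k * C k l * v l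

theorem sum_sq_pos {v : κ → ℝ} (hv : v ≠ 0) : 0 < ∑ k, v k ^ 2 := by
  obtain ⟨k, hk⟩ := Function.ne_iff.1 hv
  exact Finset.sum_pos' (fun _ _ => sq_nonneg _) ⟨k, Finset.mem_univ k, by
    have : v k ≠ 0 := hk
    positivity⟩

theorem contDiffAt_curvOp (p : ℝ) {v : κ → ℝ} (hv : v ≠ 0) (C : κ → κ → ℝ) :
    ContDiffAt ℝ ∞ (fun q : (κ → ℝ) × (κ → κ → ℝ) => curvOp p q.1 q.2) (v, C) := by
  unfold curvOp
  have hS : ContDiffAt ℝ ∞ (fun q : (κ → ℝ) × (κ → κ → ℝ) => ∑ k, q.1 k ^ 2) (v, C) := by fun_prop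
  have h0 : (∑ k, v k ^ 2) ≠ 0 := (sum_sq_pos hv).ne'
  have h1 := hS.rpow_const_of_ne (p := (p - 1) / 2) h0
  have h2 := hS.rpow_const_of_ne (p := (p - 3) / 2) h0
  refine (h1.mul ?_).add ((contDiffAt_const.mul h2).mul ?_)
  · fun_prop
  · fun_prop

theorem curvOp_add_smul (p : ℝ) (v : κ → ℝ) (C C' : κ → κ → ℝ) (c : ℝ) :
    curvOp p v (C + c • C') = curvOp p v C + c * curvOp p v C' := by
  simp only [curvOp, Pi.add_apply, Pi.smul_apply, smul_eq_mul, mul_add, add_mul,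
    Finset.sum_add_distrib]
  have h1 : ∑ k, c * C' k k = c * ∑ k, C' k k := by rw [Finset.mul_sum]
  have h2 : ∑ k, ∑ l, v k * (c * C' k l) * v l = c * ∑ k, ∑ l, v k * C' k l * v l := by
    simp only [Finset.mul_sum]
    exact Finset.sum_congr rfl fun k _ => Finset.sum_congr rfl fun l _ => by ring
  rw [h1, h2]
  ring

/-- This splitting shows ellipticity for all p ≥ 0, although the coefficient p − 1 in the definition
may be negative. -/
theorem curvOp_eq (p : ℝ) {v : κ → ℝ} (hv : v ≠ 0) (C : κ → κ → ℝ) :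
    curvOp p v C = (∑ k, v k ^ 2) ^ ((p - 3) / 2) *
      (((∑ k, v k ^ 2) * ∑ k, C k k - ∑ k, ∑ l, v k * C k l * v l) +
        p * ∑ k, ∑ l, v k * C k l * v l) := by
  have : (p - 1) / 2 = (p - 3) / 2 + 1 := by ring
  rw [curvOp, this, Real.rpow_add_one (sum_sq_pos hv).ne']
  ring

/-- Lagrange's identity: each summand is C evaluated twice on v_l e_k − v_k e_l. C need not be
symmetric, as second derivatives along noncommuting fields are not. -/
theorem sum_sq_mul_trace_sub (v : κ → ℝ) (C : κ → κ → ℝ) :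
    (∑ k, v k ^ 2) * ∑ k, C k k - ∑ k, ∑ l, v k * C k l * v l =
      (1 / 2) * ∑ k, ∑ l, (v l ^ 2 * C k k - v l * v k * C k l - v k * v l * C l k
        + v k ^ 2 * C l l) := by
  simp only [Finset.sum_add_distrib, Finset.sum_sub_distrib]
  have h1 : ∑ k, ∑ l, v l ^ 2 * C k k = (∑ k, v k ^ 2) * ∑ k, C k k := by
    rw [Finset.sum_mul_sum, Finset.sum_comm]
  have h2 : ∑ k, ∑ l, v k ^ 2 * C l l = (∑ k, v k ^ 2) * ∑ k, C k k := by
    rw [Finset.sum_mul_sum]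
  have h3 : ∑ k, ∑ l, v l * v k * C k l = ∑ k, ∑ l, v k * C k l * v l :=
    Finset.sum_congr rfl fun k _ => Finset.sum_congr rfl fun l _ => by ring
  have h4 : ∑ k, ∑ l, v k * v l * C l k = ∑ k, ∑ l, v k * C k l * v l := by
    rw [Finset.sum_comm]
    exact Finset.sum_congr rfl fun k _ => Finset.sum_congr rfl fun l _ => by ring
  rw [h1, h2, h3, h4]
  ring

theorem curvOp_nonneg {p : ℝ} (hp : 0 ≤ p) {v : κ → ℝ} (hv : v ≠ 0) {C : κ → κ → ℝ}
    (hC : ∀ ξ : κ → ℝ, 0 ≤ ∑ k, ∑ l, ξ k * C k l * ξ l) : 0 ≤ curvOp p v C := by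
  classical
  rw [curvOp_eq p hv, sum_sq_mul_trace_sub]
  refine mul_nonneg (Real.rpow_nonneg (sum_sq_pos hv).le _)
    (add_nonneg (mul_nonneg (by norm_num) (Finset.sum_nonneg fun k _ => Finset.sum_nonneg
      fun l _ => ?_)) (mul_nonneg hp (hC v)))
  have h := hC (v l • Pi.single k 1 - v k • Pi.single l 1)
  have key : ∀ ξ η : κ → ℝ, ∑ a, ∑ b, (ξ a - η a) * C a b * (ξ b - η b) =
      ∑ a, ∑ b, ξ a * C a b * ξ b - ∑ a, ∑ b, ξ a * C a b * η b
      - ∑ a, ∑ b, η a * C a b * ξ b + ∑ a, ∑ b, η a * C a b * η b := by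
    intro ξ η
    simp only [← Finset.sum_sub_distrib, ← Finset.sum_add_distrib]
    exact Finset.sum_congr rfl fun a _ => Finset.sum_congr rfl fun b _ => by ring
  have hs : ∀ (c d : ℝ) (k l : κ), ∑ a, ∑ b, (c • (Pi.single k 1 : κ → ℝ)) a * C a b *
      (d • (Pi.single l 1 : κ → ℝ)) b = c * d * C k l := by
    intro c d k l
    rw [Finset.sum_eq_single k, Finset.sum_eq_single l]
    · simp; ring
    · intro b _ hb; simp [hb]
    · simp
    · intro a _ ha; simp [ha]
    · simp
  simp only [Pi.sub_apply] at h
  rw [key, hs, hs, hs, hs] at h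
  nlinarith

theorem curvOp_rankOne {p : ℝ} {v : κ → ℝ} (hv : v ≠ 0) (b : κ → ℝ) :
    curvOp p v (fun k l => b k * b l) = (∑ k, v k ^ 2) ^ ((p - 3) / 2) *
      ((1 / 2) * ∑ k, ∑ l, (v l * b k - v k * b l) ^ 2 + p * (∑ k, v k * b k) ^ 2) := by
  have h1 : ∑ k, ∑ l, (v l ^ 2 * (b k * b k) - v l * v k * (b k * b l) - v k * v l * (b l * b k)
      + v k ^ 2 * (b l * b l)) = ∑ k, ∑ l, (v l * b k - v k * b l) ^ 2 :=
    Finset.sum_congr rfl fun k _ => Finset.sum_congr rfl fun l _ => by ring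
  have h2 : ∑ k, ∑ l, v k * (b k * b l) * v l = (∑ k, v k * b k) ^ 2 := by
    rw [sq, Finset.sum_mul_sum]
    exact Finset.sum_congr rfl fun k _ => Finset.sum_congr rfl fun l _ => by ring
  rw [curvOp_eq p hv, sum_sq_mul_trace_sub v fun k l => b k * b l, h1, h2]

theorem curvOp_rankOne_nonneg {p : ℝ} (hp : 0 ≤ p) {v : κ → ℝ} (hv : v ≠ 0) (b : κ → ℝ) :
    0 ≤ curvOp p v (fun k l => b k * b l) := by
  rw [curvOp_rankOne hv]
  have := sum_sq_pos hv
  positivity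

/-- Since p = 0 is allowed, only the cross terms can be used, and they give b parallel to v, not b =
0. This is the degeneracy of the equation. -/
theorem parallel_of_curvOp_rankOne_eq_zero {p : ℝ} (hp : 0 ≤ p) {v : κ → ℝ} (hv : v ≠ 0)
    {b : κ → ℝ} (h : curvOp p v (fun k l => b k * b l) = 0) (k l : κ) :
    v l * b k = v k * b l := by
  rw [curvOp_rankOne hv, mul_eq_zero_iff_left
    (Real.rpow_pos_of_pos (sum_sq_pos hv) _).ne'] at h
  have hn : ∀ k, 0 ≤ ∑ l, (v l * b k - v k * b l) ^ 2 := fun k =>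
    Finset.sum_nonneg fun _ _ => sq_nonneg _
  have h0 : ∑ k, ∑ l, (v l * b k - v k * b l) ^ 2 = 0 := by
    have h1 : 0 ≤ ∑ k, ∑ l, (v l * b k - v k * b l) ^ 2 := Finset.sum_nonneg fun k _ => hn k
    have h2 : 0 ≤ p * (∑ k, v k * b k) ^ 2 := by positivity
    linarith
  rw [Finset.sum_eq_zero_iff_of_nonneg fun k _ => hn k] at h0
  have h1 := h0 k (Finset.mem_univ k)
  rw [Finset.sum_eq_zero_iff_of_nonneg fun _ _ => sq_nonneg _] at h1
  have := h1 l (Finset.mem_univ l)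
  rw [sq_eq_zero_iff] at this
  linarith

end Operator

/-! ### First and second derivatives along vector fields -/

section Jets

variable {E κ : Type*} [NormedAddCommGroup E] [NormedSpace ℝ E]

/-- The derivatives of `u` along the vector fields `Y k`. -/
def hGrad (Y : κ → E → E) (u : E → ℝ) (w : E) : κ → ℝ := fun k => fderiv ℝ u w (Y k w)

/-- The second derivatives `Y k (Y l u)`. -/
def hHess (Y : κ → E → E) (u : E → ℝ) (w : E) : κ → κ → ℝ :=
  fun k l => fderiv ℝ (fun x => hGrad Y u x l) w (Y k w)

variable {Y : κ → E → E}

theorem contDiffOn_hGrad [Fintype κ] (hY : ∀ k, ContDiff ℝ ∞ (Y k))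
    {u : E → ℝ} {O : Set E} (hO : IsOpen O) (hu : ContDiffOn ℝ ∞ u O) :
    ContDiffOn ℝ ∞ (hGrad Y u) O :=
  contDiffOn_pi.2 fun k => (hu.fderiv_of_isOpen hO (by simp)).clm_apply (hY k).contDiffOn

theorem contDiffOn_hHess [Fintype κ] (hY : ∀ k, ContDiff ℝ ∞ (Y k))
    {u : E → ℝ} {O : Set E} (hO : IsOpen O) (hu : ContDiffOn ℝ ∞ u O) :
    ContDiffOn ℝ ∞ (hHess Y u) O :=
  contDiffOn_pi.2 fun k => contDiffOn_pi.2 fun l =>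
    ((contDiffOn_pi.1 (contDiffOn_hGrad hY hO hu) l).fderiv_of_isOpen hO (by simp)).clm_apply
      (hY k).contDiffOn

theorem hGrad_add_mul {u ψ : E → ℝ} {x : E} (hu : DifferentiableAt ℝ u x)
    (hψ : DifferentiableAt ℝ ψ x) (c : ℝ) :
    hGrad Y (fun y => u y + c * ψ y) x = hGrad Y u x + c • hGrad Y ψ x := by
  funext k
  simp only [hGrad, Pi.add_apply, Pi.smul_apply, smul_eq_mul]
  rw [fderiv_fun_add hu (hψ.const_mul c), fderiv_const_mul hψ c]
  simp

theorem hHess_add_mul [Fintype κ] (hY : ∀ k, ContDiff ℝ ∞ (Y k))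
    {u ψ : E → ℝ} {O : Set E} (hO : IsOpen O) (hu : ContDiffOn ℝ ∞ u O)
    (hψ : ContDiffOn ℝ ∞ ψ O) (c : ℝ) {x : E} (hx : x ∈ O) :
    hHess Y (fun y => u y + c * ψ y) x = hHess Y u x + c • hHess Y ψ x := by
  have hd : ∀ {f : E → ℝ}, ContDiffOn ℝ ∞ f O → ∀ y ∈ O, DifferentiableAt ℝ f y :=
    fun hf y hy => (hf.differentiableOn (by simp)).differentiableAt (hO.mem_nhds hy)
  funext k l
  have h1 : (fun y => hGrad Y (fun y => u y + c * ψ y) y l) =ᶠ[𝓝 x]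
      fun y => hGrad Y u y l + c * hGrad Y ψ y l := by
    filter_upwards [hO.mem_nhds hx] with y hy
    rw [hGrad_add_mul (hd hu y hy) (hd hψ y hy)]
    simp
  have e1 := hd (contDiffOn_pi.1 (contDiffOn_hGrad hY hO hu) l) x hx
  have e2 := hd (contDiffOn_pi.1 (contDiffOn_hGrad hY hO hψ) l) x hx
  simp only [hHess, Pi.add_apply, Pi.smul_apply, smul_eq_mul]
  rw [h1.fderiv_eq, fderiv_fun_add e1 (e2.const_mul c), fderiv_const_mul e2 c]
  simp

theorem hHess_sq [Fintype κ] (hY : ∀ k, ContDiff ℝ ∞ (Y k))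
    {h : E → ℝ} (hh : ContDiff ℝ ∞ h) {z : E} (hz : h z = 0) :
    hHess Y (fun x => h x ^ 2) z = (2 : ℝ) • fun k l => hGrad Y h z k * hGrad Y h z l := by
  have hd : Differentiable ℝ h := hh.differentiable (by simp)
  have h1 : ∀ l, (fun y => hGrad Y (fun x => h x ^ 2) y l) =
      fun y => 2 * h y * hGrad Y h y l := fun l => by
    funext y
    simp only [hGrad]
    rw [((hd y).hasFDerivAt.pow 2).fderiv]
    simp
  funext k l
  have e2 : DifferentiableAt ℝ (fun y => hGrad Y h y l) z :=
    (contDiffOn_pi.1 (contDiffOn_hGrad hY isOpen_univ hh.contDiffOn) l).differentiableOn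
      (by simp) |>.differentiableAt univ_mem
  simp only [hHess]
  rw [h1, fderiv_fun_mul ((hd z).const_mul 2) e2, fderiv_const_mul (hd z)]
  simp [hz, hGrad]
  ring

theorem hGrad_sq {h : E → ℝ} (hh : ContDiff ℝ ∞ h) {z : E} (hz : h z = 0) :
    hGrad Y (fun x => h x ^ 2) z = 0 := by
  have hd : Differentiable ℝ h := hh.differentiable (by simp)
  funext k
  simp only [hGrad]
  rw [((hd z).hasFDerivAt.pow 2).fderiv]
  simp [hz]

/-- A negative second derivative along v would make x also a local maximum on that line; d would be
constant there and the second derivative zero. -/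
theorem fderiv_fderiv_nonneg_of_isLocalMin {d : E → ℝ} {x : E} (hd : ContDiffAt ℝ ∞ d x)
    (hmin : IsLocalMin d x) (v : E) : 0 ≤ fderiv ℝ (fderiv ℝ d) x v v := by
  by_contra! hneg
  set f : ℝ → ℝ := fun t => d (x + t • v) with hf
  have hline : Continuous fun t : ℝ => x + t • v := by fun_prop
  have hline0 : Tendsto (fun t : ℝ => x + t • v) (𝓝 0) (𝓝 x) := by
    simpa using hline.tendsto 0
  have hl : ∀ t : ℝ, HasDerivAt (fun t : ℝ => x + t • v) v t := fun t => by
    simpa using ((hasDerivAt_id t).smul_const v).const_add x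
  have hdiff : ∀ᶠ y in 𝓝 x, DifferentiableAt ℝ d y := by
    filter_upwards [(hd.of_le (m := 1) (by norm_cast)).eventually (by simp)] with y hy
    exact hy.differentiableAt (by simp)
  have hderiv : deriv f =ᶠ[𝓝 0] fun t => fderiv ℝ d (x + t • v) v := by
    filter_upwards [hline0.eventually hdiff] with t ht
    exact (ht.hasFDerivAt.comp_hasDerivAt t (hl t)).deriv
  have hfd : DifferentiableAt ℝ (fderiv ℝ d) x :=
    (hd.fderiv_right (m := 1) (by norm_cast)).differentiableAt (by simp)
  have hdd : deriv (deriv f) 0 = fderiv ℝ (fderiv ℝ d) x v v := by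
    rw [hderiv.deriv_eq]
    have h0 : HasFDerivAt (fderiv ℝ d) (fderiv ℝ (fderiv ℝ d) x) (x + (0 : ℝ) • v) := by
      simpa using hfd.hasFDerivAt
    have h1 := h0.comp_hasDerivAt (0 : ℝ) (hl 0)
    exact (h1.clm_apply (hasDerivAt_const (0 : ℝ) v)).deriv.trans (by simp)
  have hfmin : IsLocalMin f 0 := by
    have h := hline0.eventually hmin
    filter_upwards [h] with t ht
    simpa [hf] using ht
  have hfmax : IsLocalMax f 0 := by
    refine isLocalMax_of_deriv_deriv_neg (by rwa [hdd]) hfmin.deriv_eq_zero ?_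
    exact ContinuousAt.comp (g := d) (by simpa using hd.continuousAt) hline.continuousAt
  have hconst : f =ᶠ[𝓝 0] fun _ => f 0 := by
    filter_upwards [hfmin, hfmax] with t h1 h2 using le_antisymm h2 h1
  have : deriv (deriv f) 0 = 0 := by
    have h1 : deriv f =ᶠ[𝓝 0] fun _ => 0 := by
      filter_upwards [hconst.eventuallyEq_nhds] with t ht
      rw [ht.deriv_eq]; simp
    rw [h1.deriv_eq]; simp
  rw [hdd] at this
  exact hneg.ne this

/-- At a critical point the terms with derivatives of the fields vanish, so `hHess` is the ordinary
second derivative evaluated on the Y_k. -/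
theorem hHess_nonneg_of_isLocalMin [Fintype κ] (hY : ∀ k, ContDiff ℝ ∞ (Y k))
    {d : E → ℝ} {x : E} (hd : ContDiffAt ℝ ∞ d x)
    (hmin : IsLocalMin d x) (ξ : κ → ℝ) : 0 ≤ ∑ k, ∑ l, ξ k * hHess Y d x k l * ξ l := by
  have hfd : DifferentiableAt ℝ (fderiv ℝ d) x :=
    (hd.fderiv_right (m := 1) (by norm_cast)).differentiableAt (by simp)
  have h : ∀ k l, hHess Y d x k l = fderiv ℝ (fderiv ℝ d) x (Y k x) (Y l x) := by
    intro k l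
    have hYl : DifferentiableAt ℝ (Y l) x := ((hY l).differentiable (by simp)) x
    have := hfd.hasFDerivAt.clm_apply hYl.hasFDerivAt
    simp only [hHess, hGrad]
    rw [this.fderiv]
    simp [hmin.fderiv_eq_zero]
  have h2 := fderiv_fderiv_nonneg_of_isLocalMin hd hmin (∑ k, ξ k • Y k x)
  refine h2.trans_eq ?_
  simp only [map_sum, map_smul, sum_apply, smul_apply,
    smul_eq_mul, Finset.mul_sum, h]
  rw [Finset.sum_comm]
  exact Finset.sum_congr rfl fun k _ => Finset.sum_congr rfl fun l _ => by ring

end Jets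

/-! ### Linearization and the comparison principle at contact points -/

section Comparison

variable {ι κ : Type*} [Fintype ι] [Fintype κ] {Y : κ → (ι → ℝ) → ι → ℝ}

/-- The linearization at `u` of `u ↦ curvOp p (Y u + e) (Y Y u)`. -/
def linCurvOp (p : ℝ) (Y : κ → (ι → ℝ) → ι → ℝ) (e : κ → ℝ) (u : (ι → ℝ) → ℝ) (z : ι → ℝ)
    (Φ : (ι → ℝ) → ℝ) : ℝ :=
  fderiv ℝ (fun q : (κ → ℝ) × (κ → κ → ℝ) => curvOp p q.1 q.2) (hGrad Y u z + e, hHess Y u z)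
    (hGrad Y Φ z, hHess Y Φ z)

theorem linCurvOp_add_mul (p : ℝ) (hY : ∀ k, ContDiff ℝ ∞ (Y k)) (e : κ → ℝ) (u : (ι → ℝ) → ℝ)
    (z : ι → ℝ) {Φ Ψ : (ι → ℝ) → ℝ} (hΦ : ContDiff ℝ ∞ Φ) (hΨ : ContDiff ℝ ∞ Ψ) (c : ℝ) :
    linCurvOp p Y e u z (fun x => Φ x + c * Ψ x) =
      linCurvOp p Y e u z Φ + c * linCurvOp p Y e u z Ψ := by
  have h1 := hGrad_add_mul (Y := Y) (hΦ.differentiable (by simp) z)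
    (hΨ.differentiable (by simp) z) c
  have h2 := hHess_add_mul hY isOpen_univ hΦ.contDiffOn hΨ.contDiffOn c (Set.mem_univ z)
  rw [linCurvOp, h1, h2, linCurvOp, linCurvOp, ← smul_eq_mul, ← map_smul, ← map_add]
  rfl

theorem linCurvOp_sq (p : ℝ) (hY : ∀ k, ContDiff ℝ ∞ (Y k)) (e : κ → ℝ) (u : (ι → ℝ) → ℝ)
    {z : ι → ℝ} (hv : hGrad Y u z + e ≠ 0) {h : (ι → ℝ) → ℝ} (hh : ContDiff ℝ ∞ h) (hz : h z = 0) :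
    linCurvOp p Y e u z (fun x => h x ^ 2) =
      2 * curvOp p (hGrad Y u z + e) fun k l => hGrad Y h z k * hGrad Y h z l := by
  rw [linCurvOp, hHess_sq hY hh hz, hGrad_sq hh hz]
  set v := hGrad Y u z + e
  set C := hHess Y u z
  set B : κ → κ → ℝ := fun k l => hGrad Y h z k * hGrad Y h z l
  have hd : HasFDerivAt (fun q : (κ → ℝ) × (κ → κ → ℝ) => curvOp p q.1 q.2) _ (v, C) :=
    ((contDiffAt_curvOp p hv C).differentiableAt (by simp)).hasFDerivAt
  have h1 : HasDerivAt (fun t : ℝ => curvOp p v (C + t • ((2 : ℝ) • B)))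
      (fderiv ℝ (fun q : (κ → ℝ) × (κ → κ → ℝ) => curvOp p q.1 q.2) (v, C) (0, (2 : ℝ) • B)) 0 := by
    have := hd.hasLineDerivAt (0, (2 : ℝ) • B)
    simpa [HasLineDerivAt] using this
  have h2 : HasDerivAt (fun t : ℝ => curvOp p v (C + t • ((2 : ℝ) • B)))
      (2 * curvOp p v B) 0 := by
    have h3 : (fun t : ℝ => curvOp p v (C + t • ((2 : ℝ) • B))) =
        fun t => curvOp p v C + t * (2 * curvOp p v B) := by
      funext t
      rw [smul_smul, curvOp_add_smul]
      ring
    rw [h3]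
    simpa using ((hasDerivAt_id (0 : ℝ)).mul_const (2 * curvOp p v B)).const_add (curvOp p v C)
  exact h1.unique h2

/-- If the linearization is positive on `ψ`, adding small positive multiples of `ψ` to `u` strictly
increases the operator. -/
theorem eventually_curvOp_lt (p : ℝ) (hY : ∀ k, ContDiff ℝ ∞ (Y k)) (e : κ → ℝ)
    {u ψ : (ι → ℝ) → ℝ} {O : Set (ι → ℝ)} (hO : IsOpen O) (hu : ContDiffOn ℝ ∞ u O)
    (hψ : ContDiff ℝ ∞ ψ) {z : ι → ℝ} (hz : z ∈ O) (hv : hGrad Y u z + e ≠ 0)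
    (hpos : 0 < linCurvOp p Y e u z ψ) :
    ∀ᶠ q : (ι → ℝ) × ℝ in 𝓝 (z, 0), 0 < q.2 →
      hGrad Y u q.1 + e + q.2 • hGrad Y ψ q.1 ≠ 0 ∧
      curvOp p (hGrad Y u q.1 + e) (hHess Y u q.1) <
        curvOp p (hGrad Y u q.1 + e + q.2 • hGrad Y ψ q.1)
          (hHess Y u q.1 + q.2 • hHess Y ψ q.1) := by
  set J : (ι → ℝ) × ℝ → (κ → ℝ) × (κ → κ → ℝ) := fun q =>
    (hGrad Y u q.1 + e + q.2 • hGrad Y ψ q.1, hHess Y u q.1 + q.2 • hHess Y ψ q.1) with hJ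
  have hfst : ContDiffAt ℝ ∞ (Prod.fst : (ι → ℝ) × ℝ → (ι → ℝ)) (z, 0) := contDiffAt_fst
  have hsnd : ContDiffAt ℝ ∞ (Prod.snd : (ι → ℝ) × ℝ → ℝ) (z, 0) := contDiffAt_snd
  have g1 : ContDiffAt ℝ ∞ (hGrad Y u) z := (contDiffOn_hGrad hY hO hu).contDiffAt (hO.mem_nhds hz)
  have g2 : ContDiffAt ℝ ∞ (hHess Y u) z := (contDiffOn_hHess hY hO hu).contDiffAt (hO.mem_nhds hz)
  have g3 : ContDiffAt ℝ ∞ (hGrad Y ψ) z :=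
    (contDiffOn_hGrad hY isOpen_univ hψ.contDiffOn).contDiffAt univ_mem
  have g4 : ContDiffAt ℝ ∞ (hHess Y ψ) z :=
    (contDiffOn_hHess hY isOpen_univ hψ.contDiffOn).contDiffAt univ_mem
  have hJs : ContDiffAt ℝ ∞ J (z, 0) := by
    refine ContDiffAt.prodMk (((g1.comp (z, (0 : ℝ)) hfst).add contDiffAt_const).add
      (hsnd.smul (g3.comp (z, (0 : ℝ)) hfst))) ((g2.comp (z, (0 : ℝ)) hfst).add
      (hsnd.smul (g4.comp (z, (0 : ℝ)) hfst)))
  have hJ0 : J (z, 0) = (hGrad Y u z + e, hHess Y u z) := by simp [hJ]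
  set T : (κ → ℝ) × (κ → κ → ℝ) → ℝ := fun q => curvOp p q.1 q.2 with hT
  have hTs : ContDiffAt ℝ ∞ T (J (z, 0)) := by rw [hJ0]; exact contDiffAt_curvOp p hv _
  have hm : ContDiffAt ℝ ∞ (fun q => T (J q)) (z, 0) := hTs.comp (z, (0 : ℝ)) hJs
  set m := fun q => T (J q) with hmdef
  -- Strict differentiability, applied to the pair q and (q.1, 0), gives an expansion in q.2 that is
  -- uniform in the base point.
  have hstrict := hm.hasStrictFDerivAt (by simp)
  have hdir : fderiv ℝ m (z, 0) (0, 1) = linCurvOp p Y e u z ψ := by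
    have h1 : HasDerivAt (fun t : ℝ => J ((z, (0 : ℝ)) + t • ((0 : ι → ℝ), (1 : ℝ))))
        (hGrad Y ψ z, hHess Y ψ z) 0 := by
      have h2 : (fun t : ℝ => J ((z, (0 : ℝ)) + t • ((0 : ι → ℝ), (1 : ℝ)))) =
          fun t => (hGrad Y u z + e, hHess Y u z) + t • (hGrad Y ψ z, hHess Y ψ z) := by
        funext t; simp [hJ]
      rw [h2]
      simpa using ((hasDerivAt_id (0 : ℝ)).smul_const (hGrad Y ψ z, hHess Y ψ z)).const_add
        (hGrad Y u z + e, hHess Y u z)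
    have h3 : HasFDerivAt T (fderiv ℝ T (hGrad Y u z + e, hHess Y u z))
        (J ((z, (0 : ℝ)) + (0 : ℝ) • ((0 : ι → ℝ), (1 : ℝ)))) := by
      rw [zero_smul, add_zero, hJ0]
      rw [hJ0] at hTs
      exact (hTs.differentiableAt (by simp)).hasFDerivAt
    have h4 := h3.comp_hasDerivAt (0 : ℝ) h1
    exact ((hm.differentiableAt (by simp)).hasFDerivAt.hasLineDerivAt
      ((0 : ι → ℝ), (1 : ℝ))).unique h4
  have hlit := (hstrict.isLittleO.def (half_pos hpos))
  have hpair : Tendsto (fun q : (ι → ℝ) × ℝ => (q, ((q.1, 0) : (ι → ℝ) × ℝ))) (𝓝 (z, 0))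
      (𝓝 ((z, 0), (z, 0))) := by
    have : Continuous (fun q : (ι → ℝ) × ℝ => (q, ((q.1, 0) : (ι → ℝ) × ℝ))) := by fun_prop
    exact this.tendsto (z, 0)
  have hne : ∀ᶠ q in 𝓝 ((z, 0) : (ι → ℝ) × ℝ), (J q).1 ≠ 0 := by
    have : ContinuousAt (fun q => (J q).1) ((z, 0) : (ι → ℝ) × ℝ) := hJs.continuousAt.fst
    exact this.eventually_ne (by rw [hJ0]; exact hv)
  filter_upwards [hpair.eventually hlit, hne] with q hq hqne hq2
  refine ⟨hqne, ?_⟩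
  have h5 : q - (q.1, 0) = q.2 • ((0 : ι → ℝ), (1 : ℝ)) := by
    ext <;> simp
  simp only [h5, map_smul, hdir, smul_eq_mul, norm_smul, Real.norm_eq_abs, abs_of_pos hq2] at hq
  have h6 : ‖((0 : ι → ℝ), (1 : ℝ))‖ = 1 := by simp [Prod.norm_def]
  rw [h6, mul_one] at hq
  have h7 := (abs_le.1 hq).1
  have h8 : m (q.1, 0) = curvOp p (hGrad Y u q.1 + e) (hHess Y u q.1) := by simp [hmdef, hT, hJ]
  have h9 : m q = curvOp p (hGrad Y u q.1 + e + q.2 • hGrad Y ψ q.1)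
          (hHess Y u q.1 + q.2 • hHess Y ψ q.1) := rfl
  rw [← h8, ← h9]
  have : 0 < q.2 * linCurvOp p Y e u z ψ := mul_pos hq2 hpos
  linarith

/-- Where ψ < 0 both terms have the right sign; on the compact set where ψ ≥ 0 the function w has a
positive minimum. -/
theorem exists_pos_forall_sub_mul_pos {X : Type*} [TopologicalSpace X] {K : Set X}
    (hK : IsCompact K) {w ψ : X → ℝ} (hw : ContinuousOn w K) (hψ : ContinuousOn ψ K)
    (hw0 : ∀ x ∈ K, 0 ≤ w x) (h : ∀ x ∈ K, w x = 0 → ψ x < 0) :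
    ∃ ε₀ > 0, ∀ ε, 0 < ε → ε < ε₀ → ∀ x ∈ K, 0 < w x - ε * ψ x := by
  obtain ⟨B, hB⟩ := (hK.image_of_continuousOn hψ).bddAbove
  have hB' : ∀ x ∈ K, ψ x ≤ B := fun x hx => hB ⟨x, hx, rfl⟩
  have hc : IsCompact (K ∩ ψ ⁻¹' Set.Ici 0) := by
    obtain ⟨C, hC, hCK⟩ := (continuousOn_iff_isClosed.1 hψ) (Set.Ici 0) isClosed_Ici
    rw [Set.inter_comm, hCK, Set.inter_comm]
    exact hK.inter_right hC
  rcases (K ∩ ψ ⁻¹' Set.Ici 0).eq_empty_or_nonempty with he | hne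
  · refine ⟨1, one_pos, fun ε hε _ x hx => ?_⟩
    have : ψ x < 0 := by
      by_contra! h0
      exact (Set.eq_empty_iff_forall_notMem.1 he) x ⟨hx, h0⟩
    nlinarith [hw0 x hx]
  · obtain ⟨x₀, hx₀, hmin⟩ := hc.exists_isMinOn hne (hw.mono Set.inter_subset_left)
    have hm : 0 < w x₀ := lt_of_le_of_ne (hw0 x₀ hx₀.1) fun h0 =>
      absurd (h x₀ hx₀.1 h0.symm) (not_lt.2 hx₀.2)
    refine ⟨w x₀ / (|B| + 1), by positivity, fun ε hε hε' x hx => ?_⟩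
    rw [lt_div_iff₀ (by positivity)] at hε'
    by_cases h0 : 0 ≤ ψ x
    · have h1 : w x₀ ≤ w x := hmin ⟨hx, h0⟩
      have h2 : ψ x ≤ |B| := (hB' x hx).trans (le_abs_self B)
      nlinarith [abs_nonneg B]
    · push Not at h0
      nlinarith [hw0 x hx]

/-- The comparison function cannot have a local maximum on the contact set where the linearized
operator is positive. -/
theorem linCurvOp_nonpos_of_contact {p : ℝ} (hp : 0 ≤ p) (hY : ∀ k, ContDiff ℝ ∞ (Y k))
    (e : κ → ℝ) {u₁ u₂ : (ι → ℝ) → ℝ} {O : Set (ι → ℝ)} (hO : IsOpen O)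
    (hu₁ : ContDiffOn ℝ ∞ u₁ O) (hu₂ : ContDiffOn ℝ ∞ u₂ O) (hle : ∀ x ∈ O, u₁ x ≤ u₂ x)
    (hQ : ∀ x ∈ O, curvOp p (hGrad Y u₂ x + e) (hHess Y u₂ x) ≤
      curvOp p (hGrad Y u₁ x + e) (hHess Y u₁ x))
    (hv : ∀ x ∈ O, hGrad Y u₁ x + e ≠ 0) {z : ι → ℝ} (hz : z ∈ O) (hz12 : u₁ z = u₂ z)
    {Φ : (ι → ℝ) → ℝ} (hΦ : ContDiff ℝ ∞ Φ)
    (hmax : ∀ᶠ x in 𝓝 z, u₁ x = u₂ x → Φ x ≤ Φ z) : linCurvOp p Y e u₁ z Φ ≤ 0 := by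
  by_contra! hpos
  have hE : ContDiff ℝ ∞ fun x : ι → ℝ => ∑ k, (x k - z k) ^ 2 := by fun_prop
  set E : (ι → ℝ) → ℝ := fun x => ∑ k, (x k - z k) ^ 2 with hEdef
  -- Subtracting δE makes the local maximum along the contact set strict and keeps the linearization
  -- positive.
  obtain ⟨δ, hδ, hδpos⟩ : ∃ δ > 0, 0 < linCurvOp p Y e u₁ z Φ + -δ * linCurvOp p Y e u₁ z E := by
    refine ⟨linCurvOp p Y e u₁ z Φ / (2 * (|linCurvOp p Y e u₁ z E| + 1)), by positivity, ?_⟩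
    set a := linCurvOp p Y e u₁ z Φ
    set b := linCurvOp p Y e u₁ z E
    have h1 : a / (2 * (|b| + 1)) * b ≤ a / (2 * (|b| + 1)) * (|b| + 1) := by
      gcongr
      linarith [le_abs_self b]
    have h2 : a / (2 * (|b| + 1)) * (|b| + 1) = a / 2 := by
      field_simp
    linarith
  set ψ : (ι → ℝ) → ℝ := fun x => (Φ x + -δ * E x) + -Φ z * 1 with hψdef
  have hψ1 : ContDiff ℝ ∞ fun x => Φ x + -δ * E x := hΦ.add (contDiff_const.mul hE)
  have hψ : ContDiff ℝ ∞ ψ := hψ1.add contDiff_const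
  have hconst : linCurvOp p Y e u₁ z (fun _ => 1) = 0 := by
    have h1 : hGrad Y (fun _ : ι → ℝ => (1 : ℝ)) = 0 := by funext x k; simp [hGrad]
    have h2 : hHess Y (fun _ : ι → ℝ => (1 : ℝ)) z = 0 := by funext k l; simp [hHess, h1]
    rw [linCurvOp, h1, h2]
    exact map_zero _
  have hψpos : 0 < linCurvOp p Y e u₁ z ψ := by
    rw [hψdef, linCurvOp_add_mul p hY e u₁ z hψ1 contDiff_const, hconst,
      linCurvOp_add_mul p hY e u₁ z hΦ hE]
    linarith
  have hψz : ψ z = 0 := by simp [hψdef, hEdef]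
  obtain ⟨U, hU, I, hI, hUI⟩ := mem_nhds_prod_iff.1
    (eventually_curvOp_lt p hY e hO hu₁ hψ hz (hv z hz) hψpos)
  obtain ⟨ε₁, hε₁, hεI⟩ := Metric.mem_nhds_iff.1 hI
  obtain ⟨ρ, hρ, hball⟩ := Metric.nhds_basis_closedBall.mem_iff.1
    (inter_mem hU (inter_mem (hO.mem_nhds hz) hmax))
  have hcont₁ : ContinuousOn u₁ (Metric.closedBall z ρ) :=
    hu₁.continuousOn.mono fun x hx => (hball hx).2.1
  have hcont₂ : ContinuousOn u₂ (Metric.closedBall z ρ) :=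
    hu₂.continuousOn.mono fun x hx => (hball hx).2.1
  -- On the sphere ψ < 0 at contact points, so u₂ − u₁ − εψ is positive there for small ε. It
  -- vanishes at the centre and so has an interior minimum.
  obtain ⟨ε₂, hε₂, hsph⟩ := exists_pos_forall_sub_mul_pos (isCompact_sphere z ρ)
    ((hcont₂.sub hcont₁).mono Metric.sphere_subset_closedBall) hψ.continuous.continuousOn
    (fun x hx => sub_nonneg.2 (hle x (hball (Metric.sphere_subset_closedBall hx)).2.1))
    (fun x hx h0 => by
      have h1 := (hball (Metric.sphere_subset_closedBall hx)).2.2 (sub_eq_zero.1 h0).symm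
      have h2 : x - z ≠ 0 := by
        rw [← norm_ne_zero_iff, ← dist_eq_norm, Metric.mem_sphere.1 hx]; exact hρ.ne'
      have h3 : 0 < E x := sum_sq_pos h2
      simp only [hψdef]
      nlinarith)
  set ε := min ε₁ ε₂ / 2 with hε
  have hε0 : 0 < ε := half_pos (lt_min hε₁ hε₂)
  have hεlt : ε < min ε₁ ε₂ := half_lt_self (lt_min hε₁ hε₂)
  have hcd : ContinuousOn (fun y => u₂ y - u₁ y - ε * ψ y) (Metric.closedBall z ρ) :=
    (hcont₂.sub hcont₁).sub (continuousOn_const.mul hψ.continuous.continuousOn)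
  obtain ⟨x, hxb, hxmin⟩ := (isCompact_closedBall z ρ).exists_isMinOn
    ⟨z, Metric.mem_closedBall_self hρ.le⟩ hcd
  have hxz : u₂ x - u₁ x - ε * ψ x ≤ 0 := by
    have h1 : u₂ x - u₁ x - ε * ψ x ≤ u₂ z - u₁ z - ε * ψ z :=
      hxmin (Metric.mem_closedBall_self hρ.le)
    rw [hψz, hz12] at h1
    simpa using h1
  have hxin : x ∈ Metric.ball z ρ := by
    rcases (Metric.mem_closedBall.1 hxb).lt_or_eq with h | h
    · exact h
    · exact absurd (hsph ε hε0 (hεlt.trans_le (min_le_right _ _)) x h) (not_lt.2 hxz)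
  obtain ⟨hxU, hxO, -⟩ := hball hxb
  have hO2 : ContDiffOn ℝ ∞ (fun y => u₁ y + ε * ψ y) O := hu₁.add
    (contDiffOn_const.mul hψ.contDiffOn)
  set d : (ι → ℝ) → ℝ := fun y => u₂ y + (-1) * (u₁ y + ε * ψ y) with hd
  have hdO : ContDiffOn ℝ ∞ d O := hu₂.add (contDiffOn_const.mul hO2)
  have hdmin : IsLocalMin d x := by
    filter_upwards [Metric.isOpen_ball.mem_nhds hxin] with y hy
    have : u₂ x - u₁ x - ε * ψ x ≤ u₂ y - u₁ y - ε * ψ y :=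
      hxmin (Metric.ball_subset_closedBall hy)
    simp only [hd]
    linarith
  have hda : ∀ {f : (ι → ℝ) → ℝ}, ContDiffOn ℝ ∞ f O → DifferentiableAt ℝ f x :=
    fun hf => (hf.differentiableOn (by simp)).differentiableAt (hO.mem_nhds hxO)
  have hgrad : hGrad Y u₂ x = hGrad Y u₁ x + ε • hGrad Y ψ x := by
    have h1 : hGrad Y d x = 0 := by funext k; simp [hGrad, hdmin.fderiv_eq_zero]
    rw [hd, hGrad_add_mul (hda hu₂) (hda hO2),
      hGrad_add_mul (hda hu₁) (hda hψ.contDiffOn)] at h1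
    funext k
    have := congrFun h1 k
    simp only [Pi.add_apply, Pi.smul_apply, smul_eq_mul, Pi.zero_apply] at this ⊢
    linarith
  have hhess : hHess Y u₂ x = (hHess Y u₁ x + ε • hHess Y ψ x) + (1 : ℝ) • hHess Y d x := by
    rw [hd, hHess_add_mul hY hO hu₂ hO2 _ hxO, hHess_add_mul hY hO hu₁ hψ.contDiffOn _ hxO]
    funext k l
    simp only [Pi.add_apply, Pi.smul_apply, smul_eq_mul]
    ring
  have hI0 : (ε : ℝ) ∈ I := hεI (by
    rw [Metric.mem_ball, Real.dist_eq, sub_zero, abs_of_pos hε0]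
    exact hεlt.trans_le (min_le_left _ _))
  have hfin := hUI (Set.mk_mem_prod hxU hI0) hε0
  simp only at hfin
  have hrw : hGrad Y u₂ x + e = hGrad Y u₁ x + e + ε • hGrad Y ψ x := by rw [hgrad]; abel
  -- At the minimum x the gradients of u₂ and u₁ + εψ agree and the Hessians are ordered, so Q(u₂) ≥
  -- Q(u₁ + εψ) > Q(u₁).
  have hQx := hQ x hxO
  rw [hrw, hhess, curvOp_add_smul] at hQx
  have := curvOp_nonneg hp hfin.1
    (hHess_nonneg_of_isLocalMin hY (hdO.contDiffAt (hO.mem_nhds hxO)) hdmin)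
  linarith [hfin.2]

end Comparison

/-! ### First variation -/

section Determinant

variable {κ : Type*} [Fintype κ] [DecidableEq κ]

/-- The determinant as a continuous multilinear function of the rows. -/
def detMultilinear (κ : Type*) [Fintype κ] [DecidableEq κ] :
    ContinuousMultilinearMap ℝ (fun _ : κ => κ → ℝ) ℝ :=
  ⟨(Matrix.detRowAlternating : (κ → ℝ) [⋀^κ]→ₗ[ℝ] ℝ).toMultilinearMap,
    Continuous.matrix_det (n := κ) (R := ℝ) continuous_id⟩

theorem detMultilinear_apply (M : κ → κ → ℝ) : detMultilinear κ M = Matrix.det M := rfl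

/-- By Cramer's rule the sum is tr(adj(Aᵀ) N Aᵀ), where A is M as a matrix, and Aᵀ adj(Aᵀ) = det A.
The trace of D will be the divergence of ν_p. -/
theorem sum_det_update_linear (D : (κ → ℝ) →ₗ[ℝ] κ → ℝ) (M : κ → κ → ℝ) :
    ∑ i, Matrix.det (Function.update M i (D (M i))) =
      (∑ i, D (Pi.single i 1) i) * Matrix.det M := by
  set N := LinearMap.toMatrix' D with hN
  set A : Matrix κ κ ℝ := M with hA
  have h1 : ∀ i, Matrix.det (Function.update M i (D (M i))) =
      (A.transpose.adjugate * (N * A.transpose)) i i := by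
    intro i
    have h2 : D (M i) = N.mulVec (A i) := by
      rw [hN, ← Matrix.toLin'_apply, Matrix.toLin'_toMatrix']
    rw [h2]
    change (A.updateRow i _).det = _
    rw [← Matrix.cramer_transpose_apply, Matrix.cramer_eq_adjugate_mulVec, Matrix.mulVec_mulVec]
    rw [← Matrix.mul_assoc]
    rfl
  refine (Finset.sum_congr rfl fun i _ => h1 i).trans ?_
  have h3 : ∑ i, (A.transpose.adjugate * (N * A.transpose)) i i =
      Matrix.trace (A.transpose.adjugate * (N * A.transpose)) := rfl
  rw [h3, Matrix.trace_mul_comm, Matrix.mul_assoc, Matrix.mul_adjugate, Matrix.det_transpose,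
    Matrix.mul_smul, Matrix.mul_one, Matrix.trace_smul, smul_eq_mul, mul_comm]
  congr 1

theorem hasDerivAt_det_rows {A : ℝ → κ → κ → ℝ} {A' : κ → κ → ℝ} {t : ℝ}
    (hA : HasDerivAt A A' t) :
    HasDerivAt (fun s => Matrix.det (A s)) (∑ i, Matrix.det (Function.update (A t) i (A' i))) t := by
  have h := ((detMultilinear κ).hasFDerivAt (A t)).comp_hasDerivAt t hA
  rw [ContinuousMultilinearMap.linearDeriv_apply] at h
  exact h

end Determinant

/-! ### Differentiation under the integral over a compact set -/

section ParametricIntegral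

theorem hasDerivAt_setIntegral_of_contDiffOn {E : Type*} [NormedAddCommGroup E] [NormedSpace ℝ E]
    [MeasurableSpace E] [BorelSpace E] [FiniteDimensional ℝ E] (μ : Measure E)
    [IsFiniteMeasureOnCompacts μ] {J : ℝ × E → ℝ} {Ω : Set (ℝ × E)} (hΩ : IsOpen Ω)
    (hJ : ContDiffOn ℝ 1 J Ω) {K : Set E} (hK : IsCompact K) (h0 : ∀ y ∈ K, ((0 : ℝ), y) ∈ Ω) :
    HasDerivAt (fun t => ∫ y in K, J (t, y) ∂μ)
      (∫ y in K, fderiv ℝ J (0, y) (1, 0) ∂μ) 0 := by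
  obtain ⟨U, V, hU, hV, h0U, hKV, hUV⟩ := generalized_tube_lemma (isCompact_singleton (x := (0 : ℝ)))
    hK hΩ (by
      rintro ⟨t, y⟩ ⟨ht, hy⟩
      obtain rfl : t = 0 := ht
      exact h0 y hy)
  obtain ⟨ε, hε, hεU⟩ := Metric.nhds_basis_closedBall.mem_iff.1 (hU.mem_nhds (h0U rfl))
  have hsub : ∀ t ∈ Metric.closedBall (0 : ℝ) ε, ∀ y ∈ K, (t, y) ∈ Ω := fun t ht y hy =>
    hUV ⟨hεU ht, hKV hy⟩
  have hJ' : ContinuousOn (fun q => fderiv ℝ J q ((1 : ℝ), (0 : E))) Ω :=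
    (hJ.continuousOn_fderiv_of_isOpen hΩ le_rfl).clm_apply continuousOn_const
  obtain ⟨C, hC⟩ := ((isCompact_closedBall (0 : ℝ) ε).prod hK).exists_bound_of_continuousOn
    (hJ'.mono fun q hq => hsub q.1 hq.1 q.2 hq.2)
  have hKm := hK.measurableSet
  have hslice : ∀ {F : ℝ × E → ℝ}, ContinuousOn F Ω → ∀ t ∈ Metric.closedBall (0 : ℝ) ε,
      ContinuousOn (fun y => F (t, y)) K := fun hF t ht =>
    hF.comp (by fun_prop) fun y hy => hsub t ht y hy
  refine (hasDerivAt_integral_of_dominated_loc_of_deriv_le (μ := μ.restrict K)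
    (F := fun t y => J (t, y)) (F' := fun t y => fderiv ℝ J (t, y) (1, 0)) (bound := fun _ => C)
    (Metric.ball_mem_nhds (0 : ℝ) hε) ?_ ?_ ?_ ?_ ?_ ?_).2
  · filter_upwards [Metric.closedBall_mem_nhds (0 : ℝ) hε] with t ht
    exact (hslice hJ.continuousOn t ht).aestronglyMeasurable hKm
  · exact (hslice hJ.continuousOn 0 (Metric.mem_closedBall_self hε.le)).integrableOn_compact hK
  · exact (hslice hJ' 0 (Metric.mem_closedBall_self hε.le)).aestronglyMeasurable hKm
  · filter_upwards [ae_restrict_mem hKm] with y hy t ht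
    exact hC (t, y) ⟨Metric.ball_subset_closedBall ht, hy⟩
  · exact continuousOn_const.integrableOn_compact hK
  · filter_upwards [ae_restrict_mem hKm] with y hy t ht
    have hmem := hsub t (Metric.ball_subset_closedBall ht) y hy
    have h1 := ((hJ.differentiableOn one_ne_zero).differentiableAt (hΩ.mem_nhds hmem)).hasFDerivAt
    exact h1.comp_hasDerivAt t ((hasDerivAt_id t).prodMk (hasDerivAt_const t y))

end ParametricIntegral

/-! ### The first variation of the p-area is the divergence of the p-normal -/

section FirstVariation

variable {n : ℕ}

/-- The divergence of the `p`-normal. -/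
def normalDiv (p : ℝ) (φ : Heis n → ℝ) (q : Heis n) : ℝ :=
  ∑ i, fderiv ℝ (pNormal p φ) q (Pi.single i 1) i

theorem contDiff_frame (k : Fin n ⊕ Fin n) : ContDiff ℝ ∞ (frame (n := n) k) := by
  rcases k with j | j <;> unfold frame <;> fun_prop

theorem coNorm_pos {q : Heis n} {α : Heis n →L[ℝ] ℝ} (h : coNorm q α ≠ 0) : 0 < coInner q α α := by
  by_contra h0
  exact h (Real.sqrt_eq_zero_of_nonpos (not_lt.1 h0))

theorem contDiffOn_pNormal (p : ℝ) {φ : Heis n → ℝ} {V : Set (Heis n)} (hV : IsOpen V)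
    (hφ : ContDiffOn ℝ ∞ φ V) (hne : ∀ x ∈ V, coNorm x (fderiv ℝ φ x) ≠ 0) :
    ContDiffOn ℝ ∞ (pNormal p φ) V := by
  have h1 : ∀ k, ContDiffOn ℝ ∞ (fun x => fderiv ℝ φ x (frame k x)) V := fun k =>
    (hφ.fderiv_of_isOpen hV (by simp)).clm_apply (contDiff_frame k).contDiffOn
  have h2 : ContDiffOn ℝ ∞ (fun x => coInner x (fderiv ℝ φ x) (fderiv ℝ φ x)) V :=
    ContDiffOn.sum fun k _ => (h1 k).mul (h1 k)
  have h3 : ContDiffOn ℝ ∞ (fun x => coNorm x (fderiv ℝ φ x)) V := fun x hx =>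
    (h2 x hx).sqrt (coNorm_pos (hne x hx)).ne'
  have h4 : ContDiffOn ℝ ∞ (fun x => (coNorm x (fderiv ℝ φ x) ^ (1 - p))⁻¹) V := fun x hx =>
    (((h3 x hx).rpow_const_of_ne (hne x hx))).inv (by
      have : 0 < coNorm x (fderiv ℝ φ x) := lt_of_le_of_ne (Real.sqrt_nonneg _) (hne x hx).symm
      positivity)
  exact h4.smul (ContDiffOn.sum fun k _ => (h1 k).smul (contDiff_frame k).contDiffOn)

/-- The integrand is a determinant whose rows are the tangent vectors and ν. Moving with velocity fν
changes each row by f Dν(row), up to multiples of the row ν, so the determinant changes by f tr(Dν)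
times itself. -/
theorem hasDerivAt_integral_pullback (p : ℝ) {φ : Heis n → ℝ} {V : Set (Heis n)} (hV : IsOpen V)
    (hφ : ContDiffOn ℝ ∞ φ V) (hne : ∀ x ∈ V, coNorm x (fderiv ℝ φ x) ≠ 0)
    {B : Set (Fin n ⊕ Fin n → ℝ)} {γ : (Fin n ⊕ Fin n → ℝ) → Heis n} (hB : IsOpen B)
    (hγ : ContDiffOn ℝ ∞ γ B) (hγV : Set.MapsTo γ B V) {f : (Fin n ⊕ Fin n → ℝ) → ℝ}
    (hf : ContDiff ℝ ∞ f) (hfc : HasCompactSupport f) (hfB : tsupport f ⊆ B) :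
    HasDerivAt
      (fun t : ℝ => ∫ y in tsupport f,
        pullback (areaForm p φ) (fun w => γ w + (t * f w) • pNormal p φ (γ w)) y)
      (∫ y in tsupport f, f y * normalDiv p φ (γ y) * pullback (areaForm p φ) γ y) 0 := by
  set ν := pNormal p φ with hνdef
  have hν : ContDiffOn ℝ ∞ ν V := contDiffOn_pNormal p hV hφ hne
  have hνγ : ContDiffOn ℝ ∞ (fun w => ν (γ w)) B := hν.comp hγ hγV
  set σ : (Fin n ⊕ Fin n → ℝ) → Heis n := fun w => f w • ν (γ w) with hσdef
  have hσ : ContDiffOn ℝ ∞ σ B := hf.contDiffOn.smul hνγ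
  have hdγ : ∀ y ∈ B, DifferentiableAt ℝ γ y := fun y hy =>
    (hγ.differentiableOn (by simp)).differentiableAt (hB.mem_nhds hy)
  have hdσ : ∀ y ∈ B, DifferentiableAt ℝ σ y := fun y hy =>
    (hσ.differentiableOn (by simp)).differentiableAt (hB.mem_nhds hy)
  have hdν : ∀ x ∈ V, DifferentiableAt ℝ ν x := fun x hx =>
    (hν.differentiableOn (by simp)).differentiableAt (hV.mem_nhds hx)
  -- the matrix whose determinant is the pulled back area form
  set A : ℝ × (Fin n ⊕ Fin n → ℝ) → ((Fin n ⊕ Fin n) ⊕ Unit) → Heis n := fun q =>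
    Sum.elim (fun k => fderiv ℝ γ q.2 (Pi.single k 1) + q.1 • fderiv ℝ σ q.2 (Pi.single k 1))
      fun _ => ν (γ q.2 + q.1 • σ q.2) with hAdef
  set J : ℝ × (Fin n ⊕ Fin n → ℝ) → ℝ := fun q => Matrix.det (A q) with hJdef
  have hpb : ∀ t, ∀ y ∈ B,
      pullback (areaForm p φ) (fun w => γ w + (t * f w) • ν (γ w)) y = J (t, y) := by
    intro t y hy
    have h1 : (fun w => γ w + (t * f w) • ν (γ w)) = fun w => γ w + t • σ w := by
      funext w; simp [hσdef, smul_smul]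
    have h2 : ∀ v, fderiv ℝ (fun w => γ w + t • σ w) y v = fderiv ℝ γ y v + t • fderiv ℝ σ y v := by
      intro v
      rw [((hdγ y hy).hasFDerivAt.fun_add ((hdσ y hy).hasFDerivAt.fun_const_smul t)).fderiv]
      simp
    rw [h1, pullback, areaForm]
    simp only [h2]
    rfl
  set Ω₁ : Set (ℝ × (Fin n ⊕ Fin n → ℝ)) := {q | q.2 ∈ B} with hΩ₁def
  have hΩ₁ : IsOpen Ω₁ := hB.preimage continuous_snd
  have hmap : ContDiffOn ℝ ∞ (fun q : ℝ × (Fin n ⊕ Fin n → ℝ) => γ q.2 + q.1 • σ q.2) Ω₁ :=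
    (hγ.comp contDiff_snd.contDiffOn fun q hq => hq).add
      (contDiff_fst.contDiffOn.smul (hσ.comp contDiff_snd.contDiffOn fun q hq => hq))
  -- Smoothness of ν is known only in V, so the displaced points have to stay in V.
  set Ω := Ω₁ ∩ (fun q : ℝ × (Fin n ⊕ Fin n → ℝ) => γ q.2 + q.1 • σ q.2) ⁻¹' V with hΩdef
  have hΩ : IsOpen Ω := hmap.continuousOn.isOpen_inter_preimage hΩ₁ hV
  have hAs : ContDiffOn ℝ ∞ A Ω := by
    have hsnd : Set.MapsTo (Prod.snd : ℝ × (Fin n ⊕ Fin n → ℝ) → _) Ω B := fun q hq => hq.1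
    refine contDiffOn_pi.2 ?_
    rintro (k | _)
    · refine ContDiffOn.add ?_ (contDiff_fst.contDiffOn.smul ?_)
      · exact ((hγ.fderiv_of_isOpen hB (by simp)).clm_apply contDiffOn_const).comp
          contDiff_snd.contDiffOn hsnd
      · exact ((hσ.fderiv_of_isOpen hB (by simp)).clm_apply contDiffOn_const).comp
          contDiff_snd.contDiffOn hsnd
    · exact hν.comp (hmap.mono Set.inter_subset_left) fun q hq => hq.2
  have hJs : ContDiffOn ℝ 1 J Ω :=
    ((detMultilinear ((Fin n ⊕ Fin n) ⊕ Unit)).contDiff.comp_contDiffOn hAs).of_le (by simp)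
  have hK : IsCompact (tsupport f) := hfc
  have h0 : ∀ y ∈ B, ((0 : ℝ), y) ∈ Ω := fun y hy => ⟨hy, by simpa using hγV hy⟩
  have hmain := hasDerivAt_setIntegral_of_contDiffOn volume hΩ hJs hK fun y hy => h0 y (hfB hy)
  have hKm := hK.measurableSet
  have e1 : (fun t : ℝ => ∫ y in tsupport f,
      pullback (areaForm p φ) (fun w => γ w + (t * f w) • ν (γ w)) y) =
      fun t => ∫ y in tsupport f, J (t, y) := by
    funext t
    exact setIntegral_congr_fun hKm fun y hy => hpb t y (hfB hy)
  have e2 : (∫ y in tsupport f, f y * normalDiv p φ (γ y) * pullback (areaForm p φ) γ y) =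
      ∫ y in tsupport f, fderiv ℝ J (0, y) (1, 0) := by
    refine setIntegral_congr_fun hKm fun y hy => ?_
    have hyB := hfB hy
    have hJ0 : pullback (areaForm p φ) γ y = Matrix.det (A (0, y)) := by
      have := hpb 0 y hyB
      simpa using this
    have hfd : HasDerivAt (fun t : ℝ => J (t, y)) (fderiv ℝ J (0, y) (1, 0)) 0 := by
      have h1 := ((hJs.differentiableOn one_ne_zero).differentiableAt
        (hΩ.mem_nhds (h0 y hyB))).hasFDerivAt
      exact h1.comp_hasDerivAt (0 : ℝ) ((hasDerivAt_id (0 : ℝ)).prodMk (hasDerivAt_const (0 : ℝ) y))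
    set D := fderiv ℝ ν (γ y) with hD
    have hνd : HasFDerivAt ν D (γ y) := (hdν _ (hγV hyB)).hasFDerivAt
    set c : ((Fin n ⊕ Fin n) ⊕ Unit) → ℝ :=
      Sum.elim (fun k => fderiv ℝ f y (Pi.single k 1)) fun _ => 0 with hc
    have hσd : ∀ v, fderiv ℝ σ y v = fderiv ℝ f y v • ν (γ y) + f y • D (fderiv ℝ γ y v) := by
      intro v
      have h1 : HasFDerivAt (fun w => ν (γ w)) (D.comp (fderiv ℝ γ y)) y :=
        hνd.comp y (hdγ y hyB).hasFDerivAt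
      have h2 := ((hf.differentiable (by simp) y).hasFDerivAt.fun_smul h1).fderiv
      rw [hσdef, h2]
      simp [add_comm]
    have hA0 : A (0, y) = Sum.elim (fun k => fderiv ℝ γ y (Pi.single k 1)) fun _ => ν (γ y) := by
      simp [hAdef]
    have hAd : HasDerivAt (fun t : ℝ => A (t, y))
        (fun i => c i • ν (γ y) + f y • D (A (0, y) i)) 0 := by
      refine hasDerivAt_pi.2 ?_
      rintro (k | _)
      · have h1 := ((hasDerivAt_id (0 : ℝ)).smul_const (fderiv ℝ σ y (Pi.single k 1))).const_add
          (fderiv ℝ γ y (Pi.single k 1))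
        rw [hA0]
        simpa [hAdef, hc, hσd] using h1
      · have h1 : HasDerivAt (fun t : ℝ => γ y + t • σ y) (σ y) 0 := by
          simpa using ((hasDerivAt_id (0 : ℝ)).smul_const (σ y)).const_add (γ y)
        have h2 : HasFDerivAt ν D (γ y + (0 : ℝ) • σ y) := by simpa using hνd
        have h3 : HasDerivAt (ν ∘ fun t : ℝ => γ y + t • σ y) (D (σ y)) 0 :=
          h2.comp_hasDerivAt (0 : ℝ) h1
        rw [hA0]
        have h4 : D (σ y) = f y • D (ν (γ y)) := by simp [hσdef]
        rw [h4] at h3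
        simpa [hAdef, hc, Function.comp_def] using h3
    have hdet := hasDerivAt_det_rows hAd
    have heq := hfd.unique hdet
    rw [heq, hJ0]
    have hrow : ∀ i, Matrix.det (Function.update (A (0, y)) i
        (c i • ν (γ y) + f y • D (A (0, y) i))) =
        f y * Matrix.det (Function.update (A (0, y)) i (D.toLinearMap (A (0, y) i))) := by
      intro i
      have h1 := (detMultilinear ((Fin n ⊕ Fin n) ⊕ Unit)).map_update_add (A (0, y)) i
        (c i • ν (γ y)) (f y • D (A (0, y) i))
      rw [ContinuousMultilinearMap.map_update_smul, ContinuousMultilinearMap.map_update_smul] at h1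
      simp only [detMultilinear_apply] at h1
      rw [h1]
      -- In a tangential row, ν repeats the last row; in the last row c is zero.
      have h2 : c i • Matrix.det (Function.update (A (0, y)) i (ν (γ y))) = 0 := by
        rcases i with k | _
        · have h3 : ν (γ y) = A (0, y) (Sum.inr ()) := by rw [hA0]; rfl
          rw [h3]
          have : Matrix.det (Function.update (A (0, y)) (Sum.inl k) (A (0, y) (Sum.inr ()))) = 0 :=
            Matrix.det_updateRow_eq_zero (M := A (0, y)) (by simp)
          rw [this, smul_zero]
        · simp [hc]
      rw [h2, zero_add, smul_eq_mul]
      rfl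
    simp only [hrow]
    rw [← Finset.mul_sum, sum_det_update_linear, mul_assoc]
    rfl
  rw [e1, e2]
  exact hmain

end FirstVariation

/-! ### Coordinates on the space of translation orbits -/

section Slice

variable {n : ℕ}

/-- No component of a frame field depends on its own coordinate: the only variable coefficient is
that of ∂/∂z, and it is independent of z. -/
theorem sum_fderiv_frame (k : Fin n ⊕ Fin n) (q : Heis n) :
    ∑ i, fderiv ℝ (frame k) q (Pi.single i 1) i = 0 := by
  refine Finset.sum_eq_zero fun i _ => ?_
  have h1 : HasDerivAt (fun t : ℝ => frame k (q + t • Pi.single i 1))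
      (fderiv ℝ (frame k) q (Pi.single i 1)) 0 :=
    (((contDiff_frame k).differentiable (by simp)) q).hasFDerivAt.hasLineDerivAt _
  refine (hasDerivAt_pi.1 h1 i).unique ?_
  have hz : ∀ (l : Fin n ⊕ Fin n) (t : ℝ),
      (q + t • (Pi.single i 1 : Heis n)) (Sum.inl l) * (ddz : Heis n) i =
        q (Sum.inl l) * (ddz : Heis n) i := by
    intro l t
    rcases i with i | i <;> simp [ddz]
  rcases k with j | j
  · have : (fun t : ℝ => frame (Sum.inl j) (q + t • (Pi.single i 1 : Heis n)) i) =
        fun _ => ddx j i + q (Sum.inl (Sum.inr j)) * (ddz : Heis n) i := by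
      funext t
      rw [← hz _ t]
      rfl
    rw [this]
    exact hasDerivAt_const _ _
  · have : (fun t : ℝ => frame (Sum.inr j) (q + t • (Pi.single i 1 : Heis n)) i) =
        fun _ => ddy j i - q (Sum.inl (Sum.inl j)) * (ddz : Heis n) i := by
      funext t
      rw [← hz _ t]
      rfl
    rw [this]
    exact hasDerivAt_const _ _

variable [NeZero n]

/-- The coordinates `(z + x_1 y_1, x_2, …, x_n, y_1, …, y_n)`, which are invariant under the
translations; the first one is indexed by `inl 0`. -/
def slice (q : Heis n) : Fin n ⊕ Fin n → ℝ := fun k =>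
  if k = Sum.inl 0 then q (Sum.inr ()) + q (Sum.inl (Sum.inl 0)) * q (Sum.inl (Sum.inr 0))
  else q (Sum.inl k)

/-- The point with `x_1 = t` on the orbit `w`. -/
def orbitPoint (t : ℝ) (w : Fin n ⊕ Fin n → ℝ) : Heis n :=
  Sum.elim (fun k => if k = Sum.inl 0 then t else w k)
    fun _ => w (Sum.inl 0) - t * w (Sum.inr 0)

/-- The projections of the horizontal frame to the orbit space. -/
def sliceFrame : Fin n ⊕ Fin n → (Fin n ⊕ Fin n → ℝ) → Fin n ⊕ Fin n → ℝ
  | Sum.inl j, w => if j = 0 then (2 * w (Sum.inr 0)) • Pi.single (Sum.inl 0) 1 else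
      Pi.single (Sum.inl j) 1 + w (Sum.inr j) • Pi.single (Sum.inl 0) 1
  | Sum.inr j, w => if j = 0 then Pi.single (Sum.inr 0) 1 else
      Pi.single (Sum.inr j) 1 - w (Sum.inl j) • Pi.single (Sum.inl 0) 1

theorem contDiff_sliceFrame (k : Fin n ⊕ Fin n) : ContDiff ℝ ∞ (sliceFrame (n := n) k) := by
  rcases k with j | j <;> unfold sliceFrame <;> by_cases h : j = 0 <;> simp only [h, if_true, if_false]
    <;> fun_prop

theorem contDiff_slice : ContDiff ℝ ∞ (slice (n := n)) := by
  refine contDiff_pi.2 fun k => ?_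
  unfold slice
  by_cases h : k = Sum.inl 0 <;> simp only [h, if_true, if_false] <;> fun_prop

theorem slice_orbitPoint (t : ℝ) (w : Fin n ⊕ Fin n → ℝ) : slice (orbitPoint t w) = w := by
  funext k
  by_cases h : k = Sum.inl 0
  · subst h; simp [slice, orbitPoint]
  · simp [slice, orbitPoint, h]

theorem orbitPoint_apply_zero (t : ℝ) (w : Fin n ⊕ Fin n → ℝ) :
    orbitPoint t w (Sum.inl (Sum.inl 0)) = t := by simp [orbitPoint]

theorem orbitPoint_slice (q : Heis n) : orbitPoint (q (Sum.inl (Sum.inl 0))) (slice q) = q := by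
  funext k
  rcases k with k | k
  · by_cases h : k = Sum.inl 0
    · subst h; simp [slice, orbitPoint]
    · simp [slice, orbitPoint, h]
  · simp [slice, orbitPoint]

theorem lTrans_orbitPoint (a t : ℝ) (w : Fin n ⊕ Fin n → ℝ) :
    lTrans a (orbitPoint t w) = orbitPoint (t + a) w := by
  funext k
  rcases k with k | k
  · by_cases h : k = Sum.inl 0
    · subst h; simp [lTrans, orbitPoint, ddx, ddz]
    · simp [lTrans, orbitPoint, ddx, ddz, h]
  · simp [lTrans, orbitPoint, ddx, ddz]
    ring

theorem slice_lTrans (a : ℝ) (q : Heis n) : slice (lTrans a q) = slice q := by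
  rw [← orbitPoint_slice q, lTrans_orbitPoint, slice_orbitPoint, slice_orbitPoint]

theorem lTrans_apply_zero (a : ℝ) (q : Heis n) :
    lTrans a q (Sum.inl (Sum.inl 0)) = q (Sum.inl (Sum.inl 0)) + a := by
  rw [← orbitPoint_slice q, lTrans_orbitPoint, orbitPoint_apply_zero, orbitPoint_apply_zero]

theorem fderiv_slice (q v : Heis n) (k : Fin n ⊕ Fin n) : fderiv ℝ slice q v k =
    if k = Sum.inl 0 then v (Sum.inr ()) + (v (Sum.inl (Sum.inl 0)) * q (Sum.inl (Sum.inr 0))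
      + q (Sum.inl (Sum.inl 0)) * v (Sum.inl (Sum.inr 0))) else v (Sum.inl k) := by
  have hc : ∀ k, HasDerivAt (fun t : ℝ => (q + t • v) k) (v k) 0 := fun k => by
    have := ((hasDerivAt_id (0 : ℝ)).mul_const (v k)).const_add (q k)
    simpa using this
  have h1 : HasDerivAt (fun t : ℝ => slice (q + t • v)) (fderiv ℝ slice q v) 0 :=
    ((contDiff_slice.differentiable (by simp)) q).hasFDerivAt.hasLineDerivAt v
  have h2 := hasDerivAt_pi.1 h1 k
  refine h2.unique ?_
  by_cases h : k = Sum.inl 0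
  · simp only [slice, h, if_true]
    have := (hc (Sum.inr ())).fun_add ((hc (Sum.inl (Sum.inl 0))).fun_mul (hc (Sum.inl (Sum.inr 0))))
    simpa using this
  · simp only [slice, h, if_false]
    exact hc _

/-- The frame is left invariant and the translations are left multiplications, so it descends to the
orbit space. -/
theorem fderiv_slice_frame (q : Heis n) (k : Fin n ⊕ Fin n) :
    fderiv ℝ slice q (frame k q) = sliceFrame k (slice q) := by
  funext l
  rw [fderiv_slice]
  rcases k with j | j
  · by_cases hj : j = 0
    · subst hj
      by_cases hl : l = Sum.inl 0
      · subst hl; simp [frame, sliceFrame, slice, ddx, ddz]; ring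
      · simp [frame, sliceFrame, slice, ddx, ddz, hl]
    · by_cases hl : l = Sum.inl 0
      · subst hl; simp [frame, sliceFrame, slice, ddx, ddz, hj, Ne.symm hj]
      · simp [frame, sliceFrame, slice, ddx, ddz, hj, hl, Pi.single_apply]
  · by_cases hj : j = 0
    · subst hj
      by_cases hl : l = Sum.inl 0
      · subst hl; simp [frame, sliceFrame, ddy, ddz]
      · simp [frame, sliceFrame, ddy, ddz, hl, Pi.single_apply]
    · by_cases hl : l = Sum.inl 0
      · subst hl; simp [frame, sliceFrame, slice, ddy, ddz, hj, Ne.symm hj]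
      · simp [frame, sliceFrame, slice, ddy, ddz, hj, hl, Pi.single_apply]

/-- The defining function `u - x_1` of a graph over the orbit space. -/
def graphFun (u : (Fin n ⊕ Fin n → ℝ) → ℝ) (q : Heis n) : ℝ :=
  u (slice q) - q (Sum.inl (Sum.inl 0))

/-- The derivatives of `-x_1` along the horizontal frame. -/
def frameOffset : Fin n ⊕ Fin n → ℝ := -Pi.single (Sum.inl 0) 1

theorem contDiffOn_graphFun {u : (Fin n ⊕ Fin n → ℝ) → ℝ} {O : Set (Fin n ⊕ Fin n → ℝ)}
    (hu : ContDiffOn ℝ ∞ u O) : ContDiffOn ℝ ∞ (graphFun u) (slice ⁻¹' O) :=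
  (hu.comp contDiff_slice.contDiffOn fun _ hx => hx).sub
    (by fun_prop : ContDiff ℝ ∞ fun q : Heis n => q (Sum.inl (Sum.inl 0))).contDiffOn

theorem fderiv_graphFun {u : (Fin n ⊕ Fin n → ℝ) → ℝ} {q : Heis n}
    (hu : DifferentiableAt ℝ u (slice q)) (v : Heis n) :
    fderiv ℝ (graphFun u) q v =
      fderiv ℝ u (slice q) (fderiv ℝ slice q v) - v (Sum.inl (Sum.inl 0)) := by
  have h1 : HasFDerivAt (fun q => u (slice q)) ((fderiv ℝ u (slice q)).comp (fderiv ℝ slice q)) q :=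
    hu.hasFDerivAt.comp q ((contDiff_slice.differentiable (by simp)) q).hasFDerivAt
  have h2 : HasFDerivAt (fun q : Heis n => q (Sum.inl (Sum.inl 0)))
      (ContinuousLinearMap.proj (R := ℝ) (φ := fun _ => ℝ) (Sum.inl (Sum.inl 0))) q :=
    (ContinuousLinearMap.proj (R := ℝ) (φ := fun _ : (Fin n ⊕ Fin n) ⊕ Unit => ℝ)
      (Sum.inl (Sum.inl 0))).hasFDerivAt
  have h3 : fderiv ℝ (graphFun u) q = _ := (h1.sub h2).fderiv
  rw [h3]
  rfl

theorem fderiv_graphFun_frame {u : (Fin n ⊕ Fin n → ℝ) → ℝ} {q : Heis n}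
    (hu : DifferentiableAt ℝ u (slice q)) (k : Fin n ⊕ Fin n) :
    fderiv ℝ (graphFun u) q (frame k q) =
      (hGrad sliceFrame u (slice q) + frameOffset : Fin n ⊕ Fin n → ℝ) k := by
  rw [fderiv_graphFun hu, fderiv_slice_frame]
  have : frame k q (Sum.inl (Sum.inl 0)) = -frameOffset k := by
    rcases k with j | j
    · simp [frame, ddx, ddz, frameOffset, Pi.single_apply, eq_comm]
    · simp [frame, ddy, ddz, frameOffset]
  rw [this]
  simp [hGrad]

theorem inv_sqrt_rpow {S : ℝ} (hS : 0 < S) (p : ℝ) : (√S ^ (1 - p))⁻¹ = S ^ ((p - 1) / 2) := by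
  rw [Real.sqrt_eq_rpow, ← Real.rpow_mul hS.le, ← Real.rpow_neg hS.le]
  congr 1
  ring

/-- Near q, ν_p is the sum of |V|^{p−1} V_k ê_k with coefficients depending only on the orbit. The
frame is divergence free, so the divergence is the sum of Y_k(|V|^{p−1} V_k), expanded by the
product rule. -/
theorem normalDiv_eq_curvOp (p : ℝ) {u : (Fin n ⊕ Fin n → ℝ) → ℝ} {O : Set (Fin n ⊕ Fin n → ℝ)}
    (hO : IsOpen O) (hu : ContDiffOn ℝ ∞ u O) {φ : Heis n → ℝ} {q : Heis n} (hq : slice q ∈ O)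
    (hv : hGrad sliceFrame u (slice q) + frameOffset ≠ 0) (hφ : φ =ᶠ[𝓝 q] graphFun u) :
    normalDiv p φ q = curvOp p (hGrad sliceFrame u (slice q) + frameOffset)
      (hHess sliceFrame u (slice q)) := by
  set w := slice q with hw
  set V : (Fin n ⊕ Fin n → ℝ) → Fin n ⊕ Fin n → ℝ := fun y =>
    hGrad sliceFrame u y + frameOffset with hV
  have hVs : ContDiffOn ℝ ∞ V O := (contDiffOn_hGrad contDiff_sliceFrame hO hu).add contDiffOn_const
  have hVd : ∀ l, DifferentiableAt ℝ (fun y => V y l) w := fun l =>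
    ((contDiffOn_pi.1 hVs l).differentiableOn (by simp)).differentiableAt (hO.mem_nhds hq)
  have hVf : ∀ k l, fderiv ℝ (fun y => V y l) w (sliceFrame k w) = hHess sliceFrame u w k l := by
    intro k l
    have : (fun y => V y l) = fun y => hGrad sliceFrame u y l + frameOffset l := rfl
    rw [this, fderiv_add_const]
    rfl
  set S : (Fin n ⊕ Fin n → ℝ) → ℝ := fun y => ∑ l, V y l ^ 2 with hS
  have hSw : 0 < S w := sum_sq_pos hv
  set c : (Fin n ⊕ Fin n) → (Fin n ⊕ Fin n → ℝ) → ℝ := fun k y =>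
    S y ^ ((p - 1) / 2) * V y k with hc
  have hSd : HasFDerivAt S (∑ l, (2 * V w l) • fderiv ℝ (fun y => V y l) w) w := by
    refine HasFDerivAt.fun_sum fun l _ => ?_
    simpa using (hVd l).hasFDerivAt.pow 2
  have hcd : ∀ k, HasFDerivAt (c k) (S w ^ ((p - 1) / 2) • fderiv ℝ (fun y => V y k) w + V w k •
      (((p - 1) / 2 * S w ^ ((p - 1) / 2 - 1)) •
        ∑ l, (2 * V w l) • fderiv ℝ (fun y => V y l) w)) w := fun k =>
    (hSd.rpow_const (Or.inl hSw.ne')).mul (hVd k).hasFDerivAt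
  have hnear : pNormal p φ =ᶠ[𝓝 q] fun x => ∑ k, c k (slice x) • frame k x := by
    have hSc : ContinuousAt (fun x => S (slice x)) q :=
      ContinuousAt.comp (g := S) hSd.continuousAt contDiff_slice.continuous.continuousAt
    filter_upwards [hφ.eventuallyEq_nhds, contDiff_slice.continuous.continuousAt.preimage_mem_nhds
      (hO.mem_nhds hq), hSc.eventually_const_lt hSw] with x hx hxO hxS
    have hud : DifferentiableAt ℝ u (slice x) :=
      (hu.differentiableOn (by simp)).differentiableAt (hO.mem_nhds hxO)
    have hb : ∀ k, fderiv ℝ φ x (frame k x) = V (slice x) k := fun k => by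
      rw [hx.fderiv_eq, fderiv_graphFun_frame hud]
    have hco : coInner x (fderiv ℝ φ x) (fderiv ℝ φ x) = S (slice x) := by
      simp only [coInner, hb, hS, sq]
    rw [pNormal, coNorm, hco, inv_sqrt_rpow hxS, sharp, Finset.smul_sum]
    refine Finset.sum_congr rfl fun k _ => ?_
    rw [hb, smul_smul]
  have hfd : HasFDerivAt (fun x => ∑ k, c k (slice x) • frame k x)
      (∑ k, (c k w • fderiv ℝ (frame k) q +
        (((S w ^ ((p - 1) / 2) • fderiv ℝ (fun y => V y k) w + V w k •
      (((p - 1) / 2 * S w ^ ((p - 1) / 2 - 1)) •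
        ∑ l, (2 * V w l) • fderiv ℝ (fun y => V y l) w)).comp (fderiv ℝ slice q)).smulRight
          (frame k q)))) q := by
    refine HasFDerivAt.fun_sum fun k _ => ?_
    have h1 := (hcd k).comp q ((contDiff_slice.differentiable (by simp)) q).hasFDerivAt
    exact h1.smul ((contDiff_frame k).differentiable (by simp) q).hasFDerivAt
  rw [normalDiv, hnear.fderiv_eq, hfd.fderiv]
  simp only [sum_apply, Finset.sum_apply, add_apply, Pi.add_apply]
  rw [Finset.sum_comm]
  have hdiv : ∀ (L : Heis n →L[ℝ] ℝ) (x : Heis n), ∑ i, (L.smulRight x) (Pi.single i 1) i = L x := by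
    intro L x
    conv_rhs => rw [pi_eq_sum_univ' x]
    simp [map_sum, mul_comm]
  have hterm : ∀ k, ∑ i, ((c k w • fderiv ℝ (frame k) q) (Pi.single i 1) i +
        ((((S w ^ ((p - 1) / 2) • fderiv ℝ (fun y => V y k) w + V w k •
      (((p - 1) / 2 * S w ^ ((p - 1) / 2 - 1)) •
        ∑ l, (2 * V w l) • fderiv ℝ (fun y => V y l) w)).comp (fderiv ℝ slice q)).smulRight
          (frame k q))) (Pi.single i 1) i) = S w ^ ((p - 1) / 2) * hHess sliceFrame u w k k +
      (p - 1) * S w ^ ((p - 3) / 2) * ∑ l, V w k * hHess sliceFrame u w k l * V w l := by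
    intro k
    rw [Finset.sum_add_distrib, hdiv]
    have h0 : ∑ i, (c k w • fderiv ℝ (frame k) q) (Pi.single i 1) i = 0 := by
      simp only [smul_apply, Pi.smul_apply, smul_eq_mul]
      rw [← Finset.mul_sum, sum_fderiv_frame, mul_zero]
    rw [h0, zero_add, ContinuousLinearMap.comp_apply, fderiv_slice_frame, ← hw]
    simp only [add_apply, smul_apply, sum_apply, smul_eq_mul, hVf]
    have he : (p - 1) / 2 - 1 = (p - 3) / 2 := by ring
    rw [he]
    congr 1
    simp only [Finset.mul_sum]
    refine Finset.sum_congr rfl fun l _ => ?_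
    ring
  rw [Finset.sum_congr rfl fun k _ => hterm k, Finset.sum_add_distrib, ← Finset.mul_sum,
    ← Finset.mul_sum]
  rfl

end Slice

/-! ### The mean curvature of a graph -/

section MeanCurvature

variable {n : ℕ}

theorem continuousOn_normalDiv (p : ℝ) {φ : Heis n → ℝ} {V : Set (Heis n)} (hV : IsOpen V)
    (hφ : ContDiffOn ℝ ∞ φ V) (hne : ∀ x ∈ V, coNorm x (fderiv ℝ φ x) ≠ 0) :
    ContinuousOn (normalDiv p φ) V := by
  have h1 : ContinuousOn (fderiv ℝ (pNormal p φ)) V :=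
    (contDiffOn_pNormal p hV hφ hne).continuousOn_fderiv_of_isOpen hV (by simp)
  exact continuousOn_finsetSum _ fun i _ =>
    (continuous_apply i).comp_continuousOn (h1.clm_apply continuousOn_const)

theorem continuousOn_pullback (p : ℝ) {φ : Heis n → ℝ} {V : Set (Heis n)} (hV : IsOpen V)
    (hφ : ContDiffOn ℝ ∞ φ V) (hne : ∀ x ∈ V, coNorm x (fderiv ℝ φ x) ≠ 0)
    {B : Set (Fin n ⊕ Fin n → ℝ)} {γ : (Fin n ⊕ Fin n → ℝ) → Heis n} (hB : IsOpen B)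
    (hγ : ContDiffOn ℝ ∞ γ B) (hγV : Set.MapsTo γ B V) :
    ContinuousOn (pullback (areaForm p φ) γ) B := by
  have h1 : ContinuousOn (fun y => Sum.elim (fun k => fderiv ℝ γ y (Pi.single k 1))
      (fun _ : Unit => pNormal p φ (γ y))) B := by
    refine continuousOn_pi.2 ?_
    rintro (k | _)
    · exact (hγ.continuousOn_fderiv_of_isOpen hB (by simp)).clm_apply continuousOn_const
    · exact (contDiffOn_pNormal p hV hφ hne).continuousOn.comp hγ.continuousOn hγV
  exact (detMultilinear ((Fin n ⊕ Fin n) ⊕ Unit)).cont.comp_continuousOn h1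

theorem fderiv_pNormal_pos (p : ℝ) {φ : Heis n → ℝ} {x : Heis n}
    (hne : coNorm x (fderiv ℝ φ x) ≠ 0) : 0 < fderiv ℝ φ x (pNormal p φ x) := by
  have h1 : 0 < coNorm x (fderiv ℝ φ x) := lt_of_le_of_ne (Real.sqrt_nonneg _) hne.symm
  have h2 : fderiv ℝ φ x (sharp x (fderiv ℝ φ x)) = coInner x (fderiv ℝ φ x) (fderiv ℝ φ x) := by
    simp [sharp, coInner]
  rw [pNormal, map_smul, h2, smul_eq_mul]
  have := coNorm_pos hne
  positivity

/-- The tangent vectors lie in the kernel of dφ whereas dφ(ν_p) > 0, so the rows are independent. -/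
theorem pullback_areaForm_ne_zero (p : ℝ) {φ : Heis n → ℝ} {γ : (Fin n ⊕ Fin n → ℝ) → Heis n}
    {y : Fin n ⊕ Fin n → ℝ} (hφ : DifferentiableAt ℝ φ (γ y)) (hγ : DifferentiableAt ℝ γ y)
    (hne : coNorm (γ y) (fderiv ℝ φ (γ y)) ≠ 0) (hinj : Function.Injective (fderiv ℝ γ y))
    (h0 : ∀ᶠ w in 𝓝 y, φ (γ w) = 0) : pullback (areaForm p φ) γ y ≠ 0 := by
  intro hdet
  have hker : ∀ v, fderiv ℝ φ (γ y) (fderiv ℝ γ y v) = 0 := by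
    intro v
    have h1 : HasFDerivAt (fun w => φ (γ w)) ((fderiv ℝ φ (γ y)).comp (fderiv ℝ γ y)) y :=
      hφ.hasFDerivAt.comp y hγ.hasFDerivAt
    have h2 : HasFDerivAt (fun w => φ (γ w)) (0 : (Fin n ⊕ Fin n → ℝ) →L[ℝ] ℝ) y :=
      (hasFDerivAt_const (0 : ℝ) y).congr_of_eventuallyEq h0
    have := congrArg (fun L : (Fin n ⊕ Fin n → ℝ) →L[ℝ] ℝ => L v) (h1.unique h2)
    simpa using this
  obtain ⟨c, hc, hc0⟩ := (Matrix.exists_vecMul_eq_zero_iff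
    (M := (Sum.elim (fun k => fderiv ℝ γ y (Pi.single k 1)) (fun _ : Unit => pNormal p φ (γ y)) :
      Matrix ((Fin n ⊕ Fin n) ⊕ Unit) ((Fin n ⊕ Fin n) ⊕ Unit) ℝ))).2 hdet
  set d : Fin n ⊕ Fin n → ℝ := fun k => c (Sum.inl k) with hd
  have hcomb : fderiv ℝ γ y d + c (Sum.inr ()) • pNormal p φ (γ y) = 0 := by
    have h1 : fderiv ℝ γ y d = ∑ k, d k • fderiv ℝ γ y (Pi.single k 1) := by
      conv_lhs => rw [pi_eq_sum_univ' d]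
      simp
    rw [h1, ← hc0]
    funext i
    simp [Matrix.vecMul, dotProduct, hd]
  have hc1 : c (Sum.inr ()) = 0 := by
    have := congrArg (fderiv ℝ φ (γ y)) hcomb
    rw [map_add, hker, map_smul, map_zero, zero_add, smul_eq_mul] at this
    exact (mul_eq_zero.1 this).resolve_right (fderiv_pNormal_pos p hne).ne'
  rw [hc1, zero_smul, add_zero] at hcomb
  have hd0 : d = 0 := hinj (by rw [hcomb, map_zero])
  refine hc (funext fun i => ?_)
  rcases i with k | u
  · exact congrFun hd0 k
  · exact hc1

/-- Fundamental lemma of the calculus of variations: H − div ν_p times the area density vanishes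
almost everywhere, hence everywhere by continuity, and the density has no zeros. -/
theorem eq_normalDiv_of_satisfiesFirstVariation {p : ℝ} {φ : Heis n → ℝ} {S V : Set (Heis n)}
    (hV : IsOpen V) (hφ : ContDiffOn ℝ ∞ φ V) (hne : ∀ x ∈ V, coNorm x (fderiv ℝ φ x) ≠ 0)
    (hS : ∀ x ∈ V, x ∈ S ↔ φ x = 0) {H : Heis n → ℝ} (hH : SatisfiesFirstVariation p φ S V H)
    {B : Set (Fin n ⊕ Fin n → ℝ)} {γ : (Fin n ⊕ Fin n → ℝ) → Heis n} (hB : IsOpen B)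
    (hγ : ContDiffOn ℝ ∞ γ B) (hinj : Set.InjOn γ B)
    (himm : ∀ y ∈ B, Function.Injective (fderiv ℝ γ y)) (hmaps : Set.MapsTo γ B (S ∩ V))
    {y : Fin n ⊕ Fin n → ℝ} (hy : y ∈ B) : H (γ y) = normalDiv p φ (γ y) := by
  have hγV : Set.MapsTo γ B V := fun w hw => (hmaps hw).2
  have hHc : ContinuousOn (fun w => H (γ w)) B := hH.1.comp hγ.continuousOn hmaps
  have hDc : ContinuousOn (fun w => normalDiv p φ (γ w)) B :=
    (continuousOn_normalDiv p hV hφ hne).comp hγ.continuousOn hγV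
  have hPc := continuousOn_pullback p hV hφ hne hB hγ hγV
  set F : (Fin n ⊕ Fin n → ℝ) → ℝ := fun w =>
    (H (γ w) - normalDiv p φ (γ w)) * pullback (areaForm p φ) γ w with hF
  have hFc : ContinuousOn F B := (hHc.sub hDc).mul hPc
  have hFae : ∀ᵐ w, w ∈ B → F w = 0 := by
    refine hB.ae_eq_zero_of_integral_contDiff_smul_eq_zero
      (hFc.locallyIntegrableOn hB.measurableSet) fun g hg hgc hgB => ?_
    have h1 := hH.2 B γ hB hγ hinj himm hmaps g hg hgc hgB
    have h2 := hasDerivAt_integral_pullback p hV hφ hne hB hγ hγV hg hgc hgB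
    have h3 := h1.unique h2
    have hK : IsCompact (tsupport g) := hgc
    have hgc' := hg.continuous.continuousOn (s := tsupport g)
    have i1 : IntegrableOn (fun w => g w * H (γ w) * pullback (areaForm p φ) γ w) (tsupport g) :=
      ((hgc'.mul (hHc.mono hgB)).mul (hPc.mono hgB)).integrableOn_compact hK
    have i2 : IntegrableOn (fun w => g w * normalDiv p φ (γ w) * pullback (areaForm p φ) γ w)
        (tsupport g) := ((hgc'.mul (hDc.mono hgB)).mul (hPc.mono hgB)).integrableOn_compact hK
    have h4 : ∫ w in tsupport g, g w • F w = 0 := by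
      rw [← sub_eq_zero, ← integral_sub i1 i2] at h3
      rw [← h3]
      refine integral_congr_ae (Eventually.of_forall fun w => ?_)
      simp only [hF, smul_eq_mul]
      ring
    rw [← h4]
    refine (setIntegral_eq_integral_of_forall_compl_eq_zero fun w hw => ?_).symm
    rw [image_eq_zero_of_notMem_tsupport hw, zero_smul]
  have hF0 : Set.EqOn F (fun _ => 0) B :=
    Measure.eqOn_open_of_ae_eq (μ := volume) ((ae_restrict_iff' hB.measurableSet).2 hFae) hB hFc
      continuousOn_const
  have h5 := hF0 hy
  have hpb : pullback (areaForm p φ) γ y ≠ 0 := by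
    refine pullback_areaForm_ne_zero p ?_ ?_ (hne _ (hγV hy)) (himm y hy) ?_
    · exact (hφ.differentiableOn (by simp)).differentiableAt (hV.mem_nhds (hγV hy))
    · exact (hγ.differentiableOn (by simp)).differentiableAt (hB.mem_nhds hy)
    · filter_upwards [hB.mem_nhds hy] with w hw using (hS _ (hγV hw)).1 (hmaps hw).1
  exact sub_eq_zero.1 ((mul_eq_zero.1 h5).resolve_right hpb)

variable [NeZero n]

theorem coInner_fderiv_graphFun {u : (Fin n ⊕ Fin n → ℝ) → ℝ} {x : Heis n}
    (hu : DifferentiableAt ℝ u (slice x)) :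
    coInner x (fderiv ℝ (graphFun u) x) (fderiv ℝ (graphFun u) x) =
      ∑ k, (hGrad sliceFrame u (slice x) + frameOffset : Fin n ⊕ Fin n → ℝ) k ^ 2 := by
  simp only [coInner, fderiv_graphFun_frame hu, sq]

theorem contDiff_orbitPoint :
    ContDiff ℝ ∞ fun q : ℝ × (Fin n ⊕ Fin n → ℝ) => orbitPoint q.1 q.2 := by
  refine contDiff_pi.2 ?_
  rintro (k | _)
  · by_cases h : k = Sum.inl 0
    · simp only [orbitPoint, h, Sum.elim_inl, if_true]; fun_prop
    · simp only [orbitPoint, h, Sum.elim_inl, if_false]; fun_prop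
  · simp only [orbitPoint, Sum.elim_inr]; fun_prop

/-- A compatible defining function of a graph is the standard one. -/
theorem eventuallyEq_graphFun {u : (Fin n ⊕ Fin n → ℝ) → ℝ} {S V : Set (Heis n)} {q : Heis n}
    {φ : Heis n → ℝ} (hV : V ∈ 𝓝 q) (hu : ContinuousAt u (slice q)) (hqS : q ∈ S)
    (hS : ∀ᶠ x in 𝓝 q, x ∈ S ↔ x (Sum.inl (Sum.inl 0)) = u (slice x))
    (hφS : ∀ x ∈ V, x ∈ S ↔ φ x = 0) (hφ : IsCompatible φ V) : φ =ᶠ[𝓝 q] graphFun u := by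
  obtain ⟨δ, hδ, hcomp⟩ := hφ
  have hq0 : q (Sum.inl (Sum.inl 0)) = u (slice q) := hS.self_of_nhds.1 hqS
  have huc : ContinuousAt (fun x : Heis n => u (slice x)) q :=
    ContinuousAt.comp (g := u) hu contDiff_slice.continuous.continuousAt
  have hgc : ContinuousAt (graphFun u) q :=
    huc.sub (continuous_apply (Sum.inl (Sum.inl 0))).continuousAt
  have hg0 : graphFun u q = 0 := by rw [graphFun, hq0, sub_self]
  have hlc : Tendsto (fun x : Heis n => lTrans (graphFun u x) x) (𝓝 q) (𝓝 q) := by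
    have h1 : ContinuousAt (fun x : Heis n => orbitPoint (u (slice x)) (slice x)) q :=
      ContinuousAt.comp (g := fun y : ℝ × (Fin n ⊕ Fin n → ℝ) => orbitPoint y.1 y.2)
        contDiff_orbitPoint.continuous.continuousAt
        (huc.prodMk contDiff_slice.continuous.continuousAt)
    have h2 : (fun x : Heis n => lTrans (graphFun u x) x) =
        fun x : Heis n => orbitPoint (u (slice x)) (slice x) := by
      funext x
      conv_lhs => rw [← orbitPoint_slice x, lTrans_orbitPoint]
      rw [orbitPoint_slice, graphFun]
      congr 1
      ring
    rw [h2]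
    have h3 : orbitPoint (u (slice q)) (slice q) = q := by rw [← hq0, orbitPoint_slice]
    have h4 := h1.tendsto
    rwa [h3] at h4
  have hsmall : ∀ᶠ x in 𝓝 q, |graphFun u x| < δ := by
    have := hgc.abs
    exact this.eventually_lt continuousAt_const (by rw [hg0, abs_zero]; exact hδ)
  filter_upwards [hV, hsmall, hlc.eventually hV, hlc.eventually hS] with x hx hxδ hlV hlS
  -- Translation by `graphFun u x` carries x along its orbit onto S, where φ vanishes.
  have h1 := hcomp x hx _ hxδ hlV
  have h2 : lTrans (graphFun u x) x ∈ S := by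
    rw [hlS, lTrans_apply_zero, slice_lTrans, graphFun]
    ring
  rw [(hφS _ hlV).1 h2] at h1
  linarith

/-- Existence and uniqueness together make the choice in `meanCurvature` harmless. Uniqueness is
tested on the graph patch, which `slice` inverts. -/
theorem isMeanCurvatureAt_iff (p : ℝ) {u : (Fin n ⊕ Fin n → ℝ) → ℝ}
    {O : Set (Fin n ⊕ Fin n → ℝ)} (hO : IsOpen O) (hu : ContDiffOn ℝ ∞ u O) {S : Set (Heis n)}
    {q : Heis n} (hq : slice q ∈ O) (hqS : q ∈ S)
    (hS : ∀ᶠ x in 𝓝 q, x ∈ S ↔ x (Sum.inl (Sum.inl 0)) = u (slice x))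
    (hv : hGrad sliceFrame u (slice q) + frameOffset ≠ 0) (h : ℝ) :
    IsMeanCurvatureAt S p q h ↔ h = curvOp p (hGrad sliceFrame u (slice q) + frameOffset)
      (hHess sliceFrame u (slice q)) := by
  have hq0 : q (Sum.inl (Sum.inl 0)) = u (slice q) := hS.self_of_nhds.1 hqS
  have hud : ∀ w ∈ O, DifferentiableAt ℝ u w := fun w hw =>
    (hu.differentiableOn (by simp)).differentiableAt (hO.mem_nhds hw)
  constructor
  · rintro ⟨-, V, φ, hφ, hqV, hcomp, hne, H, hH, rfl⟩
    have hφu : φ =ᶠ[𝓝 q] graphFun u :=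
      eventuallyEq_graphFun (hφ.isOpen.mem_nhds hqV) (hud _ hq).continuousAt hqS hS hφ.mem_iff hcomp
    rw [← normalDiv_eq_curvOp p hO hu hq hv hφu]
    obtain ⟨W, hWS, hW, hqW⟩ := eventually_nhds_iff.1 (hS.and (hφ.isOpen.mem_nhds hqV))
    set γ : (Fin n ⊕ Fin n → ℝ) → Heis n := fun w => orbitPoint (u w) w with hγdef
    have hγO : ContDiffOn ℝ ∞ γ O := contDiff_orbitPoint.comp_contDiffOn (hu.prodMk contDiffOn_id)
    set B := O ∩ γ ⁻¹' W with hBdef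
    have hB : IsOpen B := hγO.continuousOn.isOpen_inter_preimage hO hW
    have hγ : ContDiffOn ℝ ∞ γ B := hγO.mono Set.inter_subset_left
    have hγq : γ (slice q) = q := by simp only [hγdef]; rw [← hq0, orbitPoint_slice]
    have hqB : slice q ∈ B := ⟨hq, by rw [Set.mem_preimage, hγq]; exact hqW⟩
    have hsl : ∀ w, slice (γ w) = w := fun w => slice_orbitPoint _ _
    have key := eq_normalDiv_of_satisfiesFirstVariation hφ.isOpen hφ.contDiffOn hne hφ.mem_iff hH hB hγ
      (fun w _ w' _ hww => by rw [← hsl w, hww, hsl]) (fun y hy => ?_) (fun w hw => ?_) hqB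
    · rwa [hγq] at key
    · have h1 : HasFDerivAt γ (fderiv ℝ γ y) y :=
        ((hγ.differentiableOn (by simp)).differentiableAt (hB.mem_nhds hy)).hasFDerivAt
      have h2 := ((contDiff_slice.differentiable (by simp)) (γ y)).hasFDerivAt.comp y h1
      have h3 : slice ∘ γ = id := funext hsl
      rw [h3] at h2
      have h4 := h2.unique (hasFDerivAt_id y)
      refine Function.LeftInverse.injective (g := fderiv ℝ slice (γ y)) fun v => ?_
      exact congrArg (fun L : (Fin n ⊕ Fin n → ℝ) →L[ℝ] (Fin n ⊕ Fin n → ℝ) => L v) h4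
    · have h1 := hWS (γ w) hw.2
      exact ⟨h1.1.2 (by rw [hsl]; exact orbitPoint_apply_zero _ _), h1.2⟩
  · rintro rfl
    have hVc : ContinuousOn (fun w => hGrad sliceFrame u w + frameOffset) O :=
      ((contDiffOn_hGrad contDiff_sliceFrame hO hu).continuousOn).add continuousOn_const
    have hvne : ∀ᶠ x in 𝓝 q, hGrad sliceFrame u (slice x) + frameOffset ≠ 0 :=
      (contDiff_slice.continuous.continuousAt (x := q)).eventually
        ((hVc.continuousAt (hO.mem_nhds hq)).eventually_ne hv)
    obtain ⟨V, hVS, hV, hqV⟩ := eventually_nhds_iff.1 ((hS.and hvne).and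
      (contDiff_slice.continuous.continuousAt.preimage_mem_nhds (hO.mem_nhds hq)))
    have hφs : ContDiffOn ℝ ∞ (graphFun u) V :=
      (contDiffOn_graphFun hu).mono fun x hx => (hVS x hx).2
    have hne : ∀ x ∈ V, coNorm x (fderiv ℝ (graphFun u) x) ≠ 0 := fun x hx => by
      rw [coNorm, coInner_fderiv_graphFun (hud _ (hVS x hx).2)]
      exact (Real.sqrt_pos.2 (sum_sq_pos (hVS x hx).1.2)).ne'
    refine ⟨hqS, V, graphFun u, ⟨hV, hφs, ?_, ?_⟩, hqV, ⟨1, one_pos, ?_⟩, hne, normalDiv p (graphFun u),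
      ⟨(continuousOn_normalDiv p hV hφs hne).mono Set.inter_subset_right, ?_⟩, ?_⟩
    · intro x hx h0
      refine hne x hx ?_
      simp [coNorm, coInner, h0]
    · intro x hx
      rw [(hVS x hx).1.1, graphFun, sub_eq_zero, eq_comm]
    · intro x _ a _ _
      rw [graphFun, graphFun, slice_lTrans, lTrans_apply_zero]
      ring
    · intro B γ hB hγ _ _ hmaps f hf hfc hfB
      exact hasDerivAt_integral_pullback p hV hφs hne hB hγ (fun w hw => (hmaps hw).2) hf hfc hfB
    · exact normalDiv_eq_curvOp p hO hu hq hv EventuallyEq.rfl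

theorem meanCurvature_eq_curvOp (p : ℝ) {u : (Fin n ⊕ Fin n → ℝ) → ℝ}
    {O : Set (Fin n ⊕ Fin n → ℝ)} (hO : IsOpen O) (hu : ContDiffOn ℝ ∞ u O) {S : Set (Heis n)}
    {q : Heis n} (hq : slice q ∈ O) (hqS : q ∈ S)
    (hS : ∀ᶠ x in 𝓝 q, x ∈ S ↔ x (Sum.inl (Sum.inl 0)) = u (slice x))
    (hv : hGrad sliceFrame u (slice q) + frameOffset ≠ 0) :
    meanCurvature S p q = curvOp p (hGrad sliceFrame u (slice q) + frameOffset)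
      (hHess sliceFrame u (slice q)) := by
  have hiff := isMeanCurvatureAt_iff p hO hu hq hqS hS hv
  have hex : ∃ c, IsMeanCurvatureAt S p q c := ⟨_, (hiff _).2 rfl⟩
  rw [meanCurvature, dif_pos hex]
  exact (hiff _).1 hex.choose_spec

end MeanCurvature

/-! ### Hypersurfaces as graphs -/

section Graph

theorem exists_contDiffOn_implicitFunction {E : Type*} [NormedAddCommGroup E] [NormedSpace ℝ E]
    [CompleteSpace E] {f : E × ℝ → ℝ} {N : Set (E × ℝ)} (hN : IsOpen N) (hf : ContDiffOn ℝ ∞ f N)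
    {w : E} {t : ℝ} (hwt : (w, t) ∈ N) (h0 : f (w, t) = 0) (hne : fderiv ℝ f (w, t) (0, 1) ≠ 0) :
    ∃ (u : E → ℝ) (O : Set E), IsOpen O ∧ w ∈ O ∧ ContDiffOn ℝ ∞ u O ∧ u w = t ∧
      ∀ᶠ x in 𝓝 (w, t), f x = 0 ↔ u x.1 = x.2 := by
  have hinv : ∀ P : E × ℝ, fderiv ℝ f P (0, 1) ≠ 0 →
      (fderiv ℝ f P ∘L .inr ℝ E ℝ).IsInvertible := by
    intro P hP
    refine ⟨ContinuousLinearEquiv.unitsEquivAut ℝ (Units.mk0 _ hP), ?_⟩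
    ext
    simp
  have hfc : ∀ P ∈ N, ContDiffAt ℝ ∞ f P := fun P hP => hf.contDiffAt (hN.mem_nhds hP)
  have hloc : ∀ P ∈ N, fderiv ℝ f P (0, 1) ≠ 0 → f P = 0 → ∃ u : E → ℝ,
      ContDiffAt ℝ ∞ u P.1 ∧ u P.1 = P.2 ∧ ∀ᶠ x in 𝓝 P, f x = 0 ↔ u x.1 = x.2 := by
    intro P hP hP1 hP0
    refine ⟨(hfc P hP).implicitFunction (by simp) (hinv P hP1),
      (hfc P hP).contDiffAt_implicitFunction (by simp) (hinv P hP1),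
      (hfc P hP).implicitFunction_apply_self (by simp) (hinv P hP1), ?_⟩
    have := (hfc P hP).eventually_apply_eq_iff_implicitFunction (by simp) (hinv P hP1)
    rwa [hP0] at this
  obtain ⟨u, hu, huw, hiff⟩ := hloc _ hwt hne h0
  have hgraph : ∀ w', ContinuousAt u w' → ContinuousAt (fun x => (x, u x)) w' := fun w' h =>
    continuousAt_id.prodMk h
  have hg0 : Tendsto (fun x => (x, u x)) (𝓝 w) (𝓝 (w, t)) := by
    have := (hgraph w hu.continuousAt).tendsto
    rwa [huw] at this
  have hfd : ContinuousAt (fun P => fderiv ℝ f P (0, 1)) (w, t) :=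
    ((hf.continuousOn_fderiv_of_isOpen hN (by simp)).clm_apply
      continuousOn_const).continuousAt (hN.mem_nhds hwt)
  have hu1 : ∀ᶠ x in 𝓝 w, ContDiffAt ℝ 1 u x :=
    (hu.of_le (by simp)).eventually (by simp)
  -- `ContDiffAt ℝ ∞` at one point gives C^m only on neighbourhoods that may shrink with m. The
  -- implicit function theorem is therefore applied again at each nearby point of the graph, and
  -- uniqueness identifies the solutions.
  have hsm : ∀ᶠ x in 𝓝 w, ContDiffAt ℝ ∞ u x := by
    filter_upwards [hu1, hg0.eventually (hN.mem_nhds hwt), hg0.eventually (hfd.eventually_ne hne),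
      hg0.eventually hiff.eventually_nhds] with x hx hxN hxd hxi
    obtain ⟨u', hu', -, hiff'⟩ := hloc _ hxN hxd (hxi.self_of_nhds.2 rfl)
    refine hu'.congr_of_eventuallyEq ?_
    have hc := hgraph x hx.continuousAt
    filter_upwards [hc.eventually hxi, hc.eventually hiff'] with y h1 h2
    exact (h2.1 (h1.2 rfl)).symm
  obtain ⟨O, hO, hOo, hwO⟩ := eventually_nhds_iff.1 hsm
  exact ⟨u, O, hOo, hwO, fun x hx => (hO x hx).contDiffWithinAt, huw, hiff⟩

variable {n : ℕ} [NeZero n]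

/-- At q the differential of the defining function is −c dx_1 with c > 0, and x_1 is the orbit
parameter. So the equation is solvable for it, and du = 0 at the base point. -/
theorem HasUnitNormalAt.exists_graph {S : Set (Heis n)} {q : Heis n}
    (h : HasUnitNormalAt S q (-ddx 0)) :
    ∃ (u : (Fin n ⊕ Fin n → ℝ) → ℝ) (O : Set (Fin n ⊕ Fin n → ℝ)), IsOpen O ∧ slice q ∈ O ∧
      ContDiffOn ℝ ∞ u O ∧ u (slice q) = q (Sum.inl (Sum.inl 0)) ∧ fderiv ℝ u (slice q) = 0 ∧
      ∀ᶠ x in 𝓝 q, x ∈ S ↔ x (Sum.inl (Sum.inl 0)) = u (slice x) := by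
  obtain ⟨hqS, -, V, φ, hφ, hqV, c, hc, hn⟩ := h
  set t := q (Sum.inl (Sum.inl 0)) with ht
  set Q : (Fin n ⊕ Fin n → ℝ) × ℝ → Heis n := fun y => orbitPoint y.2 y.1 with hQdef
  have hQ : ContDiff ℝ ∞ Q := contDiff_orbitPoint.comp (contDiff_snd.prodMk contDiff_fst)
  have hQq : Q (slice q, t) = q := orbitPoint_slice q
  have hφQ : HasFDerivAt (fun y => φ (Q y)) ((-c) • ContinuousLinearMap.snd ℝ _ ℝ) (slice q, t) := by
    have h1 : HasFDerivAt φ (fderiv ℝ φ q) (Q (slice q, t)) := by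
      rw [hQq]
      exact ((hφ.contDiffOn.differentiableOn (by simp)).differentiableAt
        (hφ.isOpen.mem_nhds hqV)).hasFDerivAt
    have h2 := (hQ.differentiable (by simp) (slice q, t)).hasFDerivAt
    have h3 := h1.comp _ h2
    have h4 : (fderiv ℝ φ q).comp (fderiv ℝ Q (slice q, t)) =
        (-c) • ContinuousLinearMap.snd ℝ _ ℝ := by
      refine ContinuousLinearMap.ext fun v => ?_
      have h5 := hasFDerivAt_pi'.1 h2 (Sum.inl (Sum.inl 0))
      have h6 : (fun y => Q y (Sum.inl (Sum.inl 0))) = Prod.snd :=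
        funext fun y => orbitPoint_apply_zero _ _
      rw [h6] at h5
      have h7 := congrArg (fun L : (Fin n ⊕ Fin n → ℝ) × ℝ →L[ℝ] ℝ => L v) (h5.unique hasFDerivAt_snd)
      have h8 : fderiv ℝ Q (slice q, t) v (Sum.inl (Sum.inl 0)) = v.2 := h7
      rw [ContinuousLinearMap.comp_apply, hn, ddx, neg_dotProduct, single_one_dotProduct, h8]
      simp
    rw [h4] at h3
    exact h3
  have hf0 : φ (Q (slice q, t)) = 0 := by rw [hQq]; exact (hφ.mem_iff q hqV).1 hqS
  obtain ⟨u, O, hO, hqO, hu, huq, hiff⟩ := exists_contDiffOn_implicitFunction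
    (hφ.isOpen.preimage hQ.continuous) (hφ.contDiffOn.comp hQ.contDiffOn fun _ hx => hx)
    (by rw [Set.mem_preimage, hQq]; exact hqV) hf0
    (by
      have : fderiv ℝ (φ ∘ Q) (slice q, t) = _ := hφQ.fderiv
      rw [this]
      simpa using hc.ne')
  have hud : HasFDerivAt u (fderiv ℝ u (slice q)) (slice q) :=
    ((hu.differentiableOn (by simp)).differentiableAt (hO.mem_nhds hqO)).hasFDerivAt
  refine ⟨u, O, hO, hqO, hu, huq, ?_, ?_⟩
  · have h1 : HasFDerivAt (fun w => (w, u w)) _ (slice q) := (hasFDerivAt_id (slice q)).prodMk hud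
    have h2 : Tendsto (fun w => (w, u w)) (𝓝 (slice q)) (𝓝 (slice q, t)) := by
      have := h1.continuousAt.tendsto
      rwa [huq] at this
    have h3 : HasFDerivAt (fun w => φ (Q (w, u w))) _ (slice q) :=
      HasFDerivAt.comp (g := fun y => φ (Q y)) _ (by rw [huq]; exact hφQ) h1
    have h4 : (fun w => φ (Q (w, u w))) =ᶠ[𝓝 (slice q)] fun _ => 0 := by
      filter_upwards [h2.eventually hiff] with w hw using hw.2 rfl
    have h5 := h3.unique ((hasFDerivAt_const (0 : ℝ) _).congr_of_eventuallyEq h4)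
    refine ContinuousLinearMap.ext fun v => ?_
    have h6 := congrArg (fun L : (Fin n ⊕ Fin n → ℝ) →L[ℝ] ℝ => L v) h5
    simpa [hc.ne'] using h6
  · have h1 : Tendsto (fun x : Heis n => (slice x, x (Sum.inl (Sum.inl 0)))) (𝓝 q)
        (𝓝 (slice q, t)) :=
      (contDiff_slice.continuous.continuousAt).prodMk (continuous_apply _).continuousAt
    filter_upwards [h1.eventually hiff, hφ.isOpen.mem_nhds hqV] with x hx hxV
    rw [hφ.mem_iff x hxV, eq_comm (b := u (slice x)), ← hx]
    simp only [Function.comp_apply, hQdef, orbitPoint_slice]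

end Graph

/-! ### The contact distribution of a graph -/

section ContactDistribution

variable {n : ℕ} [NeZero n]

theorem sliceFrame_zero (w : Fin n ⊕ Fin n → ℝ) :
    sliceFrame (Sum.inl 0) w = (2 * w (Sum.inr 0)) • Pi.single (Sum.inl 0) 1 := by
  simp [sliceFrame]

theorem sliceFrame_of_ne {k : Fin n ⊕ Fin n} (hk : k ≠ Sum.inl 0) (w : Fin n ⊕ Fin n → ℝ) :
    sliceFrame k w =
      Pi.single k 1 + sliceFrame k w (Sum.inl 0) • Pi.single (Sum.inl 0) 1 := by
  rcases k with j | j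
  · have hj : j ≠ 0 := fun h => hk (by rw [h])
    simp [sliceFrame, hj, Ne.symm hj]
  · by_cases hj : j = 0
    · subst hj; simp [sliceFrame]
    · simp [sliceFrame, hj, sub_eq_add_neg]

/-- The derivatives along the horizontal frame of the defining function of the graph of `u`. -/
def graphGrad (u : (Fin n ⊕ Fin n → ℝ) → ℝ) (w : Fin n ⊕ Fin n → ℝ) : Fin n ⊕ Fin n → ℝ :=
  hGrad sliceFrame u w + frameOffset

/-- The coefficients of the frame, in the form `contactField`, of the horizontal vectors tangent to
the graph of `u`. -/
def contactCoeff (u : (Fin n ⊕ Fin n → ℝ) → ℝ) (w : Fin n ⊕ Fin n → ℝ) (k : Fin n ⊕ Fin n) : ℝ :=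
  sliceFrame k w (Sum.inl 0) - 2 * w (Sum.inr 0) * (graphGrad u w k / graphGrad u w (Sum.inl 0))

/-- Subtracting a multiple of Y_0 alters only the coefficient of ∂_s, because Y_0 is itself a
multiple of ∂_s. -/
theorem contactField_contactCoeff (u : (Fin n ⊕ Fin n → ℝ) → ℝ) {k : Fin n ⊕ Fin n}
    (hk : k ≠ Sum.inl 0) (w : Fin n ⊕ Fin n → ℝ) :
    contactField (Sum.inl 0) (contactCoeff u) k w = sliceFrame k w -
      (graphGrad u w k / graphGrad u w (Sum.inl 0)) • sliceFrame (Sum.inl 0) w := by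
  rw [contactField, contactCoeff, sliceFrame_zero, sub_smul, smul_smul]
  conv_rhs => rw [sliceFrame_of_ne hk w]
  rw [mul_comm (2 * w (Sum.inr 0)), ← add_sub_assoc]

theorem contDiffOn_graphGrad {u : (Fin n ⊕ Fin n → ℝ) → ℝ} {O : Set (Fin n ⊕ Fin n → ℝ)}
    (hO : IsOpen O) (hu : ContDiffOn ℝ ∞ u O) : ContDiffOn ℝ ∞ (graphGrad u) O :=
  (contDiffOn_hGrad contDiff_sliceFrame hO hu).add contDiffOn_const

theorem contDiffOn_contactCoeff {u : (Fin n ⊕ Fin n → ℝ) → ℝ} {O : Set (Fin n ⊕ Fin n → ℝ)}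
    (hO : IsOpen O) (hu : ContDiffOn ℝ ∞ u O)
    (hv : ∀ x ∈ O, graphGrad u x (Sum.inl 0) ≠ 0) : ContDiffOn ℝ ∞ (contactCoeff u) O := by
  have h1 := fun k => contDiffOn_pi.1 (contDiffOn_graphGrad hO hu) k
  refine contDiffOn_pi.2 fun k => ?_
  have h2 : ContDiffOn ℝ ∞ (fun w : Fin n ⊕ Fin n → ℝ => sliceFrame k w (Sum.inl 0)) O :=
    (contDiff_pi.1 (contDiff_sliceFrame k) (Sum.inl 0)).contDiffOn
  have h3 : ContDiffOn ℝ ∞ (fun w : Fin n ⊕ Fin n → ℝ => 2 * w (Sum.inr 0)) O := by fun_prop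
  exact h2.sub (h3.mul ((h1 k).div (h1 (Sum.inl 0)) hv))

/-- The symbol on dh is the operator on the rank-one form b ⊗ b with b_k = Y_k h. If it vanishes, b
is parallel to v = `graphGrad u₁ z`, which says that dh kills every Y_k − (v_k/v_0) Y_0. -/
theorem isContactOperator_linCurvOp {p : ℝ} (hp : 0 ≤ p) {O : Set (Fin n ⊕ Fin n → ℝ)}
    (hO : IsOpen O) {u₁ u₂ : (Fin n ⊕ Fin n → ℝ) → ℝ} (hu₁ : ContDiffOn ℝ ∞ u₁ O)
    (hu₂ : ContDiffOn ℝ ∞ u₂ O) (hle : ∀ x ∈ O, u₁ x ≤ u₂ x)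
    (hQ : ∀ x ∈ O, curvOp p (graphGrad u₂ x) (hHess sliceFrame u₂ x) ≤
      curvOp p (graphGrad u₁ x) (hHess sliceFrame u₁ x))
    (hv : ∀ x ∈ O, graphGrad u₁ x (Sum.inl 0) ≠ 0) {z : Fin n ⊕ Fin n → ℝ} (hz : z ∈ O)
    (hz12 : u₁ z = u₂ z) :
    IsContactOperator (Sum.inl 0) (contactCoeff u₁) {x | u₁ x = u₂ x} z
      (linCurvOp p sliceFrame frameOffset u₁ z) := by
  have hv' : ∀ x ∈ O, hGrad sliceFrame u₁ x + frameOffset ≠ 0 := fun x hx h0 =>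
    hv x hx (congrFun h0 (Sum.inl 0))
  have hsq : ∀ {h : (Fin n ⊕ Fin n → ℝ) → ℝ}, ContDiff ℝ ∞ h → h z = 0 →
      linCurvOp p sliceFrame frameOffset u₁ z (fun x => h x ^ 2) = 2 * curvOp p (graphGrad u₁ z)
        fun k l => hGrad sliceFrame h z k * hGrad sliceFrame h z l := fun hh h0 =>
    linCurvOp_sq p contDiff_sliceFrame frameOffset u₁ (hv' z hz) hh h0
  refine ⟨fun Φ Ψ hΦ hΨ c => linCurvOp_add_mul p contDiff_sliceFrame _ _ _ hΦ hΨ c,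
    fun Φ hΦ hmax => linCurvOp_nonpos_of_contact hp contDiff_sliceFrame frameOffset hO hu₁ hu₂ hle
      hQ hv' hz hz12 hΦ hmax, fun h hh h0 => ?_, fun h hh h0 hΛ k hk => ?_, fun h hh h0 hd => ?_⟩
  · rw [hsq hh h0]
    exact mul_nonneg zero_le_two (curvOp_rankOne_nonneg hp (hv' z hz) _)
  · rw [hsq hh h0] at hΛ
    have h1 := parallel_of_curvOp_rankOne_eq_zero hp (hv' z hz)
      ((mul_eq_zero.1 hΛ).resolve_left two_ne_zero) k (Sum.inl 0)
    change graphGrad u₁ z (Sum.inl 0) * hGrad sliceFrame h z k =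
      graphGrad u₁ z k * hGrad sliceFrame h z (Sum.inl 0) at h1
    rw [contactField_contactCoeff u₁ hk, map_sub, map_smul, smul_eq_mul, sub_eq_zero,
      div_mul_eq_mul_div, eq_div_iff (hv z hz), mul_comm]
    exact h1
  · rw [hsq hh h0]
    have h1 : hGrad sliceFrame h z = 0 := by
      funext k
      simp [hGrad, hd]
    simp [h1, curvOp]

/-- The asymmetry is [Y_k, Y_l]u, which vanishes at a critical point of u. -/
theorem hHess_comm_of_fderiv_eq_zero {u : (Fin n ⊕ Fin n → ℝ) → ℝ} {w : Fin n ⊕ Fin n → ℝ}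
    (hu : ContDiffAt ℝ ∞ u w) (h0 : fderiv ℝ u w = 0) (k l : Fin n ⊕ Fin n) :
    hHess sliceFrame u w k l = hHess sliceFrame u w l k := by
  have hd : DifferentiableAt ℝ (fderiv ℝ u) w :=
    (hu.fderiv_right (m := ∞) (by simp)).differentiableAt (by simp)
  have key : ∀ k l, hHess sliceFrame u w k l =
      fderiv ℝ (fderiv ℝ u) w (sliceFrame k w) (sliceFrame l w) := by
    intro k l
    have h1 : HasFDerivAt (fun x => fderiv ℝ u x (sliceFrame l x)) _ w :=
      hd.hasFDerivAt.clm_apply ((contDiff_sliceFrame l).differentiable (by simp) w).hasFDerivAt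
    change fderiv ℝ (fun x => fderiv ℝ u x (sliceFrame l x)) w (sliceFrame k w) = _
    rw [h1.fderiv]
    simp [h0]
  rw [key, key]
  exact (hu.isSymmSndFDerivAt (by
    rw [minSmoothness_of_isRCLikeNormedField]
    exact WithTop.coe_le_coe.2 le_top)).eq _ _

/-- At a critical point v_0 = −1 and the other v_k vanish, so X_k = Y_k there and the quotient
v_l/v_0 has derivative −Y_k Y_l u along Y_k. -/
theorem fderiv_contactCoeff_contactField {u : (Fin n ⊕ Fin n → ℝ) → ℝ}
    {O : Set (Fin n ⊕ Fin n → ℝ)} (hO : IsOpen O) (hu : ContDiffOn ℝ ∞ u O)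
    (hv : ∀ x ∈ O, graphGrad u x (Sum.inl 0) ≠ 0) {w : Fin n ⊕ Fin n → ℝ} (hw : w ∈ O)
    (h0 : fderiv ℝ u w = 0) {k l : Fin n ⊕ Fin n} (hk : k ≠ Sum.inl 0) (hl : l ≠ Sum.inl 0) :
    fderiv ℝ (contactCoeff u) w (contactField (Sum.inl 0) (contactCoeff u) k w) l =
      fderiv ℝ (fun x : Fin n ⊕ Fin n → ℝ => sliceFrame l x (Sum.inl 0)) w (sliceFrame k w) +
        2 * w (Sum.inr 0) * hHess sliceFrame u w k l := by
  have hV0 : graphGrad u w = frameOffset := by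
    funext m
    simp [graphGrad, hGrad, h0]
  have hVs : graphGrad u w (Sum.inl 0) = -1 := by rw [hV0]; simp [frameOffset]
  have hVl : ∀ {m : Fin n ⊕ Fin n}, m ≠ Sum.inl 0 → graphGrad u w m = 0 := fun hm => by
    rw [hV0]; simp [frameOffset, hm]
  have hX : contactField (Sum.inl 0) (contactCoeff u) k w = sliceFrame k w := by
    rw [contactField_contactCoeff u hk, hVl hk, zero_div, zero_smul, sub_zero]
  have hg : HasFDerivAt (contactCoeff u) (fderiv ℝ (contactCoeff u) w) w :=
    (((contDiffOn_contactCoeff hO hu hv).differentiableOn (by simp)).differentiableAt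
      (hO.mem_nhds hw)).hasFDerivAt
  have hVd : ∀ m, DifferentiableAt ℝ (fun y => graphGrad u y m) w := fun m =>
    ((contDiffOn_pi.1 (contDiffOn_graphGrad hO hu) m).differentiableOn (by simp)).differentiableAt
      (hO.mem_nhds hw)
  have hVH : fderiv ℝ (fun y => graphGrad u y l) w (sliceFrame k w) = hHess sliceFrame u w k l := by
    have : (fun y => graphGrad u y l) = fun y => hGrad sliceFrame u y l + frameOffset l := rfl
    rw [this, fderiv_add_const]
    rfl
  have hS : HasFDerivAt (fun x : Fin n ⊕ Fin n → ℝ => sliceFrame l x (Sum.inl 0)) _ w :=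
    ((contDiff_pi.1 (contDiff_sliceFrame l) (Sum.inl 0)).differentiable (by simp) w).hasFDerivAt
  have hy : HasFDerivAt (fun x : Fin n ⊕ Fin n → ℝ => 2 * x (Sum.inr 0)) _ w :=
    ((by fun_prop : Differentiable ℝ fun x : Fin n ⊕ Fin n → ℝ => 2 * x (Sum.inr 0)) w).hasFDerivAt
  have hgl : HasFDerivAt (fun x => sliceFrame l x (Sum.inl 0) -
      2 * x (Sum.inr 0) * (graphGrad u x l * (graphGrad u x (Sum.inl 0))⁻¹)) _ w :=
    hS.sub (hy.mul ((hVd l).hasFDerivAt.mul ((hVd (Sum.inl 0)).fun_inv (hv w hw)).hasFDerivAt))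
  simp only [← div_eq_mul_inv] at hgl
  have h1 := congrArg (fun L : (Fin n ⊕ Fin n → ℝ) →L[ℝ] ℝ => L (sliceFrame k w))
    ((hasFDerivAt_pi'.1 hg l).unique hgl)
  rw [hX]
  refine Eq.trans h1 ?_
  simp [hVl hl, hVs, hVH]

/-- At w the two sides are 1 and −1 plus the same Hessian term, by its symmetry; the inequality
persists nearby by continuity. An index m ≠ 0 exists because n ≥ 2. -/
theorem eventually_bracket_ne {u : (Fin n ⊕ Fin n → ℝ) → ℝ}
    {O : Set (Fin n ⊕ Fin n → ℝ)} (hO : IsOpen O) (hu : ContDiffOn ℝ ∞ u O)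
    (hv : ∀ x ∈ O, graphGrad u x (Sum.inl 0) ≠ 0) {w : Fin n ⊕ Fin n → ℝ} (hw : w ∈ O)
    (h0 : fderiv ℝ u w = 0) {m : Fin n} (hm : m ≠ 0) :
    ∀ᶠ z in 𝓝 w,
      fderiv ℝ (contactCoeff u) z (contactField (Sum.inl 0) (contactCoeff u) (Sum.inr m) z)
        (Sum.inl m) ≠
      fderiv ℝ (contactCoeff u) z (contactField (Sum.inl 0) (contactCoeff u) (Sum.inl m) z)
        (Sum.inr m) := by
  have hg := contDiffOn_contactCoeff hO hu hv
  have hc : ∀ k l, ContinuousAt (fun z => fderiv ℝ (contactCoeff u) z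
      (contactField (Sum.inl 0) (contactCoeff u) k z) l) w := by
    intro k l
    have h1 : ContinuousOn (fun z => contactField (Sum.inl 0) (contactCoeff u) k z) O :=
      continuousOn_const.add (((continuous_apply k).comp_continuousOn hg.continuousOn).smul
        continuousOn_const)
    exact ((continuous_apply l).comp_continuousOn
      ((hg.continuousOn_fderiv_of_isOpen hO (by simp)).clm_apply h1)).continuousAt (hO.mem_nhds hw)
  have hl : (Sum.inl m : Fin n ⊕ Fin n) ≠ Sum.inl 0 := fun h => hm (Sum.inl_injective h)
  have hr : (Sum.inr m : Fin n ⊕ Fin n) ≠ Sum.inl 0 := Sum.inr_ne_inl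
  have hpr : ∀ k : Fin n ⊕ Fin n, HasFDerivAt (fun x : Fin n ⊕ Fin n → ℝ => x k)
      (ContinuousLinearMap.proj (R := ℝ) (φ := fun _ => ℝ) k) w := fun k =>
    (ContinuousLinearMap.proj (R := ℝ) (φ := fun _ : Fin n ⊕ Fin n => ℝ) k).hasFDerivAt
  have e1 : (fun x : Fin n ⊕ Fin n → ℝ => sliceFrame (Sum.inl m) x (Sum.inl 0)) =
      fun x => x (Sum.inr m) := by
    funext x; simp [sliceFrame, hm, Ne.symm hm]
  have e2 : (fun x : Fin n ⊕ Fin n → ℝ => sliceFrame (Sum.inr m) x (Sum.inl 0)) =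
      fun x => -x (Sum.inl m) := by
    funext x; simp [sliceFrame, hm]
  refine ((hc _ _).sub (hc _ _)).eventually_ne (y := 0) ?_ |>.mono fun z hz => sub_ne_zero.1 hz
  rw [Pi.sub_apply, sub_ne_zero]
  rw [fderiv_contactCoeff_contactField hO hu hv hw h0 hr hl,
    fderiv_contactCoeff_contactField hO hu hv hw h0 hl hr,
    hHess_comm_of_fderiv_eq_zero (hu.contDiffAt (hO.mem_nhds hw)) h0 (Sum.inl m), e1, e2,
    (hpr _).fderiv, (hpr _).fun_neg.fderiv]
  have hsingle : (Pi.single (Sum.inl 0) 1 : Fin n ⊕ Fin n → ℝ) (Sum.inl m) = 0 :=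
    Pi.single_eq_of_ne hl 1
  simp only [ContinuousLinearMap.proj_apply, neg_apply, sliceFrame, hm, if_false, Pi.add_apply,
    Pi.sub_apply, Pi.smul_apply, hsingle, Pi.single_eq_same, smul_zero]
  intro h
  have hr' : (Pi.single (Sum.inl 0) 1 : Fin n ⊕ Fin n → ℝ) (Sum.inr m) = 0 :=
    Pi.single_eq_of_ne hr 1
  rw [hr', smul_zero] at h
  linarith

end ContactDistribution

/-! ### The strong maximum principle for graphs -/

section Coincidence

variable {n : ℕ} [NeZero n]

theorem graphGrad_of_fderiv_eq_zero {u : (Fin n ⊕ Fin n → ℝ) → ℝ} {w : Fin n ⊕ Fin n → ℝ}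
    (h0 : fderiv ℝ u w = 0) : graphGrad u w = frameOffset := by
  funext k
  simp [graphGrad, hGrad, h0]

theorem eventually_graphGrad_ne {u : (Fin n ⊕ Fin n → ℝ) → ℝ} {O : Set (Fin n ⊕ Fin n → ℝ)}
    (hO : IsOpen O) (hu : ContDiffOn ℝ ∞ u O) {w : Fin n ⊕ Fin n → ℝ} (hw : w ∈ O)
    (h0 : fderiv ℝ u w = 0) : ∀ᶠ x in 𝓝 w, graphGrad u x (Sum.inl 0) ≠ 0 := by
  refine ContinuousAt.eventually_ne (((continuous_apply (Sum.inl 0)).comp_continuousOn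
    (contDiffOn_graphGrad hO hu).continuousOn).continuousAt (hO.mem_nhds hw)) ?_
  rw [graphGrad_of_fderiv_eq_zero h0]
  simp [frameOffset]

/-- The strong maximum principle for the `p`-mean curvature operator near a critical point. -/
theorem eventually_eq_of_curvOp_le (hn : 2 ≤ n) {p : ℝ} (hp : 0 ≤ p)
    {O : Set (Fin n ⊕ Fin n → ℝ)} (hO : IsOpen O) {u₁ u₂ : (Fin n ⊕ Fin n → ℝ) → ℝ}
    (hu₁ : ContDiffOn ℝ ∞ u₁ O) (hu₂ : ContDiffOn ℝ ∞ u₂ O) (hle : ∀ x ∈ O, u₁ x ≤ u₂ x)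
    (hQ : ∀ x ∈ O, curvOp p (graphGrad u₂ x) (hHess sliceFrame u₂ x) ≤
      curvOp p (graphGrad u₁ x) (hHess sliceFrame u₁ x))
    (hv : ∀ x ∈ O, graphGrad u₁ x (Sum.inl 0) ≠ 0) {w : Fin n ⊕ Fin n → ℝ} (hw : w ∈ O)
    (hw12 : u₁ w = u₂ w) (h0 : fderiv ℝ u₁ w = 0) : ∀ᶠ x in 𝓝 w, u₁ x = u₂ x := by
  obtain ⟨m, hm⟩ : ∃ m : Fin n, m ≠ 0 :=
    haveI : Nontrivial (Fin n) := Fin.nontrivial_iff_two_le.2 hn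
    exists_ne 0
  have hbr := eventually_bracket_ne hO hu₁ hv hw h0 hm
  have hd : ∀ z ∈ O, DifferentiableAt ℝ (contactCoeff u₁) z := fun z hz =>
    ((contDiffOn_contactCoeff hO hu₁ hv).differentiableOn (by simp)).differentiableAt
      (hO.mem_nhds hz)
  refine mem_nhds_of_isContactOperator (Z := {x | u₁ x = u₂ x})
    (Λ := linCurvOp p sliceFrame frameOffset u₁) (fun h => hm (Sum.inl_injective h))
    Sum.inr_ne_inl Sum.inl_ne_inr (inter_mem (hO.mem_nhds hw) hbr) ?_ hw12
    (fun z hz => hd z hz.1) (fun z hz => hz.2)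
    (fun x hx hxZ => isContactOperator_linCurvOp hp hO hu₁ hu₂ hle hQ hv hx.1 hxZ)
  intro C hC hCO
  have hc : ContinuousOn (fun x => u₁ x - u₂ x) C :=
    (hu₁.continuousOn.sub hu₂.continuousOn).mono fun x hx => (hCO hx).1
  have h1 := hc.preimage_isClosed_of_isClosed hC.isClosed (isClosed_singleton (x := (0 : ℝ)))
  have h2 : C ∩ {x | u₁ x = u₂ x} = C ∩ (fun x => u₁ x - u₂ x) ⁻¹' {0} := by
    ext x
    simp [sub_eq_zero]
  rw [h2]
  exact hC.of_isClosed_subset h1 Set.inter_subset_left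

end Coincidence

end Heisenberg

end

open Heisenberg in
theorem corollaryD (n : ℕ) [NeZero n] (hn : 2 ≤ n) (p : ℝ) (hp : 0 ≤ p)
    (S₁ S₂ : Set (Heisenberg.Heis n)) (p₀ : Heisenberg.Heis n)
    (h₁ : Heisenberg.HasUnitNormalAt S₁ p₀ (-Heisenberg.ddx 0))
    (h₂ : Heisenberg.HasUnitNormalAt S₂ p₀ (-Heisenberg.ddx 0))
    (a : Heisenberg.Heis n → ℝ) (ha : Tendsto a (𝓝[S₁] p₀) (𝓝 0))
    (h : ∀ᶠ q in 𝓝[S₁] p₀, 0 ≤ a q ∧ Heisenberg.lTrans (a q) q ∈ S₂ ∧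
      Heisenberg.meanCurvature S₂ p (Heisenberg.lTrans (a q) q) ≤
        Heisenberg.meanCurvature S₁ p q) :
    ∃ U : Set (Heisenberg.Heis n), IsOpen U ∧ p₀ ∈ U ∧ S₁ ∩ U = S₂ ∩ U := by
  obtain ⟨u₁, O₁, hO₁, hw₁, hu₁, hup₁, hd₁, hS₁⟩ := h₁.exists_graph
  obtain ⟨u₂, O₂, hO₂, hw₂, hu₂, hup₂, hd₂, hS₂⟩ := h₂.exists_graph
  set w₀ := slice p₀ with hw₀
  have hpt : orbitPoint (p₀ (Sum.inl (Sum.inl 0))) w₀ = p₀ := orbitPoint_slice p₀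
  have hlim : ∀ {s : (Fin n ⊕ Fin n → ℝ) → ℝ}, Tendsto s (𝓝 w₀) (𝓝 (p₀ (Sum.inl (Sum.inl 0)))) →
      Tendsto (fun w => orbitPoint (s w) w) (𝓝 w₀) (𝓝 p₀) := by
    intro s hs
    have h1 := ((contDiff_orbitPoint (n := n)).continuous.tendsto
      (p₀ (Sum.inl (Sum.inl 0)), w₀)).comp (hs.prodMk_nhds tendsto_id)
    rwa [hpt] at h1
  have hc₁ : Tendsto u₁ (𝓝 w₀) (𝓝 (p₀ (Sum.inl (Sum.inl 0)))) := by
    rw [← hup₁]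
    exact hu₁.continuousOn.continuousAt (hO₁.mem_nhds hw₁)
  have hγ := hlim hc₁
  have hγS : ∀ᶠ w in 𝓝 w₀, orbitPoint (u₁ w) w ∈ S₁ := by
    filter_upwards [hγ.eventually hS₁] with w hw
    rw [hw, orbitPoint_apply_zero, slice_orbitPoint]
  have hγ' : Tendsto (fun w => orbitPoint (u₁ w) w) (𝓝 w₀) (𝓝[S₁] p₀) :=
    tendsto_nhdsWithin_iff.2 ⟨hγ, hγS⟩
  -- Since a tends to 0, the translated point stays near p₀, where S₂ is known to be a graph.
  have hs : Tendsto (fun w => u₁ w + a (orbitPoint (u₁ w) w)) (𝓝 w₀)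
      (𝓝 (p₀ (Sum.inl (Sum.inl 0)))) := by
    simpa using hc₁.add (ha.comp hγ')
  have key : ∀ᶠ w in 𝓝 w₀, w ∈ O₁ ∩ O₂ ∧ u₁ w ≤ u₂ w ∧
      curvOp p (graphGrad u₂ w) (hHess sliceFrame u₂ w) ≤
        curvOp p (graphGrad u₁ w) (hHess sliceFrame u₁ w) ∧
      graphGrad u₁ w (Sum.inl 0) ≠ 0 := by
    filter_upwards [hO₁.mem_nhds hw₁, hO₂.mem_nhds hw₂, hγS, hγ'.eventually h,
      hγ.eventually hS₁.eventually_nhds, (hlim hs).eventually hS₂.eventually_nhds,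
      eventually_graphGrad_ne hO₁ hu₁ hw₁ hd₁, eventually_graphGrad_ne hO₂ hu₂ hw₂ hd₂]
      with w ho₁ ho₂ hwS ⟨ha0, haS, hH⟩ hn₁ hn₂ hv₁ hv₂
    rw [lTrans_orbitPoint] at haS hH
    -- Both points lie on the orbit w, so a is u₂ − u₁ and a ≥ 0 is the ordering of the graphs.
    have hu : u₁ w + a (orbitPoint (u₁ w) w) = u₂ w := by
      have := hn₂.self_of_nhds.1 haS
      rwa [orbitPoint_apply_zero, slice_orbitPoint] at this
    have hne : ∀ {v : Fin n ⊕ Fin n → ℝ}, v (Sum.inl 0) ≠ 0 → v ≠ 0 := fun hv h0 =>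
      hv (congrFun h0 _)
    rw [meanCurvature_eq_curvOp p hO₂ hu₂ (by rwa [slice_orbitPoint]) haS hn₂
        (by rw [slice_orbitPoint]; exact hne hv₂),
      meanCurvature_eq_curvOp p hO₁ hu₁ (by rwa [slice_orbitPoint]) hwS hn₁
        (by rw [slice_orbitPoint]; exact hne hv₁), slice_orbitPoint, slice_orbitPoint] at hH
    exact ⟨⟨ho₁, ho₂⟩, by linarith, hH, hv₁⟩
  obtain ⟨O, hO, hOo, hwO⟩ := eventually_nhds_iff.1 key
  have heq : ∀ᶠ w in 𝓝 w₀, u₁ w = u₂ w :=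
    eventually_eq_of_curvOp_le hn hp hOo (hu₁.mono fun x hx => (hO x hx).1.1)
      (hu₂.mono fun x hx => (hO x hx).1.2) (fun x hx => (hO x hx).2.1)
      (fun x hx => (hO x hx).2.2.1) (fun x hx => (hO x hx).2.2.2) hwO (hup₁.trans hup₂.symm) hd₁
  have hfin : ∀ᶠ x in 𝓝 p₀, x ∈ S₁ ↔ x ∈ S₂ := by
    filter_upwards [hS₁, hS₂, contDiff_slice.continuous.continuousAt.eventually heq]
      with x hx₁ hx₂ hx
    rw [hx₁, hx₂, hx]
  obtain ⟨U, hU, hUo, hpU⟩ := eventually_nhds_iff.1 hfin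
  refine ⟨U, hUo, hpU, ?_⟩
  ext x
  exact ⟨fun hx => ⟨(hU x hx.2).1 hx.1, hx.2⟩, fun hx => ⟨(hU x hx.2).2 hx.1, hx.2⟩⟩
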